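/- All matroids have a finite ground set. For sets $X$, $Y$ write $X-Y$ for the difference, and $X-e+f$ for $(X-\{e\})\cup\{f\}$. Let $(A_1,A_2)$ and $(B_1,B_2)$ be ordered pairs of bases of a rank-$r$ matroid $M$ that are compatible, that is, $A_1\cap A_2=B_1\cap B_2$ and $A_1\cup A_2=B_1\cup B_2$. A symmetric exchange replaces an ordered pair of bases $(X_1,X_2)$ by $(X_1-e+f,\;X_2+e-f)$, where $e\in X_1-X_2$ and $f\in X_2-X_1$ are such that both new sets are bases. A sequence of symmetric exchanges starting from $(A_1,A_2)$ is strictly monotone (for $(A_1,A_2)$ and $(B_1,B_2)$) if each step decreases $|X_1-B_1|$, where $X_1$ is the first member of the current pair. **Theorem.** There exists a strictly monotone sequence of symmetric exchanges for $(A_1,A_2)$ and $(B_1,B_2)$ of length (a) $r-3|A_1\cap B_1|$, if $M$ is a split matroid, (b) $r-2|A_1\cap B_1|$, if $M$ is a base orderable split matroid, (c) $r-|A_1\cap B_1|-2$, if $M$ is a paving matroid, where a negative number is read as $0$. Here $M$ is *paving* if every set of size at most $r-1$ is independent. $M$ is *base orderable* if for any two bases $A,B$ there is a bijection $\varphi\colon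 A\to B$ such that $A-e+\varphi(e)$ and $B-\varphi(e)+e$ are bases for every $e\in A$. *Split* matroids are those of Joswig and Schröter: let $S$ be the ground set, $r_M$ the rank function and $P$ the convex hull in $\mathbb R^S$ of the incidence vectors of the bases of $M$, let $L$ be the affine hull of $P$, and put $Q=L\cap[0,1]^S$. A split flacet is a flat $F$ such that $\{x\in P: \sum_{e\in F}x_e=r_M(F)\}$ is a facet of $P$ and the hyperplane $h_F=\{x\in L:\sum_{e\in F}x_e=r_M(F)\}$ defines a split of $Q$, i.e. it cuts $Q$ into two full-dimensional cells without creating new vertices. $M$ is split if for any two split flacets $F,G$ either $h_F=h_G$ or $h_F\cap h_G$ is disjoint from the relative interior of $Q$. -/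

import Mathlib

namespace Matroid

variable {α : Type*}

/-- The base polytope `P(M)`: the convex hull of the incidence vectors of the bases of `M`. -/
def basePolytope (M : Matroid α) : Set (α → ℝ) :=
  convexHull ℝ {x | ∃ B, M.IsBase B ∧ x = B.indicator 1}

/-- The intersection of the unit cube with the affine hull of the base polytope.
For a connected matroid this is a hypersimplex. -/
def ambientPolytope (M : Matroid α) : Set (α → ℝ) :=
  (affineSpan ℝ M.basePolytope : Set (α → ℝ)) ∩ Set.Icc 0 1

/-- The linear functional `x ↦ x(F) = ∑ e ∈ F, x e`. -/
def coordSum (F : Finset α) : (α → ℝ) →ₗ[ℝ] ℝ :=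
  ∑ e ∈ F, LinearMap.proj e

/-- The rank of a subset of a finite matroid, as a natural number. -/
noncomputable def natRk (M : Matroid α) (F : Finset α) : ℕ :=
  (M.eRk (F : Set α)).toNat

/-- The hyperplane `{f = c}` defines a split of the polytope `Q`: it cuts `Q` into two
full-dimensional cells (it meets the relative interior of `Q` and does not contain `Q`), and
this subdivision has no new vertices. -/
def DefinesSplit {V : Type*} [AddCommGroup V] [Module ℝ V] [TopologicalSpace V]
    (Q : Set V) (f : V →ₗ[ℝ] ℝ) (c : ℝ) : Prop :=
  (∃ x ∈ intrinsicInterior ℝ Q, f x = c) ∧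
  (∃ x ∈ Q, f x ≠ c) ∧
  ({x ∈ Q | f x ≤ c}).extremePoints ℝ ⊆ Q.extremePoints ℝ ∧
  ({x ∈ Q | c ≤ f x}).extremePoints ℝ ⊆ Q.extremePoints ℝ

/-- A flacet: a flat `F` for which the inequality `x(F) ≤ r(F)`, valid on the base polytope,
defines a facet of it, that is, a nonempty face of codimension one. -/
def IsFlacet (M : Matroid α) (F : Finset α) : Prop :=
  M.IsFlat (F : Set α) ∧
  ({x ∈ M.basePolytope | coordSum F x = M.natRk F}).Nonempty ∧
  Module.finrank ℝ (vectorSpan ℝ {x ∈ M.basePolytope | coordSum F x = M.natRk F}) + 1 =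
    Module.finrank ℝ (vectorSpan ℝ M.basePolytope)

/-- A split flacet: a flacet whose hyperplane `x(F) = r(F)` defines a split of the
intersection of the unit cube with the affine hull of the base polytope. -/
def IsSplitFlacet (M : Matroid α) (F : Finset α) : Prop :=
  M.IsFlacet F ∧ DefinesSplit M.ambientPolytope (coordSum F) (M.natRk F)

/-- The split hyperplane of a split flacet, inside the affine hull of the base polytope. -/
def splitHyperplane (M : Matroid α) (F : Finset α) : Set (α → ℝ) :=
  {x ∈ (affineSpan ℝ M.basePolytope : Set (α → ℝ)) | coordSum F x = M.natRk F}

/-- Split matroids (Joswig and Schröter): the split flacets form a compatible system of splits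
of the affine hull of the base polytope intersected with the unit cube. Two splits are compatible
if they are equal or their hyperplanes do not meet in the relative interior. -/
def IsSplit (M : Matroid α) : Prop :=
  ∀ F G : Finset α, M.IsSplitFlacet F → M.IsSplitFlacet G →
    M.splitHyperplane F ≠ M.splitHyperplane G →
    Disjoint (M.splitHyperplane F ∩ M.splitHyperplane G) (intrinsicInterior ℝ M.ambientPolytope)

/-- Paving matroids: every set of size less than the rank is independent. -/
def IsPaving (M : Matroid α) : Prop :=
  ∀ X : Set α, X ⊆ M.E → X.encard < M.eRank → M.Indep X

/-- Base orderable matroids: any two bases `A`, `B` admit a bijection `φ : A → B` such that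
`A - e + φ(e)` and `B - φ(e) + e` are bases for every `e ∈ A`. -/
def IsBaseOrderable (M : Matroid α) : Prop :=
  ∀ A B : Set α, M.IsBase A → M.IsBase B → ∃ φ : A ≃ B, ∀ e : A,
    M.IsBase (insert (φ e : α) (A \ {(e : α)})) ∧ M.IsBase (insert (e : α) (B \ {(φ e : α)}))

/-- `Y` is obtained from the ordered pair of bases `X` by a symmetric exchange. -/
def SymmExchange (M : Matroid α) (X Y : Set α × Set α) : Prop :=
  M.IsBase X.1 ∧ M.IsBase X.2 ∧ ∃ e ∈ X.1 \ X.2, ∃ f ∈ X.2 \ X.1,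
    Y.1 = insert f (X.1 \ {e}) ∧ Y.2 = insert e (X.2 \ {f}) ∧ M.IsBase Y.1 ∧ M.IsBase Y.2

/-- There is a sequence of exactly `n` symmetric exchanges starting from the pair `A`, such that
each of them decreases the difference of the first member from the first member of `B`. -/
def HasStrictlyMonotoneSeq (M : Matroid α) (A B : Set α × Set α) (n : ℕ) : Prop :=
  ∃ X : ℕ → Set α × Set α, X 0 = A ∧ ∀ i < n,
    M.SymmExchange (X i) (X (i + 1)) ∧ ((X (i + 1)).1 \ B.1).ncard < ((X i).1 \ B.1).ncard

/-- Compatible basis pairs: ordered pairs of bases with the same union and intersection. -/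
def CompatiblePairs (M : Matroid α) (A B : Set α × Set α) : Prop :=
  M.IsBase A.1 ∧ M.IsBase A.2 ∧ M.IsBase B.1 ∧ M.IsBase B.2 ∧
  A.1 ∩ A.2 = B.1 ∩ B.2 ∧ A.1 ∪ A.2 = B.1 ∪ B.2

end Matroid

/-!
Say that `e` and `f` belong to the same class if `𝟙 e - 𝟙 f` is a direction of the base polytope.
Any two bases contain equally many elements of a class. If `X` is a base and `e ∈ X`, `f ∉ X` belong
to the same class although `X - e + f` is not a base, then the component of `e` that remains in the
exchange graph of `X` after deletion of `f` and its neighbours is the complement of a split flacet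
`F` with `|X ∩ F| = r(F)`. In a split matroid the flacets obtained in this way all belong to a
single class `C`, and compatibility of their splits says that any two of them, `H ≠ K`, satisfy
`|H ∩ K ∩ C| + r(C) ≤ r(H ∩ C) + r(K ∩ C)`, where `r(C)` is the number of elements of a base in `C`.
Outside of `C` any two elements of a class can be exchanged, so only `C` matters.

Since the flacets are so far apart, each element is barred from exchange by at most one flacet tight
for `X₁` and one tight for `X₂`. If no exchange is available in `C`, these flacets are `H₁`, `H₂`
(tight for `X₁`) and `K₁`, `K₂` (tight for `X₂`), complementary to each other on the elements still
to be exchanged, and in each of the four parts `Hᵢ ∩ Kⱼ` the numbers of elements to be removed and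
to be added differ by some `t > 0`. As long as `|X₁ - B₁| > 2 * t`, some part allows an exchange,
which preserves this obstruction and `t`. Comparing with the bounds of the flacets gives
`t ≤ |X₁ ∩ B₁|`, and base orderability gives `2 * t ≤ |X₁ ∩ B₁|`. From an unobstructed pair there is
always an exchange to another unobstructed pair, hence a sequence of `|X₁ - B₁|` exchanges.

In a paving matroid, for a base `X` and `f ∉ X` at most one `e ∈ X` fails to be exchangeable for
`f`. Given `f₁ ≠ f₂` in `X₂ - B₂` and three elements of `X₁ - B₁`, one of the three can be replaced
in `X₁` by either `fᵢ`, and it can replace one of the two in `X₂`.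
-/

namespace SplitMatroid

section Exchange

variable {α : Type*} [DecidableEq α] {M : Matroid α} {C X X₁ X₂ B₁ B₂ H K : Finset α} {e f g : α}

/-- The set `X - e + f`. -/
abbrev exchange (X : Finset α) (e f : α) : Finset α := insert f (X.erase e)

lemma exchange_exchange (hf : f ∉ X) : exchange (exchange X e f) f g = exchange X e g := by
  rw [exchange, exchange, Finset.erase_insert (fun h => hf (Finset.mem_of_mem_erase h))]

lemma exchange_exchange_comm (heg : e ≠ g) (hfg : f ≠ g) (hf : f ∈ X) :
    exchange (exchange X f e) g f = exchange X g e := by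
  grind

lemma exchange_sdiff {B : Finset α} (hf : f ∈ B) : exchange X e f \ B = (X \ B).erase e := by
  grind

lemma sdiff_exchange {B : Finset α} (he : e ∉ B) : B \ exchange X e f = (B \ X).erase f := by
  grind

lemma card_exchange_inter (he : e ∈ X) (hf : f ∉ X) (H : Finset α) :
    (exchange X e f ∩ H).card + (if e ∈ H then 1 else 0) =
      (X ∩ H).card + (if f ∈ H then 1 else 0) := by
  have herase : (X.erase e ∩ H).card + (if e ∈ H then 1 else 0) = (X ∩ H).card := by
    rw [Finset.erase_inter]
    split_ifs with heH
    · exact Finset.card_erase_add_one (Finset.mem_inter.2 ⟨he, heH⟩)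
    · rw [Finset.erase_eq_of_notMem (by simp [heH]), add_zero]
  have hinsert : (exchange X e f ∩ H).card = (X.erase e ∩ H).card + (if f ∈ H then 1 else 0) := by
    split_ifs with hfH
    · rw [Finset.insert_inter_of_mem hfH, Finset.card_insert_of_notMem (by simp [hf])]
    · rw [Finset.insert_inter_of_notMem hfH, add_zero]
  omega

lemma card_exchange_inter_of_mem_iff (he : e ∈ X) (hf : f ∉ X) (h : e ∈ H ↔ f ∈ H) :
    (exchange X e f ∩ H).card = (X ∩ H).card := by
  have := card_exchange_inter he hf H
  simp only [h] at this
  omega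

lemma card_inter_add_card_inter_of_compl {T : Finset α} (h : ∀ a ∈ T, (a ∈ H ↔ a ∉ K)) :
    (T ∩ H).card + (T ∩ K).card = T.card := by
  have hK : T ∩ K = T \ H := by
    ext a
    have := h a
    simp only [Finset.mem_inter, Finset.mem_sdiff]
    tauto
  rw [hK, Finset.card_inter_add_card_sdiff]

lemma card_inter_symmDiff_add (T H K : Finset α) :
    (T ∩ symmDiff H K).card + 2 * (T ∩ H ∩ K).card = (T ∩ H).card + (T ∩ K).card := by
  have hH := Finset.card_sdiff_add_card_inter (T ∩ H) K
  have hK := Finset.card_sdiff_add_card_inter (T ∩ K) H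
  have hsplit : T ∩ symmDiff H K = (T ∩ H) \ K ∪ (T ∩ K) \ H := by
    ext a
    simp only [Finset.mem_symmDiff, Finset.mem_inter, Finset.mem_union, Finset.mem_sdiff]
    tauto
  rw [hsplit, Finset.card_union_of_disjoint
    (Finset.disjoint_left.2 fun a ha ha' => by simp_all)]
  rw [Finset.inter_right_comm] at hK
  omega

lemma card_inter_add_card_sdiff_inter (X B H : Finset α) :
    (B ∩ H).card + ((X \ B) ∩ H).card = (X ∩ H).card + ((B \ X) ∩ H).card := by
  have hunion (Y Z : Finset α) : (Y ∩ H).card = ((Y \ Z) ∩ H).card + (Y ∩ Z ∩ H).card := by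
    rw [← Finset.card_sdiff_add_card_inter (Y ∩ H) Z, Finset.inter_right_comm]
    congr 2
    grind
  have hX := hunion X B
  have hB := hunion B X
  rw [Finset.inter_comm B X] at hB
  omega

lemma card_inter_eq_sdiff_add (X B H : Finset α) :
    (X ∩ H).card = ((X \ B) ∩ H).card + (X ∩ B ∩ H).card := by
  rw [← Finset.card_sdiff_add_card_inter (X ∩ H) B, Finset.inter_right_comm]
  congr 2
  grind

omit [DecidableEq α] in
lemma card_eq_of_isBase {X Y : Finset α} (hX : M.IsBase X) (hY : M.IsBase Y) :
    X.card = Y.card := by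
  have hcard := hX.encard_eq_encard_of_isBase hY
  rw [Set.encard_coe_eq_coe_finsetCard, Set.encard_coe_eq_coe_finsetCard] at hcard
  exact_mod_cast hcard

/-- Both `X₁ - e + f` and `X₂ + e - f` are bases. -/
def CanExchange (M : Matroid α) (X₁ X₂ : Finset α) (e f : α) : Prop :=
  M.IsBase (exchange X₁ e f) ∧ M.IsBase (exchange X₂ f e)

lemma CanExchange.symm (h : CanExchange M X₁ X₂ e f) : CanExchange M X₂ X₁ f e :=
  ⟨h.2, h.1⟩

/-- A pair of bases `(X₁, X₂)` that is compatible with the target pair of bases `(B₁, B₂)` and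
differs from it only inside `C`. -/
structure ExchangePair (M : Matroid α) (C X₁ X₂ B₁ B₂ : Finset α) : Prop where
  isBase₁ : M.IsBase X₁
  isBase₂ : M.IsBase X₂
  isBase_target₁ : M.IsBase B₁
  isBase_target₂ : M.IsBase B₂
  sdiff₁ : X₁ \ B₁ = B₂ \ X₂
  sdiff₂ : X₂ \ B₂ = B₁ \ X₁
  subset₁ : X₁ \ B₁ ⊆ C
  subset₂ : X₂ \ B₂ ⊆ C

namespace ExchangePair

lemma symm (h : ExchangePair M C X₁ X₂ B₁ B₂) : ExchangePair M C X₂ X₁ B₂ B₁ :=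
  ⟨h.isBase₂, h.isBase₁, h.isBase_target₂, h.isBase_target₁, h.sdiff₂, h.sdiff₁, h.subset₂,
    h.subset₁⟩

lemma mem_target₂ (h : ExchangePair M C X₁ X₂ B₁ B₂) (he : e ∈ X₁ \ B₁) : e ∈ B₂ :=
  (Finset.mem_sdiff.1 (h.sdiff₁ ▸ he)).1

lemma notMem₂ (h : ExchangePair M C X₁ X₂ B₁ B₂) (he : e ∈ X₁ \ B₁) : e ∉ X₂ :=
  (Finset.mem_sdiff.1 (h.sdiff₁ ▸ he)).2

lemma card_sdiff_eq (h : ExchangePair M C X₁ X₂ B₁ B₂) :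
    (X₁ \ B₁).card = (X₂ \ B₂).card := by
  rw [h.sdiff₂]
  exact Finset.card_sdiff_comm (card_eq_of_isBase h.isBase₁ h.isBase_target₁)

lemma after_exchange (h : ExchangePair M C X₁ X₂ B₁ B₂) (he : e ∈ X₁ \ B₁) (hf : f ∈ X₂ \ B₂)
    (hef : CanExchange M X₁ X₂ e f) :
    ExchangePair M C (exchange X₁ e f) (exchange X₂ f e) B₁ B₂ where
  isBase₁ := hef.1
  isBase₂ := hef.2
  isBase_target₁ := h.isBase_target₁
  isBase_target₂ := h.isBase_target₂
  sdiff₁ := by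
    rw [exchange_sdiff (h.symm.mem_target₂ hf), sdiff_exchange (Finset.mem_sdiff.1 hf).2,
      h.sdiff₁]
  sdiff₂ := by
    rw [exchange_sdiff (h.mem_target₂ he), sdiff_exchange (Finset.mem_sdiff.1 he).2,
      h.sdiff₂]
  subset₁ := by
    rw [exchange_sdiff (h.symm.mem_target₂ hf)]
    exact (Finset.erase_subset _ _).trans h.subset₁
  subset₂ := by
    rw [exchange_sdiff (h.mem_target₂ he)]
    exact (Finset.erase_subset _ _).trans h.subset₂

end ExchangePair

end Exchange

section Sequence

variable {α : Type*} {M : Matroid α}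

lemma hasStrictlyMonotoneSeq_zero (A B : Set α × Set α) : M.HasStrictlyMonotoneSeq A B 0 :=
  ⟨fun _ => A, rfl, fun _ hi => absurd hi (Nat.not_lt_zero _)⟩

lemma hasStrictlyMonotoneSeq_of_le {A B : Set α × Set α} {m n : ℕ}
    (hs : M.HasStrictlyMonotoneSeq A B n) (hmn : m ≤ n) : M.HasStrictlyMonotoneSeq A B m := by
  obtain ⟨X, hX, hstep⟩ := hs
  exact ⟨X, hX, fun i hi => hstep i (hi.trans_le hmn)⟩

lemma hasStrictlyMonotoneSeq_succ {A A' B : Set α × Set α} {n : ℕ} (hA : M.SymmExchange A A')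
    (hlt : (A'.1 \ B.1).ncard < (A.1 \ B.1).ncard) (hs : M.HasStrictlyMonotoneSeq A' B n) :
    M.HasStrictlyMonotoneSeq A B (n + 1) := by
  obtain ⟨X, rfl, hstep⟩ := hs
  refine ⟨fun i => Nat.casesOn i A X, rfl, fun i hi => ?_⟩
  cases i with
  | zero => exact ⟨hA, hlt⟩
  | succ i => exact hstep i (by omega)

variable [DecidableEq α] {C X₁ X₂ B₁ B₂ : Finset α} {e f : α} {n : ℕ}

lemma ExchangePair.hasStrictlyMonotoneSeq_cons (h : ExchangePair M C X₁ X₂ B₁ B₂)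
    (he : e ∈ X₁ \ B₁) (hf : f ∈ X₂ \ B₂) (hef : CanExchange M X₁ X₂ e f)
    (hs : M.HasStrictlyMonotoneSeq ((exchange X₁ e f : Finset α),
      (exchange X₂ f e : Finset α)) (B₁, B₂) n) :
    M.HasStrictlyMonotoneSeq (X₁, X₂) (B₁, B₂) (n + 1) := by
  refine hasStrictlyMonotoneSeq_succ
    ⟨h.isBase₁, h.isBase₂, e, ⟨(Finset.mem_sdiff.1 he).1, h.notMem₂ he⟩, f,
      ⟨(Finset.mem_sdiff.1 hf).1, h.symm.notMem₂ hf⟩, by simp, by simp, hef.1, hef.2⟩ ?_ hs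
  simpa only [← Finset.coe_sdiff, Set.ncard_coe_finset,
    exchange_sdiff (h.symm.mem_target₂ hf)] using Finset.card_erase_lt_of_mem he

end Sequence

/-! ### Split systems and obstructions -/

/-- A hypergraph on a subset `ground` of a matroid that meets every base in `rank` elements, with an
upper bound for the number of elements that a base has in a hyperedge. Any two hyperedges are far
apart, and an exchange inside `ground` fails only if it violates the bound of a hyperedge. -/
structure SplitSystem {α : Type*} [DecidableEq α] (M : Matroid α) where
  ground : Finset α
  rank : ℕ
  edges : Set (Finset α)
  bound : Finset α → ℕ
  card_inter_ground : ∀ ⦃X : Finset α⦄, M.IsBase X → (X ∩ ground).card = rank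
  subset_ground : ∀ ⦃H⦄, H ∈ edges → H ⊆ ground
  card_inter_le : ∀ ⦃X : Finset α⦄, M.IsBase X → ∀ ⦃H⦄, H ∈ edges → (X ∩ H).card ≤ bound H
  card_inter_add_rank_le :
    ∀ ⦃H⦄, H ∈ edges → ∀ ⦃K⦄, K ∈ edges → H ≠ K → (H ∩ K).card + rank ≤ bound H + bound K
  exists_blocking : ∀ ⦃X : Finset α⦄, M.IsBase X → ∀ ⦃e f⦄, e ∈ X → e ∈ ground → f ∉ X →
    f ∈ ground → ¬ M.IsBase (exchange X e f) →
    ∃ H ∈ edges, (X ∩ H).card = bound H ∧ e ∉ H ∧ f ∈ H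

section System

variable {α : Type*} [DecidableEq α] {M : Matroid α} {S : SplitSystem M}
  {X X₁ X₂ B₁ B₂ H K : Finset α} {a e f : α}

namespace SplitSystem

/-- A hyperedge is tight for `X` if its bound is attained by `X`. -/
def IsTight (S : SplitSystem M) (X H : Finset α) : Prop :=
  H ∈ S.edges ∧ (X ∩ H).card = S.bound H

/-- A tight hyperedge `H` bars `a` from being exchanged with elements on the other side of `H`:
it bars `a ∈ X` from being removed and `a ∉ X` from being added. -/
def Bars (S : SplitSystem M) (X H : Finset α) (a : α) : Prop :=
  S.IsTight X H ∧ (a ∈ H ↔ a ∉ X)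

lemma card_sdiff_add_card_sdiff_union_le (hX : M.IsBase X) (hH : H ∈ S.edges) (hK : K ∈ S.edges)
    (hne : H ≠ K) :
    ((H ∩ K) \ X).card + ((X ∩ S.ground) \ (H ∪ K)).card + (X ∩ H).card + (X ∩ K).card ≤
      S.bound H + S.bound K := by
  have hsep := S.card_inter_add_rank_le hH hK hne
  have hinter := Finset.card_sdiff_add_card_inter (H ∩ K) X
  have hground := Finset.card_sdiff_add_card_inter (X ∩ S.ground) (H ∪ K)
  have hX' := Finset.card_union_add_card_inter (X ∩ H) (X ∩ K)
  rw [S.card_inter_ground hX] at hground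
  have hunion : X ∩ H ∪ X ∩ K = X ∩ S.ground ∩ (H ∪ K) := by
    have := S.subset_ground hH
    have := S.subset_ground hK
    grind
  rw [hunion, ← Finset.inter_inter_distrib_left, Finset.inter_comm X (H ∩ K)] at hX'
  omega

lemma Bars.eq (hX : M.IsBase X) (ha : a ∈ S.ground) (hH : S.Bars X H a) (hK : S.Bars X K a) :
    H = K := by
  by_contra hne
  have hsep := card_sdiff_add_card_sdiff_union_le hX hH.1.1 hK.1.1 hne
  rw [hH.1.2, hK.1.2] at hsep
  have hinter : H ∩ K ⊆ X := Finset.sdiff_eq_empty_iff_subset.1 (Finset.card_eq_zero.1 (by omega))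
  have hunion : X ∩ S.ground ⊆ H ∪ K :=
    Finset.sdiff_eq_empty_iff_subset.1 (Finset.card_eq_zero.1 (by omega))
  have := @hinter a
  have := @hunion a
  have := hH.2
  have := hK.2
  grind

lemma Bars.eq_iff (hX : M.IsBase X) (ha : a ∈ S.ground) (hH : S.Bars X H a)
    (hK : S.IsTight X K) : H = K ↔ (a ∈ K ↔ a ∉ X) :=
  ⟨fun heq => heq ▸ hH.2, fun haK => hH.eq hX ha ⟨hK, haK⟩⟩

lemma exists_bars (hX : M.IsBase X) (he : e ∈ X) (heS : e ∈ S.ground) (hf : f ∉ X)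
    (hfS : f ∈ S.ground) (hef : ¬ M.IsBase (exchange X e f)) :
    ∃ H, S.Bars X H e ∧ S.Bars X H f := by
  obtain ⟨H, hH, hXH, heH, hfH⟩ := S.exists_blocking hX he heS hf hfS hef
  exact ⟨H, ⟨⟨hH, hXH⟩, by tauto⟩, ⟨hH, hXH⟩, by tauto⟩

namespace IsTight

lemma isBase_exchange (hH : S.IsTight X H) (hX : M.IsBase X) (he : e ∈ X) (heS : e ∈ S.ground)
    (hf : f ∉ X) (hfS : f ∈ S.ground) (hef : e ∈ H ↔ f ∈ H) : M.IsBase (exchange X e f) := by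
  by_contra hbase
  obtain ⟨K, heK, hfK⟩ := exists_bars hX he heS hf hfS hbase
  have heK' := heK.2
  have hfK' := hfK.2
  by_cases hfH : f ∈ H
  · obtain rfl := Bars.eq hX hfS ⟨hH, by tauto⟩ hfK
    tauto
  · obtain rfl := Bars.eq hX heS ⟨hH, by tauto⟩ heK
    tauto

lemma mem_of_isBase_exchange (hH : S.IsTight X H) (he : e ∈ X) (hf : f ∉ X)
    (hef : M.IsBase (exchange X e f)) (hfH : f ∈ H) : e ∈ H := by
  by_contra heH
  have hle := S.card_inter_le hef hH.1
  have hcard := card_exchange_inter he hf H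
  rw [if_neg heH, if_pos hfH, hH.2] at hcard
  omega

lemma mem_of_exchange (hH : S.IsTight (exchange X e f) H) (hX : M.IsBase X) (he : e ∈ X)
    (hf : f ∉ X) (heH : e ∈ H) : f ∈ H := by
  refine hH.mem_of_isBase_exchange (f := e) (by simp) (by grind) ?_ heH
  rwa [exchange_exchange hf, exchange, Finset.insert_erase he]

end IsTight

lemma isTight_exchange_iff (he : e ∈ X) (hf : f ∉ X) (hef : e ∈ H ↔ f ∈ H) :
    S.IsTight (exchange X e f) H ↔ S.IsTight X H := by
  rw [IsTight, IsTight, card_exchange_inter_of_mem_iff he hf hef]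

lemma mem_iff_mem_of_isTight_exchange {H₁ H₂ : Finset α} (hX : M.IsBase X) (he : e ∈ X)
    (hf : f ∉ X) (hH₁ : S.IsTight (exchange X e f) H₁) (hH₂ : S.IsTight (exchange X e f) H₂)
    (heH : e ∈ H₁ ↔ e ∉ H₂) (hfH : f ∈ H₁ ↔ f ∉ H₂) : e ∈ H₁ ↔ f ∈ H₁ := by
  have := hH₁.mem_of_exchange hX he hf
  have := hH₂.mem_of_exchange hX he hf
  tauto

end SplitSystem

namespace ExchangePair

lemma card_sdiff_add (h : ExchangePair M S.ground X₁ X₂ B₁ B₂) :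
    (X₁ \ B₁).card + (X₁ ∩ B₁ ∩ S.ground).card = S.rank := by
  rw [← S.card_inter_ground h.isBase₁, card_inter_eq_sdiff_add X₁ B₁,
    Finset.inter_eq_left.2 h.subset₁]

lemma card_inter_inter_eq (h : ExchangePair M S.ground X₁ X₂ B₁ B₂) :
    (X₁ ∩ B₁ ∩ S.ground).card = (X₂ ∩ B₂ ∩ S.ground).card := by
  have h₁ := h.card_sdiff_add
  have h₂ := h.symm.card_sdiff_add
  have heq := h.card_sdiff_eq
  omega

lemma card_inter_le (h : ExchangePair M S.ground X₁ X₂ B₁ B₂) (hH : S.IsTight X₁ H) :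
    ((X₂ \ B₂) ∩ H).card ≤ ((X₁ \ B₁) ∩ H).card := by
  have hcard := card_inter_add_card_sdiff_inter X₁ B₁ H
  have hle := S.card_inter_le h.isBase_target₁ hH.1
  rw [← h.sdiff₂, hH.2] at hcard
  omega

lemma subset_of_subset (h : ExchangePair M S.ground X₁ X₂ B₁ B₂) (hH : S.IsTight X₁ H)
    (hQ : X₂ \ B₂ ⊆ H) : X₁ \ B₁ ⊆ H := by
  have hle := h.card_inter_le hH
  rw [Finset.inter_eq_left.2 hQ, ← h.card_sdiff_eq] at hle
  exact Finset.inter_eq_left.1 (Finset.eq_of_subset_of_card_le Finset.inter_subset_left hle)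

lemma disjoint_of_disjoint (h : ExchangePair M S.ground X₁ X₂ B₁ B₂) (hH : S.IsTight X₁ H)
    (hP : Disjoint (X₁ \ B₁) H) : Disjoint (X₂ \ B₂) H := by
  have hle := h.card_inter_le hH
  rwa [Finset.disjoint_iff_inter_eq_empty.1 hP, Finset.card_empty, Nat.le_zero,
    Finset.card_eq_zero, ← Finset.disjoint_iff_inter_eq_empty] at hle

lemma card_inter_eq_of_compl (h : ExchangePair M S.ground X₁ X₂ B₁ B₂) (hH : S.IsTight X₁ H)
    (hK : S.IsTight X₁ K) (hcompl : ∀ a ∈ X₁ \ B₁ ∪ X₂ \ B₂, (a ∈ H ↔ a ∉ K)) :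
    ((X₁ \ B₁) ∩ H).card = ((X₂ \ B₂) ∩ H).card := by
  have hP := card_inter_add_card_inter_of_compl
    fun a ha => hcompl a (Finset.mem_union_left (X₂ \ B₂) ha)
  have hQ := card_inter_add_card_inter_of_compl
    fun a ha => hcompl a (Finset.mem_union_right (X₁ \ B₁) ha)
  have := h.card_inter_le hH
  have := h.card_inter_le hK
  have := h.card_sdiff_eq
  omega

lemma mem_ground (h : ExchangePair M S.ground X₁ X₂ B₁ B₂) (ha : a ∈ X₁ \ B₁ ∪ X₂ \ B₂) :
    a ∈ S.ground :=
  (Finset.mem_union.1 ha).elim (fun h' => h.subset₁ h') fun h' => h.subset₂ h'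

lemma mem_iff_notMem (h : ExchangePair M S.ground X₁ X₂ B₁ B₂) (ha : a ∈ X₁ \ B₁ ∪ X₂ \ B₂) :
    a ∈ X₁ ↔ a ∉ X₂ := by
  rcases Finset.mem_union.1 ha with ha | ha
  · exact iff_of_true (Finset.mem_sdiff.1 ha).1 (h.notMem₂ ha)
  · exact iff_of_false (h.symm.notMem₂ ha) (not_not.2 (Finset.mem_sdiff.1 ha).1)

end ExchangePair

end System

section Obstruction

variable {α : Type*} [DecidableEq α] {M : Matroid α} {S : SplitSystem M}
  {X₁ X₂ B₁ B₂ H K H₁ H₂ K₁ K₂ J₁ J₂ L₁ L₂ : Finset α} {a e f q : α} {t s : ℕ}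

lemma card_add_of_compl {P Q : Finset α} (hP : ∀ a ∈ P, (a ∈ K₁ ↔ a ∉ K₂))
    (hQ : ∀ a ∈ Q, (a ∈ K₁ ↔ a ∉ K₂)) (hcard : (P ∩ H).card = (Q ∩ H).card)
    (ht : (Q ∩ H ∩ K₁).card = (P ∩ H ∩ K₁).card + t) :
    (P ∩ H ∩ K₂).card = (Q ∩ H ∩ K₂).card + t := by
  have hPH := card_inter_add_card_inter_of_compl
    fun a (ha : a ∈ P ∩ H) => hP a (Finset.mem_inter.1 ha).1
  have hQH := card_inter_add_card_inter_of_compl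
    fun a (ha : a ∈ Q ∩ H) => hQ a (Finset.mem_inter.1 ha).1
  omega

lemma card_erase_inter_eq_iff {P Q : Finset α} (he : e ∈ P) (hf : f ∈ Q) (hef : e ∈ H ↔ f ∈ H) :
    (Q.erase f ∩ H).card = (P.erase e ∩ H).card + t ↔ (Q ∩ H).card = (P ∩ H).card + t := by
  by_cases heH : e ∈ H
  · have hP := Finset.card_erase_add_one (Finset.mem_inter.2 ⟨he, heH⟩)
    have hQ := Finset.card_erase_add_one (Finset.mem_inter.2 ⟨hf, hef.1 heH⟩)
    rw [Finset.erase_inter, Finset.erase_inter]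
    omega
  · rw [Finset.erase_inter, Finset.erase_inter, Finset.erase_eq_of_notMem (a := e) (by simp [heH]),
      Finset.erase_eq_of_notMem (a := f) (by simp [← hef, heH])]

lemma forall_mem_erase_union_erase_iff {P Q : Finset α} {p : α → Prop} (he : p e) (hf : p f) :
    (∀ a ∈ P.erase e ∪ Q.erase f, p a) ↔ ∀ a ∈ P ∪ Q, p a := by
  refine ⟨fun hp a ha => ?_, fun hp a ha => hp a (Finset.union_subset_union
    (Finset.erase_subset e P) (Finset.erase_subset f Q) ha)⟩
  obtain rfl | hae := eq_or_ne a e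
  · exact he
  obtain rfl | haf := eq_or_ne a f
  · exact hf
  exact hp a (by simpa [hae, haf] using ha)

/-- Two hyperedges tight for `X₁` and two hyperedges tight for `X₂`, each two complementary on the
elements to be exchanged, which they thus divide into four parts. Only exchanges inside a part
are possible, but the part `H₁ ∩ K₁` has to gain `t` more elements than it loses. -/
structure Obstruction (S : SplitSystem M) (X₁ X₂ B₁ B₂ H₁ H₂ K₁ K₂ : Finset α) (t : ℕ) : Prop where
  isTight_H₁ : S.IsTight X₁ H₁
  isTight_H₂ : S.IsTight X₁ H₂
  isTight_K₁ : S.IsTight X₂ K₁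
  isTight_K₂ : S.IsTight X₂ K₂
  mem_H_iff : ∀ a ∈ X₁ \ B₁ ∪ X₂ \ B₂, (a ∈ H₁ ↔ a ∉ H₂)
  mem_K_iff : ∀ a ∈ X₁ \ B₁ ∪ X₂ \ B₂, (a ∈ K₁ ↔ a ∉ K₂)
  card_add : ((X₂ \ B₂) ∩ H₁ ∩ K₁).card = ((X₁ \ B₁) ∩ H₁ ∩ K₁).card + t
  pos : 0 < t

/-- The pair `(X₁, X₂)` has an obstruction to reaching `(B₁, B₂)`. -/
def IsObstructed (S : SplitSystem M) (X₁ X₂ B₁ B₂ : Finset α) : Prop :=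
  ∃ H₁ H₂ K₁ K₂ t, Obstruction S X₁ X₂ B₁ B₂ H₁ H₂ K₁ K₂ t

namespace Obstruction

lemma card_inter_H₁ (hO : Obstruction S X₁ X₂ B₁ B₂ H₁ H₂ K₁ K₂ t)
    (h : ExchangePair M S.ground X₁ X₂ B₁ B₂) :
    ((X₁ \ B₁) ∩ H₁).card = ((X₂ \ B₂) ∩ H₁).card :=
  h.card_inter_eq_of_compl hO.isTight_H₁ hO.isTight_H₂ hO.mem_H_iff

lemma card_inter_K₁ (hO : Obstruction S X₁ X₂ B₁ B₂ H₁ H₂ K₁ K₂ t)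
    (h : ExchangePair M S.ground X₁ X₂ B₁ B₂) :
    ((X₁ \ B₁) ∩ K₁).card = ((X₂ \ B₂) ∩ K₁).card := by
  refine (h.symm.card_inter_eq_of_compl hO.isTight_K₁ hO.isTight_K₂ ?_).symm
  rw [Finset.union_comm]
  exact hO.mem_K_iff

lemma card_add₁₂ (hO : Obstruction S X₁ X₂ B₁ B₂ H₁ H₂ K₁ K₂ t)
    (h : ExchangePair M S.ground X₁ X₂ B₁ B₂) :
    ((X₁ \ B₁) ∩ H₁ ∩ K₂).card = ((X₂ \ B₂) ∩ H₁ ∩ K₂).card + t :=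
  card_add_of_compl (fun a ha => hO.mem_K_iff a (Finset.mem_union_left _ ha))
    (fun a ha => hO.mem_K_iff a (Finset.mem_union_right _ ha))
    (hO.card_inter_H₁ h) hO.card_add

lemma card_add₂₁ (hO : Obstruction S X₁ X₂ B₁ B₂ H₁ H₂ K₁ K₂ t)
    (h : ExchangePair M S.ground X₁ X₂ B₁ B₂) :
    ((X₁ \ B₁) ∩ H₂ ∩ K₁).card = ((X₂ \ B₂) ∩ H₂ ∩ K₁).card + t := by
  rw [Finset.inter_right_comm _ H₂, Finset.inter_right_comm _ H₂]
  refine card_add_of_compl (fun a ha => hO.mem_H_iff a (Finset.mem_union_left _ ha))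
    (fun a ha => hO.mem_H_iff a (Finset.mem_union_right _ ha)) (hO.card_inter_K₁ h) ?_
  rw [Finset.inter_right_comm, hO.card_add, Finset.inter_right_comm]

lemma card_add₂₂ (hO : Obstruction S X₁ X₂ B₁ B₂ H₁ H₂ K₁ K₂ t)
    (h : ExchangePair M S.ground X₁ X₂ B₁ B₂) :
    ((X₂ \ B₂) ∩ H₂ ∩ K₂).card = ((X₁ \ B₁) ∩ H₂ ∩ K₂).card + t :=
  card_add_of_compl (fun a ha => hO.mem_K_iff a (Finset.mem_union_right _ ha))
    (fun a ha => hO.mem_K_iff a (Finset.mem_union_left _ ha))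
    (h.card_inter_eq_of_compl hO.isTight_H₂ hO.isTight_H₁
      fun a ha => by have := hO.mem_H_iff a ha; tauto).symm (hO.card_add₂₁ h)

lemma flip (hO : Obstruction S X₁ X₂ B₁ B₂ H₁ H₂ K₁ K₂ t)
    (h : ExchangePair M S.ground X₁ X₂ B₁ B₂) : Obstruction S X₁ X₂ B₁ B₂ H₂ H₁ K₂ K₁ t :=
  ⟨hO.isTight_H₂, hO.isTight_H₁, hO.isTight_K₂, hO.isTight_K₁,
    fun a ha => by have := hO.mem_H_iff a ha; tauto,
    fun a ha => by have := hO.mem_K_iff a ha; tauto, hO.card_add₂₂ h, hO.pos⟩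

lemma symm (hO : Obstruction S X₁ X₂ B₁ B₂ H₁ H₂ K₁ K₂ t)
    (h : ExchangePair M S.ground X₁ X₂ B₁ B₂) : Obstruction S X₂ X₁ B₂ B₁ K₁ K₂ H₂ H₁ t where
  isTight_H₁ := hO.isTight_K₁
  isTight_H₂ := hO.isTight_K₂
  isTight_K₁ := hO.isTight_H₂
  isTight_K₂ := hO.isTight_H₁
  mem_H_iff a ha := hO.mem_K_iff a (Finset.union_comm (X₁ \ B₁) _ ▸ ha)
  mem_K_iff a ha := by
    have := hO.mem_H_iff a (Finset.union_comm (X₁ \ B₁) _ ▸ ha)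
    tauto
  card_add := by
    rw [Finset.inter_right_comm, hO.card_add₂₁ h, Finset.inter_right_comm]
  pos := hO.pos

lemma two_mul_le_card (hO : Obstruction S X₁ X₂ B₁ B₂ H₁ H₂ K₁ K₂ t)
    (h : ExchangePair M S.ground X₁ X₂ B₁ B₂) : 2 * t ≤ (X₁ \ B₁).card := by
  have hH := card_inter_add_card_inter_of_compl
    fun a ha => hO.mem_H_iff a (Finset.mem_union_left (X₂ \ B₂) ha)
  have h₁ : ((X₁ \ B₁) ∩ H₁ ∩ K₂).card ≤ ((X₁ \ B₁) ∩ H₁).card :=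
    Finset.card_le_card Finset.inter_subset_left
  have h₂ : ((X₁ \ B₁) ∩ H₂ ∩ K₁).card ≤ ((X₁ \ B₁) ∩ H₂).card :=
    Finset.card_le_card Finset.inter_subset_left
  have := hO.card_add₁₂ h
  have := hO.card_add₂₁ h
  omega

lemma exists_mem₁₁ (hO : Obstruction S X₁ X₂ B₁ B₂ H₁ H₂ K₁ K₂ t) :
    ∃ q ∈ X₂ \ B₂, q ∈ H₁ ∧ q ∈ K₁ := by
  obtain ⟨q, hq⟩ : ((X₂ \ B₂) ∩ H₁ ∩ K₁).Nonempty := by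
    have := hO.pos
    rw [← Finset.card_pos, hO.card_add]
    omega
  simp only [Finset.mem_inter] at hq
  exact ⟨q, hq.1.1, hq.1.2, hq.2⟩

lemma exists_mem₁₂ (hO : Obstruction S X₁ X₂ B₁ B₂ H₁ H₂ K₁ K₂ t)
    (h : ExchangePair M S.ground X₁ X₂ B₁ B₂) : ∃ p ∈ X₁ \ B₁, p ∈ H₁ ∧ p ∈ K₂ :=
  (((hO.symm h).flip h.symm).exists_mem₁₁).imp fun _ hp => ⟨hp.1, hp.2.2, hp.2.1⟩

lemma le_card_inter (hO : Obstruction S X₁ X₂ B₁ B₂ H₁ H₂ K₁ K₂ t)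
    (h : ExchangePair M S.ground X₁ X₂ B₁ B₂) : t ≤ (X₁ ∩ B₁ ∩ S.ground).card := by
  have hne : H₁ ≠ K₁ := by
    rintro rfl
    obtain ⟨p, hp, hpH, hpK⟩ := hO.exists_mem₁₂ h
    exact (hO.mem_K_iff p (Finset.mem_union_left _ hp)).1 hpH hpK
  have hsep := SplitSystem.card_sdiff_add_card_sdiff_union_le h.isBase₁ hO.isTight_H₁.1
    hO.isTight_K₁.1 hne
  have hQ : ((X₂ \ B₂) ∩ H₁ ∩ K₁).card ≤ ((H₁ ∩ K₁) \ X₁).card := by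
    refine Finset.card_le_card fun a ha => ?_
    simp only [Finset.mem_inter] at ha
    simpa [ha.1.2, ha.2] using h.symm.notMem₂ ha.1.1
  have hP := card_inter_eq_sdiff_add X₁ B₁ K₁
  have hX₂ := card_inter_eq_sdiff_add X₂ B₂ K₁
  have hB₂ : (X₂ ∩ B₂ ∩ K₁).card ≤ (X₂ ∩ B₂ ∩ S.ground).card :=
    Finset.card_le_card (Finset.inter_subset_inter_left (S.subset_ground hO.isTight_K₁.1))
  rw [hO.isTight_H₁.2, ← hO.isTight_K₁.2] at hsep
  have := hO.card_inter_K₁ h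
  have := h.card_inter_inter_eq
  have := hO.card_add
  omega

end Obstruction

lemma obstruction_exchange_iff (h : ExchangePair M S.ground X₁ X₂ B₁ B₂) (he : e ∈ X₁ \ B₁)
    (hf : f ∈ X₂ \ B₂) (heH : e ∈ H₁ ↔ e ∉ H₂) (hfH : f ∈ H₁ ↔ f ∉ H₂) (heK : e ∈ K₁ ↔ e ∉ K₂)
    (hfK : f ∈ K₁ ↔ f ∉ K₂) (hH : e ∈ H₁ ↔ f ∈ H₁) (hK : e ∈ K₁ ↔ f ∈ K₁) :
    Obstruction S (exchange X₁ e f) (exchange X₂ f e) B₁ B₂ H₁ H₂ K₁ K₂ t ↔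
      Obstruction S X₁ X₂ B₁ B₂ H₁ H₂ K₁ K₂ t := by
  have hP : exchange X₁ e f \ B₁ = (X₁ \ B₁).erase e := exchange_sdiff (h.symm.mem_target₂ hf)
  have hQ : exchange X₂ f e \ B₂ = (X₂ \ B₂).erase f := exchange_sdiff (h.mem_target₂ he)
  have he' := Finset.mem_sdiff.1 he
  have hf' := Finset.mem_sdiff.1 hf
  have tight_H {H : Finset α} (hef : e ∈ H ↔ f ∈ H) :=
    SplitSystem.isTight_exchange_iff (S := S) he'.1 (h.symm.notMem₂ hf) hef
  have tight_K {K : Finset α} (hef : e ∈ K ↔ f ∈ K) :=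
    SplitSystem.isTight_exchange_iff (S := S) hf'.1 (h.notMem₂ he) hef.symm
  have hH₂ : e ∈ H₂ ↔ f ∈ H₂ := by tauto
  have hK₂ : e ∈ K₂ ↔ f ∈ K₂ := by tauto
  have forall_H := forall_mem_erase_union_erase_iff (P := X₁ \ B₁) (Q := X₂ \ B₂)
    (p := fun a => a ∈ H₁ ↔ a ∉ H₂) heH hfH
  have forall_K := forall_mem_erase_union_erase_iff (P := X₁ \ B₁) (Q := X₂ \ B₂)
    (p := fun a => a ∈ K₁ ↔ a ∉ K₂) heK hfK
  have card_iff : ((exchange X₂ f e \ B₂) ∩ H₁ ∩ K₁).card =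
      ((exchange X₁ e f \ B₁) ∩ H₁ ∩ K₁).card + t ↔
      ((X₂ \ B₂) ∩ H₁ ∩ K₁).card = ((X₁ \ B₁) ∩ H₁ ∩ K₁).card + t := by
    simp only [hP, hQ, Finset.inter_assoc]
    exact card_erase_inter_eq_iff he hf (by simp only [Finset.mem_inter, hH, hK])
  rw [← hP, ← hQ] at forall_H forall_K
  constructor
  · intro hO
    exact ⟨(tight_H hH).1 hO.isTight_H₁, (tight_H hH₂).1 hO.isTight_H₂,
      (tight_K hK).1 hO.isTight_K₁, (tight_K hK₂).1 hO.isTight_K₂,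
      forall_H.1 hO.mem_H_iff, forall_K.1 hO.mem_K_iff,
      card_iff.1 hO.card_add, hO.pos⟩
  · intro hO
    exact ⟨(tight_H hH).2 hO.isTight_H₁, (tight_H hH₂).2 hO.isTight_H₂,
      (tight_K hK).2 hO.isTight_K₁, (tight_K hK₂).2 hO.isTight_K₂,
      forall_H.2 hO.mem_H_iff, forall_K.2 hO.mem_K_iff,
      card_iff.2 hO.card_add, hO.pos⟩

end Obstruction

section Stuck

variable {α : Type*} [DecidableEq α] {M : Matroid α} {S : SplitSystem M}
  {X₁ X₂ B₁ B₂ : Finset α} {e : α}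

omit [DecidableEq α] in
lemma exists_labels_of_agree {β γ : Type*} {P Q : Finset α} {h : α → β} {k : α → γ}
    (hP : P.Nonempty) (hagree : ∀ p ∈ P, ∀ q ∈ Q, h p = h q ∨ k p = k q)
    (hh : ∀ p ∈ P, ∃ q ∈ Q, h p ≠ h q) (hk : ∀ p ∈ P, ∃ q ∈ Q, k p ≠ k q)
    (hk' : ∀ q ∈ Q, ∃ p ∈ P, k q ≠ k p) :
    ∃ p₁ ∈ P, ∃ p₂ ∈ P, h p₁ ≠ h p₂ ∧ k p₁ ≠ k p₂ ∧
      (∀ p ∈ P, h p = h p₁ ∧ k p = k p₁ ∨ h p = h p₂ ∧ k p = k p₂) ∧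
      (∀ q ∈ Q, h q = h p₁ ∧ k q = k p₂ ∨ h q = h p₂ ∧ k q = k p₁) ∧
      ∃ q ∈ Q, h q = h p₁ ∧ k q = k p₂ := by
  obtain ⟨p₁, hp₁⟩ := hP
  obtain ⟨q₂, hq₂, hne₂⟩ := hh p₁ hp₁
  obtain ⟨q₁, hq₁, hne₁⟩ := hk p₁ hp₁
  obtain ⟨p₂, hp₂, hne⟩ := hk' q₂ hq₂
  have := hagree p₁ hp₁ q₁ hq₁
  have := hagree p₁ hp₁ q₂ hq₂
  have := hagree p₂ hp₂ q₁ hq₁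
  have := hagree p₂ hp₂ q₂ hq₂
  refine ⟨p₁, hp₁, p₂, hp₂, ?_, ?_, fun p hp => ?_, fun q hq => ?_, q₁, hq₁, ?_⟩
  · grind
  · grind
  · have := hagree p hp q₁ hq₁
    have := hagree p hp q₂ hq₂
    grind
  · have := hagree p₁ hp₁ q hq
    have := hagree p₂ hp₂ q hq
    grind
  · grind

namespace ExchangePair

lemma exists_notMem_of_bars (h : ExchangePair M S.ground X₁ X₂ B₁ B₂) (he : e ∈ X₁ \ B₁)
    {H : Finset α} (hH : S.Bars X₁ H e) : ∃ f ∈ X₂ \ B₂, f ∉ H := by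
  by_contra! hQ
  exact hH.2.1 (h.subset_of_subset hH.1 hQ he) (Finset.mem_sdiff.1 he).1

lemma exists_mem_of_bars (h : ExchangePair M S.ground X₁ X₂ B₁ B₂) (he : e ∈ X₁ \ B₁)
    {K : Finset α} (hK : S.Bars X₂ K e) : ∃ f ∈ X₂ \ B₂, f ∈ K := by
  by_contra! hQ
  exact Finset.disjoint_left.1 (h.symm.disjoint_of_disjoint hK.1 (Finset.disjoint_left.2 hQ)) he
    (hK.2.2 (h.notMem₂ he))

lemma exists_bars_or_exists_bars (h : ExchangePair M S.ground X₁ X₂ B₁ B₂) {f : α}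
    (he : e ∈ X₁ \ B₁) (hf : f ∈ X₂ \ B₂) (hef : ¬ CanExchange M X₁ X₂ e f) :
    (∃ H, S.Bars X₁ H e ∧ S.Bars X₁ H f) ∨ ∃ K, S.Bars X₂ K e ∧ S.Bars X₂ K f := by
  rw [CanExchange, not_and_or] at hef
  refine hef.imp (SplitSystem.exists_bars h.isBase₁ (Finset.mem_sdiff.1 he).1 (h.subset₁ he)
    (h.symm.notMem₂ hf) (h.subset₂ hf)) fun hbase => ?_
  obtain ⟨K, hfK, heK⟩ := SplitSystem.exists_bars h.isBase₂ (Finset.mem_sdiff.1 hf).1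
    (h.subset₂ hf) (h.notMem₂ he) (h.subset₁ he) hbase
  exact ⟨K, heK, hfK⟩

lemma exists_bars_of_stuck (h : ExchangePair M S.ground X₁ X₂ B₁ B₂) (he : e ∈ X₁ \ B₁)
    (hstuck : ∀ f ∈ X₂ \ B₂, ¬ CanExchange M X₁ X₂ e f) :
    (∃ H, S.Bars X₁ H e) ∧ ∃ K, S.Bars X₂ K e := by
  have hbars f hf := h.exists_bars_or_exists_bars he hf (hstuck f hf)
  obtain ⟨f, hf⟩ : (X₂ \ B₂).Nonempty := by
    rw [← Finset.card_pos, ← h.card_sdiff_eq]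
    exact Finset.card_pos.2 ⟨e, he⟩
  constructor
  · by_contra! hnot
    obtain ⟨K, heK, -⟩ := (hbars f hf).resolve_left fun ⟨H, heH, _⟩ => hnot H heH
    obtain ⟨f', hf', hfK'⟩ := h.exists_mem_of_bars he heK
    obtain ⟨K', heK', hK'⟩ := (hbars f' hf').resolve_left fun ⟨H, heH, _⟩ => hnot H heH
    obtain rfl := heK.eq h.isBase₂ (h.subset₁ he) heK'
    exact hK'.2.1 hfK' (Finset.mem_sdiff.1 hf').1
  · by_contra! hnot
    obtain ⟨H, heH, -⟩ := (hbars f hf).resolve_right fun ⟨K, heK, _⟩ => hnot K heK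
    obtain ⟨f', hf', hfH'⟩ := h.exists_notMem_of_bars he heH
    obtain ⟨H', heH', hH'⟩ := (hbars f' hf').resolve_right fun ⟨K, heK, _⟩ => hnot K heK
    obtain rfl := heH.eq h.isBase₁ (h.subset₁ he) heH'
    exact hfH' (hH'.2.2 (h.symm.notMem₂ hf'))

lemma exists_labels_of_stuck (h : ExchangePair M S.ground X₁ X₂ B₁ B₂)
    (hstuck : ∀ e ∈ X₁ \ B₁, ∀ f ∈ X₂ \ B₂, ¬ CanExchange M X₁ X₂ e f) :
    ∃ label₁ label₂ : α → Finset α,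
      (∀ a ∈ X₁ \ B₁ ∪ X₂ \ B₂, S.Bars X₁ (label₁ a) a ∧ S.Bars X₂ (label₂ a) a) ∧
      ∀ p ∈ X₁ \ B₁, ∀ q ∈ X₂ \ B₂, label₁ p = label₁ q ∨ label₂ p = label₂ q := by
  have hbars : ∀ a ∈ X₁ \ B₁ ∪ X₂ \ B₂, ∃ H K, S.Bars X₁ H a ∧ S.Bars X₂ K a := by
    intro a ha
    rcases Finset.mem_union.1 ha with ha | ha
    · obtain ⟨⟨H, hH⟩, K, hK⟩ := h.exists_bars_of_stuck ha (hstuck a ha)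
      exact ⟨H, K, hH, hK⟩
    · obtain ⟨⟨K, hK⟩, H, hH⟩ := h.symm.exists_bars_of_stuck ha fun e he hae =>
        hstuck e he a ha hae.symm
      exact ⟨H, K, hH, hK⟩
  choose! label₁ label₂ hlabel using hbars
  refine ⟨label₁, label₂, hlabel, fun p hp q hq => ?_⟩
  have hpS := h.subset₁ hp
  have hqS := h.subset₂ hq
  have hp' := hlabel p (Finset.mem_union_left _ hp)
  have hq' := hlabel q (Finset.mem_union_right _ hq)
  refine (h.exists_bars_or_exists_bars hp hq (hstuck p hp q hq)).imp ?_ ?_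
  · rintro ⟨H, hpH, hqH⟩
    rw [hp'.1.eq h.isBase₁ hpS hpH, hq'.1.eq h.isBase₁ hqS hqH]
  · rintro ⟨K, hpK, hqK⟩
    rw [hp'.2.eq h.isBase₂ hpS hpK, hq'.2.eq h.isBase₂ hqS hqK]

lemma isObstructed_of_labels (h : ExchangePair M S.ground X₁ X₂ B₁ B₂)
    {label₁ label₂ : α → Finset α} {p₁ p₂ q : α}
    (hlabel : ∀ a ∈ X₁ \ B₁ ∪ X₂ \ B₂, S.Bars X₁ (label₁ a) a ∧ S.Bars X₂ (label₂ a) a)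
    (hp₁ : p₁ ∈ X₁ \ B₁) (hp₂ : p₂ ∈ X₁ \ B₁) (hH : label₁ p₁ ≠ label₁ p₂)
    (hK : label₂ p₁ ≠ label₂ p₂)
    (hP : ∀ p ∈ X₁ \ B₁, label₁ p = label₁ p₁ ∧ label₂ p = label₂ p₁ ∨
      label₁ p = label₁ p₂ ∧ label₂ p = label₂ p₂)
    (hQ : ∀ q ∈ X₂ \ B₂, label₁ q = label₁ p₁ ∧ label₂ q = label₂ p₂ ∨
      label₁ q = label₁ p₂ ∧ label₂ q = label₂ p₁)
    (hq : q ∈ X₂ \ B₂) (hq₁ : label₁ q = label₁ p₁) (hq₂ : label₂ q = label₂ p₂) :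
    IsObstructed S X₁ X₂ B₁ B₂ := by
  have tight p (hp : p ∈ X₁ \ B₁) := hlabel p (Finset.mem_union_left _ hp)
  have hmemH a (ha : a ∈ X₁ \ B₁ ∪ X₂ \ B₂) p (hp : p ∈ X₁ \ B₁) :=
    (hlabel a ha).1.eq_iff h.isBase₁ (h.mem_ground ha) (tight p hp).1.1
  have hmemK a (ha : a ∈ X₁ \ B₁ ∪ X₂ \ B₂) p (hp : p ∈ X₁ \ B₁) :=
    (hlabel a ha).2.eq_iff h.isBase₂ (h.mem_ground ha) (tight p hp).2.1
  have hcases a (ha : a ∈ X₁ \ B₁ ∪ X₂ \ B₂) :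
      (label₁ a = label₁ p₁ ↔ label₁ a ≠ label₁ p₂) ∧
        (label₂ a = label₂ p₁ ↔ label₂ a ≠ label₂ p₂) := by
    rcases Finset.mem_union.1 ha with ha | ha
    · rcases hP a ha with ⟨h₁, h₂⟩ | ⟨h₁, h₂⟩ <;> simp [h₁, h₂, hH, hK, hH.symm, hK.symm]
    · rcases hQ a ha with ⟨h₁, h₂⟩ | ⟨h₁, h₂⟩ <;> simp [h₁, h₂, hH, hK, hH.symm, hK.symm]
  have hdisj : (X₁ \ B₁) ∩ label₁ p₁ ∩ label₂ p₁ = ∅ := by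
    refine Finset.eq_empty_iff_forall_notMem.2 fun p hp => ?_
    simp only [Finset.mem_inter] at hp
    have hp' := Finset.mem_union_left (X₂ \ B₂) hp.1.1
    grind [hmemH p hp' p₁ hp₁, hmemK p hp' p₁ hp₁, h.mem_iff_notMem hp', hP p hp.1.1]
  have hqmem : q ∈ (X₂ \ B₂) ∩ label₁ p₁ ∩ label₂ p₁ := by
    have hq' := Finset.mem_union_right (X₁ \ B₁) hq
    grind [hmemH q hq' p₁ hp₁, hmemK q hq' p₁ hp₁, h.mem_iff_notMem hq']
  refine ⟨label₁ p₁, label₁ p₂, label₂ p₁, label₂ p₂, _, (tight p₁ hp₁).1.1, (tight p₂ hp₂).1.1,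
    (tight p₁ hp₁).2.1, (tight p₂ hp₂).2.1, fun a ha => ?_, fun a ha => ?_, ?_,
    Finset.card_pos.2 ⟨q, hqmem⟩⟩
  · have := (hcases a ha).1
    have := hmemH a ha p₁ hp₁
    have := hmemH a ha p₂ hp₂
    tauto
  · have := (hcases a ha).2
    have := hmemK a ha p₁ hp₁
    have := hmemK a ha p₂ hp₂
    tauto
  · rw [hdisj, Finset.card_empty, zero_add]

lemma isObstructed_of_stuck (h : ExchangePair M S.ground X₁ X₂ B₁ B₂) (hne : (X₁ \ B₁).Nonempty)
    (hstuck : ∀ e ∈ X₁ \ B₁, ∀ f ∈ X₂ \ B₂, ¬ CanExchange M X₁ X₂ e f) :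
    IsObstructed S X₁ X₂ B₁ B₂ := by
  obtain ⟨label₁, label₂, hlabel, hagree⟩ := h.exists_labels_of_stuck hstuck
  have hlabelP p (hp : p ∈ X₁ \ B₁) := hlabel p (Finset.mem_union_left _ hp)
  have hlabelQ q (hq : q ∈ X₂ \ B₂) := hlabel q (Finset.mem_union_right _ hq)
  have hne₁ : ∀ p ∈ X₁ \ B₁, ∃ q ∈ X₂ \ B₂, label₁ p ≠ label₁ q := fun p hp => by
    obtain ⟨q, hq, hqH⟩ := h.exists_notMem_of_bars hp (hlabelP p hp).1
    exact ⟨q, hq, fun heq => hqH (heq ▸ (hlabelQ q hq).1.2.2 (h.symm.notMem₂ hq))⟩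
  have hne₂ : ∀ p ∈ X₁ \ B₁, ∃ q ∈ X₂ \ B₂, label₂ p ≠ label₂ q := fun p hp => by
    obtain ⟨q, hq, hqK⟩ := h.exists_mem_of_bars hp (hlabelP p hp).2
    exact ⟨q, hq, fun heq => (hlabelQ q hq).2.2.1 (heq ▸ hqK) (Finset.mem_sdiff.1 hq).1⟩
  have hne₂' : ∀ q ∈ X₂ \ B₂, ∃ p ∈ X₁ \ B₁, label₂ q ≠ label₂ p := fun q hq => by
    obtain ⟨p, hp, hpK⟩ := h.symm.exists_notMem_of_bars hq (hlabelQ q hq).2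
    exact ⟨p, hp, fun heq => hpK (heq ▸ (hlabelP p hp).2.2.2 (h.notMem₂ hp))⟩
  obtain ⟨p₁, hp₁, p₂, hp₂, hH, hK, hP, hQ, q, hq, hq₁, hq₂⟩ :=
    exists_labels_of_agree hne hagree hne₁ hne₂ hne₂'
  exact h.isObstructed_of_labels hlabel hp₁ hp₂ hH hK hP hQ hq hq₁ hq₂

end ExchangePair

end Stuck

section Swap

variable {α : Type*} [DecidableEq α] {M : Matroid α} {S : SplitSystem M}
  {X₁ X₂ B₁ B₂ H H₁ H₂ J K K₁ K₂ : Finset α} {a e f q : α} {t : ℕ}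

lemma IsObstructed.symm (h : ExchangePair M S.ground X₁ X₂ B₁ B₂)
    (hO : IsObstructed S X₁ X₂ B₁ B₂) : IsObstructed S X₂ X₁ B₂ B₁ := by
  obtain ⟨H₁, H₂, K₁, K₂, t, hO⟩ := hO
  exact ⟨K₁, K₂, H₂, H₁, t, hO.symm h⟩

lemma SplitSystem.Bars.exists_compl {P : Finset α} (hH : S.Bars X₁ H a) (hX₁ : M.IsBase X₁)
    (hH₁ : S.IsTight X₁ H₁) (hH₂ : S.IsTight X₁ H₂) (hcompl : ∀ b ∈ P, (b ∈ H₁ ↔ b ∉ H₂))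
    (ha : a ∈ P) (haS : a ∈ S.ground) :
    ∃ J, S.IsTight X₁ J ∧ ∀ b ∈ P, (b ∈ H ↔ b ∉ J) := by
  have ha₁₂ := hcompl a ha
  by_cases haH₁ : a ∈ H₁ ↔ a ∉ X₁
  · obtain rfl := hH.eq hX₁ haS ⟨hH₁, haH₁⟩
    exact ⟨H₂, hH₂, hcompl⟩
  · obtain rfl := hH.eq hX₁ haS ⟨hH₂, by tauto⟩
    exact ⟨H₁, hH₁, fun b hb => by have := hcompl b hb; tauto⟩

lemma ExchangePair.eq_of_agree (h : ExchangePair M S.ground X₁ X₂ B₁ B₂)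
    (hcard : 2 ≤ (X₁ \ B₁).card) (hH : S.IsTight X₁ H)
    (hPQ : ((X₁ \ B₁) ∩ H).card = ((X₂ \ B₂) ∩ H).card) (hJ : J ∈ S.edges)
    (hJX : S.bound J ≤ (X₁ ∩ J).card + 1)
    (hagree : ∀ a ∈ X₁ \ B₁ ∪ X₂ \ B₂, (a ∈ H ↔ a ∉ X₁) → (a ∈ J ↔ a ∈ H)) :
    H = J := by
  by_contra hne
  have hsep := SplitSystem.card_sdiff_add_card_sdiff_union_le h.isBase₁ hH.1 hJ hne
  have hQ' : (X₂ \ B₂) ∩ H ⊆ (H ∩ J) \ X₁ := fun a ha => by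
    obtain ⟨haQ, haH⟩ := Finset.mem_inter.1 ha
    have haX := h.symm.notMem₂ haQ
    have haJ := hagree a (Finset.mem_union_right _ haQ) (iff_of_true haH haX)
    simp [haJ, haH, haX]
  have hP' : (X₁ \ B₁) \ H ⊆ (X₁ ∩ S.ground) \ (H ∪ J) := fun a ha => by
    obtain ⟨haP, haH⟩ := Finset.mem_sdiff.1 ha
    have haX := (Finset.mem_sdiff.1 haP).1
    have haJ := hagree a (Finset.mem_union_left _ haP) (iff_of_false haH (not_not.2 haX))
    simp [haJ, haH, haX, h.subset₁ haP]
  have := Finset.card_le_card hQ'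
  have := Finset.card_le_card hP'
  have := Finset.card_sdiff_add_card_inter (X₁ \ B₁) H
  rw [hH.2] at hsep
  omega

lemma SplitSystem.bound_le_of_isTight_exchange (hJ : S.IsTight (exchange X₁ e f) J) (he : e ∈ X₁)
    (hf : f ∉ X₁) : S.bound J ≤ (X₁ ∩ J).card + 1 := by
  have hcard := card_exchange_inter he hf J
  rw [hJ.2] at hcard
  split_ifs at hcard <;> omega

lemma canExchange_of_isTight (hX₁ : M.IsBase X₁) (hX₂ : M.IsBase X₂) (hH : S.IsTight X₁ H)
    (hK : S.IsTight X₂ K) (he₁ : e ∈ X₁) (he₂ : e ∉ X₂) (heS : e ∈ S.ground) (hf₂ : f ∈ X₂)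
    (hf₁ : f ∉ X₁) (hfS : f ∈ S.ground) (hefH : e ∈ H ↔ f ∈ H) (hefK : e ∈ K ↔ f ∈ K) :
    CanExchange M X₁ X₂ e f :=
  ⟨hH.isBase_exchange hX₁ he₁ heS hf₁ hfS hefH, hK.isBase_exchange hX₂ hf₂ hfS he₂ heS hefK.symm⟩

namespace Obstruction

-- `(X₁ - f + q, X₂ - q + f)` is the result of another exchange in the pair that was transformed
-- into `(X₁, X₂)` by adding `f` to its first member. That it is obstructed as well puts `f` into
-- the part of `q`.
lemma notMem_H₂_and_mem_K₁_of_swap (hO : Obstruction S X₁ X₂ B₁ B₂ H₁ H₂ K₁ K₂ t)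
    (h : ExchangePair M S.ground X₁ X₂ B₁ B₂) (hf₁ : f ∈ X₁ ∩ B₁) (hf₂ : f ∉ X₂ ∪ B₂)
    (hfS : f ∈ S.ground) (hq : q ∈ X₂ \ B₂) (hqH₁ : q ∈ H₁) (hqK₁ : q ∈ K₁) (hfH₁ : f ∈ H₁)
    (hfK₂ : f ∉ K₂) (hswap : CanExchange M X₁ X₂ f q →
      IsObstructed S (exchange X₁ f q) (exchange X₂ q f) B₁ B₂) : f ∉ H₂ ∧ f ∈ K₁ := by
  have hqX₁ := h.symm.notMem₂ hq
  have hqB₁ := h.symm.mem_target₂ hq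
  obtain ⟨hfX₁, hfB₁⟩ := Finset.mem_inter.1 hf₁
  obtain ⟨hfX₂, hfB₂⟩ := not_or.1 (mt Finset.mem_union.2 hf₂)
  obtain ⟨hqX₂, hqB₂⟩ := Finset.mem_sdiff.1 hq
  have hne : f ≠ q := fun heq => hqX₁ (heq ▸ hfX₁)
  have hqK₂ := (hO.mem_K_iff q (Finset.mem_union_right _ hq)).1 hqK₁
  have hex := canExchange_of_isTight h.isBase₁ h.isBase₂ hO.isTight_H₁ hO.isTight_K₂ hfX₁ hfX₂ hfS
    hqX₂ hqX₁ (h.subset₂ hq) (iff_of_true hfH₁ hqH₁) (iff_of_false hfK₂ hqK₂)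
  obtain ⟨_, _, _, _, _, hO'⟩ := hswap hex
  have hmem : exchange X₁ f q \ B₁ ∪ exchange X₂ q f \ B₂ =
      insert f ((X₁ \ B₁ ∪ X₂ \ B₂).erase q) := by grind
  have hf : f ∈ exchange X₁ f q \ B₁ ∪ exchange X₂ q f \ B₂ := by simp [hmem]
  have hH₁' : S.Bars (exchange X₁ f q) H₁ f :=
    ⟨(SplitSystem.isTight_exchange_iff hfX₁ hqX₁ (iff_of_true hfH₁ hqH₁)).2 hO.isTight_H₁,
      by simp [hfH₁, hne]⟩
  have hK₂' : S.Bars (exchange X₂ q f) K₂ f :=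
    ⟨(SplitSystem.isTight_exchange_iff hqX₂ hfX₂ (iff_of_false hqK₂ hfK₂)).2 hO.isTight_K₂,
      by simp [hfK₂]⟩
  obtain ⟨J, hJ, hH₁J⟩ := hH₁'.exists_compl hex.1 hO'.isTight_H₁ hO'.isTight_H₂ hO'.mem_H_iff hf hfS
  obtain ⟨L, hL, hK₂L⟩ := hK₂'.exists_compl hex.2 hO'.isTight_K₁ hO'.isTight_K₂ hO'.mem_K_iff hf hfS
  have hcard : 2 ≤ (X₁ \ B₁).card := by
    have := hO.pos
    have := hO.two_mul_le_card h
    omega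
  have hH₂J : H₂ = J := by
    refine h.eq_of_agree hcard hO.isTight_H₂ ((hO.flip h).card_inter_H₁ h) hJ.1
      (SplitSystem.bound_le_of_isTight_exchange hJ hfX₁ hqX₁) fun a ha haH₂ => ?_
    have haq : a ≠ q := by rintro rfl; have := hO.mem_H_iff a ha; tauto
    have := hO.mem_H_iff a ha
    have := hH₁J a (by simp only [hmem, Finset.mem_insert, Finset.mem_erase]; tauto)
    tauto
  have hK₁L : K₁ = L := by
    refine h.symm.eq_of_agree (h.card_sdiff_eq ▸ hcard) hO.isTight_K₁ (hO.card_inter_K₁ h).symm hL.1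
      (SplitSystem.bound_le_of_isTight_exchange hL hqX₂ hfX₂) fun a ha haK₁ => ?_
    rw [Finset.union_comm] at ha
    have haq : a ≠ q := by rintro rfl; tauto
    have := hO.mem_K_iff a ha
    have := hK₂L a (by simp only [hmem, Finset.mem_insert, Finset.mem_erase]; tauto)
    tauto
  rw [hH₂J, hK₁L]
  exact ⟨(hH₁J f hf).1 hfH₁, by have := hK₂L f hf; tauto⟩

end Obstruction

end Swap

section Unobstructed

variable {α : Type*} [DecidableEq α] {M : Matroid α} {S : SplitSystem M}
  {X₁ X₂ B₁ B₂ H₁ H₂ K₁ K₂ : Finset α} {e f : α} {t : ℕ}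

namespace Obstruction

lemma mem_H₁_or_mem_H₂ (hO : Obstruction S X₁ X₂ B₁ B₂ H₁ H₂ K₁ K₂ t) (hX₁ : M.IsBase X₁)
    (hfX₁ : f ∈ X₁) (hfS : f ∈ S.ground) : f ∈ H₁ ∨ f ∈ H₂ := by
  by_contra! hf
  obtain rfl := SplitSystem.Bars.eq hX₁ hfS ⟨hO.isTight_H₁, iff_of_false hf.1 (not_not.2 hfX₁)⟩
    ⟨hO.isTight_H₂, iff_of_false hf.2 (not_not.2 hfX₁)⟩
  obtain ⟨q, hq, hqH₁, -⟩ := hO.exists_mem₁₁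
  exact (hO.mem_H_iff q (Finset.mem_union_right _ hq)).1 hqH₁ hqH₁

lemma notMem_K₁_or_notMem_K₂ (hO : Obstruction S X₁ X₂ B₁ B₂ H₁ H₂ K₁ K₂ t) (hX₂ : M.IsBase X₂)
    (hfX₂ : f ∉ X₂) (hfS : f ∈ S.ground) : f ∉ K₁ ∨ f ∉ K₂ := by
  by_contra! hf
  obtain rfl := SplitSystem.Bars.eq hX₂ hfS ⟨hO.isTight_K₁, iff_of_true hf.1 hfX₂⟩
    ⟨hO.isTight_K₂, iff_of_true hf.2 hfX₂⟩
  obtain ⟨q, hq, -, hqK₁⟩ := hO.exists_mem₁₁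
  exact (hO.mem_K_iff q (Finset.mem_union_right _ hq)).1 hqK₁ hqK₁

lemma mem_iff_notMem_of_swap (hO : Obstruction S X₁ X₂ B₁ B₂ H₁ H₂ K₁ K₂ t)
    (h : ExchangePair M S.ground X₁ X₂ B₁ B₂) (hf₁ : f ∈ X₁ ∩ B₁) (hf₂ : f ∉ X₂ ∪ B₂)
    (hfS : f ∈ S.ground) (hswap : ∀ q ∈ X₂ \ B₂, CanExchange M X₁ X₂ f q →
      IsObstructed S (exchange X₁ f q) (exchange X₂ q f) B₁ B₂) :
    (f ∈ H₁ ↔ f ∉ H₂) ∧ (f ∈ K₁ ↔ f ∉ K₂) := by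
  have hH := hO.mem_H₁_or_mem_H₂ h.isBase₁ (Finset.mem_inter.1 hf₁).1 hfS
  have hK := hO.notMem_K₁_or_notMem_K₂ h.isBase₂ (not_or.1 (mt Finset.mem_union.2 hf₂)).1 hfS
  obtain ⟨q₁, hq₁, hqH₁, hqK₁⟩ := hO.exists_mem₁₁
  obtain ⟨q₂, hq₂, hqH₂, hqK₂⟩ := (hO.flip h).exists_mem₁₁
  have h₁ := fun hfH₁ hfK₂ => hO.notMem_H₂_and_mem_K₁_of_swap h hf₁ hf₂ hfS hq₁ hqH₁ hqK₁ hfH₁ hfK₂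
    (hswap q₁ hq₁)
  have h₂ := fun hfH₂ hfK₁ => (hO.flip h).notMem_H₂_and_mem_K₁_of_swap h hf₁ hf₂ hfS hq₂ hqH₂ hqK₂
    hfH₂ hfK₁ (hswap q₂ hq₂)
  tauto

end Obstruction

namespace ExchangePair

lemma mem_iff_notMem_of_forall_isObstructed (h : ExchangePair M S.ground X₁ X₂ B₁ B₂)
    (he : e ∈ X₁ \ B₁) (hf : f ∈ X₂ \ B₂) (hef : CanExchange M X₁ X₂ e f)
    (hall : ∀ q ∈ X₂ \ B₂, CanExchange M X₁ X₂ e q →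
      IsObstructed S (exchange X₁ e q) (exchange X₂ q e) B₁ B₂)
    (hO : Obstruction S (exchange X₁ e f) (exchange X₂ f e) B₁ B₂ H₁ H₂ K₁ K₂ t) :
    (f ∈ H₁ ↔ f ∉ H₂) ∧ (f ∈ K₁ ↔ f ∉ K₂) := by
  obtain ⟨hfX₂, hfB₂⟩ := Finset.mem_sdiff.1 hf
  have hfB₁ := h.symm.mem_target₂ hf
  have hfe : f ≠ e := fun heq => h.symm.notMem₂ hf (heq ▸ (Finset.mem_sdiff.1 he).1)
  refine hO.mem_iff_notMem_of_swap (h.after_exchange he hf hef) (by simp [hfB₁])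
    (by simp [hfe, hfB₂]) (h.subset₂ hf) fun q hq => ?_
  rw [exchange_sdiff (h.mem_target₂ he), Finset.mem_erase] at hq
  have hqe : q ≠ e := fun heq => h.notMem₂ he (heq ▸ (Finset.mem_sdiff.1 hq.2).1)
  rw [CanExchange, exchange_exchange (h.symm.notMem₂ hf),
    exchange_exchange_comm hqe.symm hq.1.symm hfX₂]
  exact hall q hq.2

lemma exists_exchange (h : ExchangePair M S.ground X₁ X₂ B₁ B₂) (hne : (X₁ \ B₁).Nonempty)
    (hO : ¬ IsObstructed S X₁ X₂ B₁ B₂) :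
    ∃ e ∈ X₁ \ B₁, ∃ f ∈ X₂ \ B₂, CanExchange M X₁ X₂ e f ∧
      ¬ IsObstructed S (exchange X₁ e f) (exchange X₂ f e) B₁ B₂ := by
  by_contra! hall
  obtain ⟨e, he, f, hf, hef⟩ : ∃ e ∈ X₁ \ B₁, ∃ f ∈ X₂ \ B₂, CanExchange M X₁ X₂ e f := by
    by_contra! hstuck
    exact hO (h.isObstructed_of_stuck hne hstuck)
  have hW := h.after_exchange he hf hef
  obtain ⟨H₁, H₂, K₁, K₂, t, hO'⟩ := hall e he f hf hef
  obtain ⟨hfH, hfK⟩ := h.mem_iff_notMem_of_forall_isObstructed he hf hef (hall e he) hO'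
  obtain ⟨heK, heH'⟩ := h.symm.mem_iff_notMem_of_forall_isObstructed hf he hef.symm
    (fun p hp hpf => (hall p hp f hf hpf.symm).symm (h.after_exchange hp hf hpf.symm))
    (hO'.symm hW)
  have heH : e ∈ H₁ ↔ e ∉ H₂ := by rw [heH', not_not]
  have hH := SplitSystem.mem_iff_mem_of_isTight_exchange h.isBase₁ (Finset.mem_sdiff.1 he).1
    (h.symm.notMem₂ hf) hO'.isTight_H₁ hO'.isTight_H₂ heH hfH
  have hK := SplitSystem.mem_iff_mem_of_isTight_exchange h.isBase₂ (Finset.mem_sdiff.1 hf).1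
    (h.notMem₂ he) hO'.isTight_K₁ hO'.isTight_K₂ hfK heK
  exact hO ⟨H₁, H₂, K₁, K₂, t,
    (obstruction_exchange_iff h he hf heH hfH heK hfK hH hK.symm).1 hO'⟩

end ExchangePair

end Unobstructed

section MonotoneSeq

variable {α : Type*} [DecidableEq α] {M : Matroid α} {S : SplitSystem M}
  {X X₁ X₂ B₁ B₂ H₁ H₂ K₁ K₂ : Finset α} {e f : α} {n t : ℕ}

lemma SplitSystem.mem_ground_iff_of_isBase_exchange (hX : M.IsBase X) (he : e ∈ X) (hf : f ∉ X)
    (hef : M.IsBase (exchange X e f)) : e ∈ S.ground ↔ f ∈ S.ground := by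
  have hcard := card_exchange_inter he hf S.ground
  rw [S.card_inter_ground hX, S.card_inter_ground hef] at hcard
  split_ifs at hcard <;> simp_all

namespace Obstruction

lemma canExchange (hO : Obstruction S X₁ X₂ B₁ B₂ H₁ H₂ K₁ K₂ t)
    (h : ExchangePair M S.ground X₁ X₂ B₁ B₂) (he : e ∈ X₁ \ B₁) (hf : f ∈ X₂ \ B₂)
    (hH : e ∈ H₁ ↔ f ∈ H₁) (hK : e ∈ K₁ ↔ f ∈ K₁) : CanExchange M X₁ X₂ e f :=
  canExchange_of_isTight h.isBase₁ h.isBase₂ hO.isTight_H₁ hO.isTight_K₁ (Finset.mem_sdiff.1 he).1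
    (h.notMem₂ he) (h.subset₁ he) (Finset.mem_sdiff.1 hf).1 (h.symm.notMem₂ hf) (h.subset₂ hf) hH hK

lemma mem_iff_mem_of_canExchange (hO : Obstruction S X₁ X₂ B₁ B₂ H₁ H₂ K₁ K₂ t)
    (h : ExchangePair M S.ground X₁ X₂ B₁ B₂) (he : e ∈ X₁ \ B₁) (hf : f ∈ X₂ \ B₂)
    (hef : CanExchange M X₁ X₂ e f) : (e ∈ H₁ ↔ f ∈ H₁) ∧ (e ∈ K₁ ↔ f ∈ K₁) := by
  have heX₁ := (Finset.mem_sdiff.1 he).1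
  have hfX₂ := (Finset.mem_sdiff.1 hf).1
  have hfX₁ := h.symm.notMem₂ hf
  have heX₂ := h.notMem₂ he
  have := hO.isTight_H₁.mem_of_isBase_exchange heX₁ hfX₁ hef.1
  have := hO.isTight_H₂.mem_of_isBase_exchange heX₁ hfX₁ hef.1
  have := hO.isTight_K₁.mem_of_isBase_exchange hfX₂ heX₂ hef.2
  have := hO.isTight_K₂.mem_of_isBase_exchange hfX₂ heX₂ hef.2
  have := hO.mem_H_iff e (Finset.mem_union_left _ he)
  have := hO.mem_H_iff f (Finset.mem_union_right _ hf)
  have := hO.mem_K_iff e (Finset.mem_union_left _ he)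
  have := hO.mem_K_iff f (Finset.mem_union_right _ hf)
  tauto

lemma exists_mem_iff_mem (hO : Obstruction S X₁ X₂ B₁ B₂ H₁ H₂ K₁ K₂ t)
    (h : ExchangePair M S.ground X₁ X₂ B₁ B₂) (hlt : 2 * t < (X₁ \ B₁).card) :
    ∃ e ∈ X₁ \ B₁, ∃ f ∈ X₂ \ B₂, (e ∈ H₁ ↔ f ∈ H₁) ∧ (e ∈ K₁ ↔ f ∈ K₁) := by
  by_contra hne
  have empty_or_empty {H K : Finset α} (hHK : ∀ a ∈ X₁ \ B₁ ∪ X₂ \ B₂, a ∈ H → a ∈ K →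
      ∀ b ∈ X₁ \ B₁ ∪ X₂ \ B₂, b ∈ H → b ∈ K → (a ∈ H₁ ↔ b ∈ H₁) ∧ (a ∈ K₁ ↔ b ∈ K₁)) :
      ((X₁ \ B₁) ∩ H ∩ K).card = 0 ∨ ((X₂ \ B₂) ∩ H ∩ K).card = 0 := by
    by_contra! hpos
    obtain ⟨e, he⟩ := Finset.card_ne_zero.1 hpos.1
    obtain ⟨f, hf⟩ := Finset.card_ne_zero.1 hpos.2
    simp only [Finset.mem_inter] at he hf
    exact hne ⟨e, he.1.1, f, hf.1.1, hHK e (Finset.mem_union_left _ he.1.1) he.1.2 he.2 f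
      (Finset.mem_union_right _ hf.1.1) hf.1.2 hf.2⟩
  have hH := hO.mem_H_iff
  have hK := hO.mem_K_iff
  have h₁₁ := empty_or_empty (H := H₁) (K := K₁) (by grind)
  have h₁₂ := empty_or_empty (H := H₁) (K := K₂) (by grind)
  have h₂₁ := empty_or_empty (H := H₂) (K := K₁) (by grind)
  have h₂₂ := empty_or_empty (H := H₂) (K := K₂) (by grind)
  have hP := card_inter_add_card_inter_of_compl
    fun a ha => hH a (Finset.mem_union_left (X₂ \ B₂) ha)
  have hPH (H : Finset α) := card_inter_add_card_inter_of_compl (T := (X₁ \ B₁) ∩ H)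
    fun a ha => hK a (Finset.mem_union_left _ (Finset.mem_inter.1 ha).1)
  have hPH₁ := hPH H₁
  have hPH₂ := hPH H₂
  have := hO.card_add
  have := hO.card_add₁₂ h
  have := hO.card_add₂₁ h
  have := hO.card_add₂₂ h
  omega

lemma exists_exchange (hO : Obstruction S X₁ X₂ B₁ B₂ H₁ H₂ K₁ K₂ t)
    (h : ExchangePair M S.ground X₁ X₂ B₁ B₂) (hlt : 2 * t < (X₁ \ B₁).card) :
    ∃ e ∈ X₁ \ B₁, ∃ f ∈ X₂ \ B₂, CanExchange M X₁ X₂ e f ∧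
      Obstruction S (exchange X₁ e f) (exchange X₂ f e) B₁ B₂ H₁ H₂ K₁ K₂ t := by
  obtain ⟨e, he, f, hf, hH, hK⟩ := hO.exists_mem_iff_mem h hlt
  have he' := Finset.mem_union_left (X₂ \ B₂) he
  have hf' := Finset.mem_union_right (X₁ \ B₁) hf
  exact ⟨e, he, f, hf, hO.canExchange h he hf hH hK,
    (obstruction_exchange_iff h he hf (hO.mem_H_iff e he') (hO.mem_H_iff f hf')
      (hO.mem_K_iff e he') (hO.mem_K_iff f hf') hH hK).2 hO⟩

lemma card_inter_symmDiff (hO : Obstruction S X₁ X₂ B₁ B₂ H₁ H₂ K₁ K₂ t)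
    (h : ExchangePair M S.ground X₁ X₂ B₁ B₂) :
    ((X₁ \ B₁) ∩ symmDiff H₁ K₁).card = ((X₂ \ B₂) ∩ symmDiff H₁ K₁).card + 2 * t := by
  have := card_inter_symmDiff_add (X₁ \ B₁) H₁ K₁
  have := card_inter_symmDiff_add (X₂ \ B₂) H₁ K₁
  have := hO.card_inter_H₁ h
  have := hO.card_inter_K₁ h
  have := hO.card_add
  omega

-- The base-ordering bijection maps `(X₁ \ B₁) ∩ (H₁ ∆ K₁)` into `(X₂ \ B₂) ∩ (H₁ ∆ K₁)`, which is
-- smaller by `2 * t`, and elements common to `X₂` and `B₂`.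
lemma two_mul_le_card_inter (hO : Obstruction S X₁ X₂ B₁ B₂ H₁ H₂ K₁ K₂ t)
    (h : ExchangePair M S.ground X₁ X₂ B₁ B₂) (hM : M.IsBaseOrderable) :
    2 * t ≤ (X₁ ∩ B₁ ∩ S.ground).card := by
  obtain ⟨φ, hφ⟩ := hM X₁ X₂ h.isBase₁ h.isBase₂
  have hle : ((X₁ \ B₁) ∩ symmDiff H₁ K₁).card ≤
      ((X₂ \ B₂) ∩ symmDiff H₁ K₁ ∪ X₂ ∩ B₂ ∩ S.ground).card := by
    refine Finset.card_le_card_of_forall_subsingleton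
      (fun e f => ∃ he : e ∈ X₁, (φ ⟨e, he⟩ : α) = f) (fun e he => ?_) ?_
    · obtain ⟨heP, heHK⟩ := Finset.mem_inter.1 he
      have heX₁ := (Finset.mem_sdiff.1 heP).1
      obtain ⟨hbase₁, hbase₂⟩ := hφ ⟨e, heX₁⟩
      have hfX₂ : (φ ⟨e, heX₁⟩ : α) ∈ X₂ := (φ ⟨e, heX₁⟩).2
      refine ⟨φ ⟨e, heX₁⟩, ?_, heX₁, rfl⟩
      generalize (φ ⟨e, heX₁⟩ : α) = f at *
      have hef : CanExchange M X₁ X₂ e f := ⟨by simpa using hbase₁, by simpa using hbase₂⟩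
      have hfS : f ∈ S.ground := (SplitSystem.mem_ground_iff_of_isBase_exchange h.isBase₂ hfX₂
        (h.notMem₂ heP) hef.2).2 (h.subset₁ heP)
      by_cases hfB₂ : f ∈ B₂
      · exact Finset.mem_union_right _ (by simp [hfX₂, hfB₂, hfS])
      · have hfQ := Finset.mem_sdiff.2 ⟨hfX₂, hfB₂⟩
        have hclass := hO.mem_iff_mem_of_canExchange h heP hfQ hef
        rw [Finset.mem_symmDiff, hclass.1, hclass.2, ← Finset.mem_symmDiff] at heHK
        exact Finset.mem_union_left _ (Finset.mem_inter.2 ⟨hfQ, heHK⟩)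
    · rintro f - e ⟨-, he, hef⟩ e' ⟨-, he', hef'⟩
      exact congrArg Subtype.val (φ.injective (Subtype.ext (hef.trans hef'.symm)))
  have hunion := Finset.card_union_le ((X₂ \ B₂) ∩ symmDiff H₁ K₁) (X₂ ∩ B₂ ∩ S.ground)
  have := hO.card_inter_symmDiff h
  have := h.card_inter_inter_eq
  omega

lemma hasStrictlyMonotoneSeq (hO : Obstruction S X₁ X₂ B₁ B₂ H₁ H₂ K₁ K₂ t)
    (h : ExchangePair M S.ground X₁ X₂ B₁ B₂) (hn : (X₁ \ B₁).card = n + 2 * t) :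
    M.HasStrictlyMonotoneSeq (X₁, X₂) (B₁, B₂) n := by
  induction n generalizing X₁ X₂ with
  | zero => exact hasStrictlyMonotoneSeq_zero _ _
  | succ n ih =>
    obtain ⟨e, he, f, hf, hef, hO'⟩ := hO.exists_exchange h (by omega)
    refine h.hasStrictlyMonotoneSeq_cons he hf hef (ih hO' (h.after_exchange he hf hef) ?_)
    rw [exchange_sdiff (h.symm.mem_target₂ hf), Finset.card_erase_of_mem he, hn]
    omega

end Obstruction

namespace ExchangePair

lemma hasStrictlyMonotoneSeq_of_not_isObstructed (h : ExchangePair M S.ground X₁ X₂ B₁ B₂)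
    (hO : ¬ IsObstructed S X₁ X₂ B₁ B₂) (hn : (X₁ \ B₁).card = n) :
    M.HasStrictlyMonotoneSeq (X₁, X₂) (B₁, B₂) n := by
  induction n generalizing X₁ X₂ with
  | zero => exact hasStrictlyMonotoneSeq_zero _ _
  | succ n ih =>
    obtain ⟨e, he, f, hf, hef, hO'⟩ := h.exists_exchange (Finset.card_pos.1 (by omega)) hO
    refine h.hasStrictlyMonotoneSeq_cons he hf hef (ih (h.after_exchange he hf hef) hO' ?_)
    rw [exchange_sdiff (h.symm.mem_target₂ hf), Finset.card_erase_of_mem he, hn,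
      Nat.add_sub_cancel]

lemma hasStrictlyMonotoneSeq_of_two_mul_le (h : ExchangePair M S.ground X₁ X₂ B₁ B₂)
    (hn : ∀ ⦃H₁ H₂ K₁ K₂ t⦄, Obstruction S X₁ X₂ B₁ B₂ H₁ H₂ K₁ K₂ t → 2 * t ≤ n) :
    M.HasStrictlyMonotoneSeq (X₁, X₂) (B₁, B₂) ((X₁ \ B₁).card - n) := by
  by_cases hobs : IsObstructed S X₁ X₂ B₁ B₂
  · obtain ⟨H₁, H₂, K₁, K₂, t, hO⟩ := hobs
    have := hO.two_mul_le_card h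
    have := hn hO
    exact hasStrictlyMonotoneSeq_of_le (hO.hasStrictlyMonotoneSeq h (n := (X₁ \ B₁).card - 2 * t)
      (by omega)) (by omega)
  · exact hasStrictlyMonotoneSeq_of_le (h.hasStrictlyMonotoneSeq_of_not_isObstructed hobs rfl)
      (Nat.sub_le _ _)

lemma hasStrictlyMonotoneSeq (h : ExchangePair M S.ground X₁ X₂ B₁ B₂) :
    M.HasStrictlyMonotoneSeq (X₁, X₂) (B₁, B₂) (S.rank - 3 * (X₁ ∩ B₁ ∩ S.ground).card) := by
  have hcard := h.card_sdiff_add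
  exact hasStrictlyMonotoneSeq_of_le (h.hasStrictlyMonotoneSeq_of_two_mul_le
    fun _ _ _ _ _ hO => Nat.mul_le_mul_left 2 (hO.le_card_inter h)) (by omega)

lemma hasStrictlyMonotoneSeq_of_isBaseOrderable (h : ExchangePair M S.ground X₁ X₂ B₁ B₂)
    (hM : M.IsBaseOrderable) :
    M.HasStrictlyMonotoneSeq (X₁, X₂) (B₁, B₂) (S.rank - 2 * (X₁ ∩ B₁ ∩ S.ground).card) := by
  have hcard := h.card_sdiff_add
  exact hasStrictlyMonotoneSeq_of_le (h.hasStrictlyMonotoneSeq_of_two_mul_le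
    fun _ _ _ _ _ hO => hO.two_mul_le_card_inter h hM) (by omega)

end ExchangePair

end MonotoneSeq

/-! ### Classes of elements and the base polytope -/

section Linear

variable {α : Type*} [DecidableEq α] {M : Matroid α} {X Y F : Finset α} {a b c e f : α}

/-- The base `X` remains a base when `a ∈ X` is replaced by `b ∉ X`. -/
structure IsExchange (M : Matroid α) (X : Finset α) (a b : α) : Prop where
  mem : a ∈ X
  notMem : b ∉ X
  isBase : M.IsBase (exchange X a b)

lemma IsExchange.mem_ground (hab : IsExchange M X a b) : b ∈ M.E :=
  hab.isBase.subset_ground (by simp)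

lemma mem_closure_of_forall_isExchange (hX : M.IsBase X) (hf : f ∈ M.E) (hfX : f ∉ X) {T : Set α}
    (hT : ∀ e, IsExchange M X e f → e ∈ M.closure T) : f ∈ M.closure T := by
  have hcl : f ∈ M.closure X := by rwa [hX.closure_eq]
  have hC := hX.fundCircuit_isCircuit hf hfX
  refine M.closure_subset_closure_of_subset_closure (fun e heC => ?_)
    (hC.mem_closure_sdiff_singleton_of_mem (M.mem_fundCircuit f X))
  have hef : e ≠ f := heC.2
  have heX : e ∈ X := by simpa [hef] using M.fundCircuit_subset_insert f X heC.1
  refine hT e ⟨heX, hfX, ?_⟩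
  rw [Finset.coe_insert, Finset.coe_erase, Set.insert_sdiff_singleton_comm hef.symm]
  exact hX.exchange_isBase_of_indep' heX hfX
    ((hX.indep.mem_fundCircuit_iff hcl hfX).1 heC.1)

lemma exists_isExchange_isExchange (hX : M.IsBase X) (hY : M.IsBase Y) (hf : f ∈ Y \ X) :
    ∃ e, IsExchange M X e f ∧ IsExchange M Y f e := by
  obtain ⟨hfY, hfX⟩ := Finset.mem_sdiff.1 hf
  obtain ⟨e, he, heY⟩ : ∃ e, IsExchange M X e f ∧ e ∉ M.closure ((Y : Set α) \ {f}) := by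
    by_contra! hmem
    exact hY.indep.notMem_closure_sdiff_of_mem (e := f) hfY
      (mem_closure_of_forall_isExchange hX (hY.subset_ground hfY) hfX hmem)
  have heE : e ∈ M.E := hX.subset_ground he.mem
  have hef : e ≠ f := fun h => hfX (h ▸ he.mem)
  refine ⟨e, he, hfY, fun h => heY (M.mem_closure_of_mem' ⟨h, hef⟩ heE), ?_⟩
  rw [Finset.coe_insert, Finset.coe_erase]
  exact hY.exchange_base_of_notMem_closure (e := f) (f := e) hfY heY heE

lemma coordSum_apply {α : Type*} (F : Finset α) (x : α → ℝ) :
    Matroid.coordSum F x = ∑ e ∈ F, x e := by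
  simp [Matroid.coordSum, LinearMap.sum_apply]

lemma coordSum_indicator (F X : Finset α) :
    Matroid.coordSum F ((X : Set α).indicator 1) = ((X ∩ F).card : ℝ) := by
  simp [coordSum_apply, Set.indicator_apply, Finset.inter_comm]

/-- The vector by which the exchange of `e` for `f` moves the incidence vector of a set. -/
def exchangeVector (e f : α) : α → ℝ :=
  Pi.single f 1 - Pi.single e 1

lemma exchangeVector_self (e : α) : exchangeVector e e = 0 :=
  sub_self _

lemma neg_exchangeVector (e f : α) : -exchangeVector e f = exchangeVector f e :=
  neg_sub _ _

lemma exchangeVector_add (a b c : α) :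
    exchangeVector a b + exchangeVector b c = exchangeVector a c := by
  simp [exchangeVector]

lemma exchangeVector_apply_eq_zero (hae : a ≠ e) (haf : a ≠ f) : exchangeVector e f a = 0 := by
  simp [exchangeVector, hae, haf]

lemma coordSum_exchangeVector (F : Finset α) (e f : α) :
    Matroid.coordSum F (exchangeVector e f) =
      (if f ∈ F then 1 else 0) - (if e ∈ F then 1 else 0) := by
  simp [coordSum_apply, exchangeVector, Pi.single_apply]

lemma indicator_exchange (he : e ∈ X) (hf : f ∉ X) :
    (exchange X e f : Set α).indicator (1 : α → ℝ) =
      (X : Set α).indicator 1 + exchangeVector e f := by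
  have hef : e ≠ f := fun h => hf (h ▸ he)
  ext a
  obtain rfl | hae := eq_or_ne a e
  · simp [exchangeVector, hef, he]
  obtain rfl | haf := eq_or_ne a f
  · simp [exchangeVector, hf, hae]
  · simp [exchangeVector, Set.indicator_apply, hae, haf]

lemma indicator_exchangeVector_mem {s : Set α} {V : Submodule ℝ (α → ℝ)}
    (hV : exchangeVector e f ∈ V) (hef : e ∈ s ↔ f ∈ s) : s.indicator (exchangeVector e f) ∈ V := by
  by_cases hes : e ∈ s
  · rwa [Set.indicator_eq_self.2]
    intro a ha
    by_contra has
    exact ha (exchangeVector_apply_eq_zero (fun h => has (h ▸ hes))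
      fun h => has (h ▸ hef.1 hes))
  · rw [show s.indicator (exchangeVector e f) = 0 from ?_]
    · exact V.zero_mem
    · refine Set.indicator_eq_zero'.2 (Set.disjoint_left.2 fun a ha has => ?_)
      exact ha (exchangeVector_apply_eq_zero (fun h => hes (h ▸ has))
        fun h => hes (hef.2 (h ▸ has)))

lemma indicator_sub_mem_of_forall_isExchange {V : Submodule ℝ (α → ℝ)} (hX : M.IsBase X)
    (hV : ∀ a b, IsExchange M X a b → exchangeVector a b ∈ V) (hY : M.IsBase Y) :
    (Y : Set α).indicator 1 - (X : Set α).indicator 1 ∈ V := by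
  induction hn : (Y \ X).card generalizing Y with
  | zero =>
    have hYX : Y ⊆ X := by rwa [Finset.card_eq_zero, Finset.sdiff_eq_empty_iff_subset] at hn
    rw [hY.eq_of_subset_isBase hX (Finset.coe_subset.2 hYX), sub_self]
    exact V.zero_mem
  | succ n ih =>
    obtain ⟨f, hf⟩ : (Y \ X).Nonempty := Finset.card_pos.1 (by omega)
    obtain ⟨e, he, he'⟩ := exists_isExchange_isExchange hX hY hf
    have hmem := ih he'.isBase (by
      rw [exchange_sdiff he.mem, Finset.card_erase_of_mem hf, hn, Nat.add_sub_cancel])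
    rw [indicator_exchange he'.mem he'.notMem, ← neg_exchangeVector] at hmem
    convert V.add_mem hmem (hV e f he) using 1
    abel

end Linear

section Direction

variable {α : Type*} {M : Matroid α} {x y v : α → ℝ}

/-- The direction of the affine hull of the base polytope. -/
abbrev baseDirection (M : Matroid α) : Submodule ℝ (α → ℝ) :=
  vectorSpan ℝ M.basePolytope

lemma indicator_mem_basePolytope {X : Set α} (hX : M.IsBase X) :
    X.indicator 1 ∈ M.basePolytope :=
  subset_convexHull _ _ ⟨X, hX, rfl⟩

lemma indicator_mem_affineSpan {X : Set α} (hX : M.IsBase X) :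
    X.indicator 1 ∈ affineSpan ℝ M.basePolytope :=
  subset_affineSpan _ _ (indicator_mem_basePolytope hX)

lemma indicator_sub_mem_baseDirection {X Y : Set α} (hX : M.IsBase X) (hY : M.IsBase Y) :
    Y.indicator 1 - X.indicator 1 ∈ baseDirection M :=
  vsub_mem_vectorSpan ℝ (indicator_mem_basePolytope hY) (indicator_mem_basePolytope hX)

lemma add_mem_affineSpan (hx : x ∈ affineSpan ℝ M.basePolytope) (hv : v ∈ baseDirection M) :
    x + v ∈ affineSpan ℝ M.basePolytope := by
  rw [baseDirection, ← direction_affineSpan] at hv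
  simpa [add_comm] using AffineSubspace.vadd_mem_of_mem_direction hv hx

lemma sub_mem_baseDirection (hx : x ∈ affineSpan ℝ M.basePolytope)
    (hy : y ∈ affineSpan ℝ M.basePolytope) : x - y ∈ baseDirection M := by
  rw [baseDirection, ← direction_affineSpan]
  exact AffineSubspace.vsub_mem_direction hx hy

lemma finiteDimensional_baseDirection (M : Matroid α) [M.Finite] :
    FiniteDimensional ℝ (baseDirection M) := by
  rw [baseDirection, Matroid.basePolytope, ← direction_affineSpan, affineSpan_convexHull,
    direction_affineSpan]
  refine finiteDimensional_vectorSpan_of_finite ℝ ((M.ground_finite.finite_subsets.image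
    (fun B => B.indicator (1 : α → ℝ))).subset ?_)
  rintro _ ⟨B, hB, rfl⟩
  exact ⟨B, hB.subset_ground, rfl⟩

lemma exists_finset_isBase (M : Matroid α) [M.RankFinite] : ∃ X : Finset α, M.IsBase X := by
  obtain ⟨X, hX⟩ := M.exists_isBase
  lift X to Finset α using hX.finite
  exact ⟨X, hX⟩

variable [DecidableEq α] {X Y : Finset α} {a b c e : α}

lemma baseDirection_le {V : Submodule ℝ (α → ℝ)} (hX : M.IsBase X)
    (hV : ∀ a b, IsExchange M X a b → exchangeVector a b ∈ V) : baseDirection M ≤ V := by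
  have hmem : (X : Set α).indicator (1 : α → ℝ) ∈ {x | ∃ B, M.IsBase B ∧ x = B.indicator 1} :=
    ⟨X, hX, rfl⟩
  rw [baseDirection, Matroid.basePolytope, ← direction_affineSpan, affineSpan_convexHull,
    direction_affineSpan, vectorSpan_eq_span_vsub_set_right ℝ hmem, Submodule.span_le]
  rintro _ ⟨_, ⟨Y, hY, rfl⟩, rfl⟩
  lift Y to Finset α using hX.finite_of_finite X.finite_toSet hY
  exact indicator_sub_mem_of_forall_isExchange hX hV hY

omit [DecidableEq α] in
lemma apply_eq_zero_of_notMem_ground [M.RankFinite] (hv : v ∈ baseDirection M) (ha : a ∉ M.E) :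
    v a = 0 := by
  classical
  obtain ⟨X, hX⟩ := exists_finset_isBase M
  exact baseDirection_le (V := LinearMap.ker (LinearMap.proj a)) hX
    (fun c d hcd => exchangeVector_apply_eq_zero
      (fun h => ha (h ▸ hX.subset_ground hcd.mem)) fun h => ha (h ▸ hcd.mem_ground)) hv

/-- Two elements belong to the same class if exchanging one for the other moves incidence vectors
parallel to the base polytope. -/
def SameClass (M : Matroid α) (a b : α) : Prop :=
  exchangeVector a b ∈ baseDirection M

lemma IsExchange.sameClass (hX : M.IsBase X) (hab : IsExchange M X a b) : SameClass M a b := by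
  have hmem := indicator_sub_mem_baseDirection hX hab.isBase
  rwa [indicator_exchange hab.mem hab.notMem, add_sub_cancel_left] at hmem

namespace SameClass

lemma refl (M : Matroid α) (a : α) : SameClass M a a := by
  rw [SameClass, exchangeVector_self]
  exact Submodule.zero_mem _

lemma symm (h : SameClass M a b) : SameClass M b a := by
  rw [SameClass, ← neg_exchangeVector]
  exact Submodule.neg_mem _ h

lemma trans (hab : SameClass M a b) (hbc : SameClass M b c) : SameClass M a c := by
  rw [SameClass, ← exchangeVector_add a b c]
  exact Submodule.add_mem _ hab hbc

end SameClass

lemma coordSum_eq_zero_of_saturated [M.RankFinite] {F : Finset α}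
    (hF : ∀ a ∈ M.E, ∀ b ∈ M.E, SameClass M a b → a ∈ F → b ∈ F) (hv : v ∈ baseDirection M) :
    Matroid.coordSum F v = 0 := by
  obtain ⟨X, hX⟩ := exists_finset_isBase M
  refine baseDirection_le (V := LinearMap.ker (Matroid.coordSum F)) hX (fun a b hab => ?_) hv
  have haE := hX.subset_ground hab.mem
  have hsame := hab.sameClass hX
  have hiff : a ∈ F ↔ b ∈ F := ⟨hF a haE b hab.mem_ground hsame,
    hF b hab.mem_ground a haE hsame.symm⟩
  simp [LinearMap.mem_ker, coordSum_exchangeVector, hiff]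

variable [M.Finite]

open Classical in
/-- The class of `e`, as a finite subset of the ground set. -/
noncomputable def classFinset (M : Matroid α) [M.Finite] (e : α) : Finset α :=
  M.ground_finite.toFinset.filter (SameClass M · e)

lemma mem_classFinset : a ∈ classFinset M e ↔ a ∈ M.E ∧ SameClass M a e := by
  simp [classFinset]

lemma SameClass.classFinset_eq (h : SameClass M a b) : classFinset M a = classFinset M b := by
  ext c
  rw [mem_classFinset, mem_classFinset]
  exact and_congr_right fun _ => ⟨fun hc => hc.trans h, fun hc => hc.trans h.symm⟩

lemma coordSum_classFinset (hv : v ∈ baseDirection M) (e : α) :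
    Matroid.coordSum (classFinset M e) v = 0 :=
  coordSum_eq_zero_of_saturated (fun _ _ _ hb hab ha =>
    mem_classFinset.2 ⟨hb, hab.symm.trans (mem_classFinset.1 ha).2⟩) hv

lemma card_inter_classFinset (hX : M.IsBase X) (hY : M.IsBase Y) (e : α) :
    (X ∩ classFinset M e).card = (Y ∩ classFinset M e).card := by
  have h := coordSum_classFinset (indicator_sub_mem_baseDirection hY hX) e
  rw [map_sub, coordSum_indicator, coordSum_indicator, sub_eq_zero] at h
  exact_mod_cast h

lemma indicator_classFinset_mem_baseDirection (hv : v ∈ baseDirection M) (e : α) :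
    (classFinset M e : Set α).indicator v ∈ baseDirection M := by
  obtain ⟨X, hX⟩ := exists_finset_isBase M
  let restrict : (α → ℝ) →ₗ[ℝ] (α → ℝ) :=
    { toFun := (classFinset M e : Set α).indicator
      map_add' := Set.indicator_add _
      map_smul' := fun c v => Set.indicator_const_smul _ c v }
  refine baseDirection_le (V := (baseDirection M).comap restrict) hX (fun a b hab => ?_) hv
  have hsame := hab.sameClass hX
  refine indicator_exchangeVector_mem hsame ?_
  simp only [Finset.mem_coe, mem_classFinset, hX.subset_ground hab.mem, hab.mem_ground, true_and]
  exact ⟨hsame.symm.trans, hsame.trans⟩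

end Direction

section Interior

variable {α : Type*} {M : Matroid α} {x y : α → ℝ} {a : α}

/-- A point of the affine hull of the base polytope all of whose non-constant coordinates are
strictly between `0` and `1`. These are the points in the relative interior of the ambient
polytope. -/
def IsInner (M : Matroid α) (x : α → ℝ) : Prop :=
  x ∈ affineSpan ℝ M.basePolytope ∧
    ∀ a, x a ∈ Set.Ioo 0 1 ∨ ∀ v ∈ baseDirection M, v a = 0

lemma indicator_mem_ambientPolytope {X : Set α} (hX : M.IsBase X) :
    X.indicator 1 ∈ M.ambientPolytope :=
  ⟨indicator_mem_affineSpan hX, Set.indicator_nonneg (fun _ _ => zero_le_one),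
    Set.indicator_le_self' (fun _ _ => zero_le_one)⟩

lemma apply_mem_Icc_of_forall_eq_zero (hx : x ∈ affineSpan ℝ M.basePolytope)
    (ha : ∀ v ∈ baseDirection M, v a = 0) : x a ∈ Set.Icc 0 1 := by
  obtain ⟨X, hX⟩ := M.exists_isBase
  have hxa := ha _ (sub_mem_baseDirection hx (indicator_mem_affineSpan hX))
  rw [sub_eq_zero.1 hxa]
  by_cases haX : a ∈ X <;> simp [haX]

namespace IsInner

lemma mem_ambientPolytope (hx : IsInner M x) : x ∈ M.ambientPolytope := by
  have hIcc (a : α) : x a ∈ Set.Icc 0 1 := (hx.2 a).elim (fun ha => Set.Ioo_subset_Icc_self ha)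
    (apply_mem_Icc_of_forall_eq_zero hx.1)
  exact ⟨hx.1, fun a => (hIcc a).1, fun a => (hIcc a).2⟩

lemma mem_intrinsicInterior [M.Finite] (hx : IsInner M x) :
    x ∈ intrinsicInterior ℝ M.ambientPolytope := by
  have hxQ := hx.mem_ambientPolytope
  refine _root_.mem_intrinsicInterior.2 ⟨⟨x, subset_affineSpan _ _ hxQ⟩, ?_, rfl⟩
  rw [mem_interior_iff_mem_nhds]
  have near_Ioo : ∀ᶠ z : affineSpan ℝ M.ambientPolytope in nhds ⟨x, subset_affineSpan _ _ hxQ⟩,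
      ∀ a ∈ M.E, x a ∈ Set.Ioo 0 1 → (z : α → ℝ) a ∈ Set.Ioo 0 1 := by
    rw [Filter.eventually_all_finite M.ground_finite]
    intro a _
    by_cases ha : x a ∈ Set.Ioo 0 1
    · have hcont : Continuous fun z : affineSpan ℝ M.ambientPolytope => (z : α → ℝ) a :=
        (continuous_apply a).comp continuous_subtype_val
      filter_upwards [hcont.continuousAt.eventually (Ioo_mem_nhds ha.1 ha.2)] with z hz _ using hz
    · exact Filter.Eventually.of_forall fun z hxa => absurd hxa ha
  filter_upwards [near_Ioo] with z hz
  have hzP : (z : α → ℝ) ∈ affineSpan ℝ M.basePolytope :=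
    affineSpan_le.2 Set.inter_subset_left z.2
  have hIcc (a : α) : (z : α → ℝ) a ∈ Set.Icc 0 1 := by
    by_cases haE : a ∈ M.E
    · exact (hx.2 a).elim (fun ha => Set.Ioo_subset_Icc_self (hz a haE ha))
        (apply_mem_Icc_of_forall_eq_zero hzP)
    · exact apply_mem_Icc_of_forall_eq_zero hzP
        fun v hv => apply_eq_zero_of_notMem_ground hv haE
  exact ⟨hzP, fun a => (hIcc a).1, fun a => (hIcc a).2⟩

lemma combo (hx : IsInner M x) (hy : y ∈ M.ambientPolytope) {s t : ℝ} (hs : 0 < s)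
    (ht : 0 ≤ t) (hst : s + t = 1) : IsInner M (s • x + t • y) := by
  refine ⟨(affineSpan ℝ M.basePolytope).convex hx.1 hy.1 hs.le ht hst, fun a => ?_⟩
  refine (hx.2 a).imp_left fun ha => ?_
  have h₀ : 0 ≤ y a := hy.2.1 a
  have h₁ : y a ≤ 1 := hy.2.2 a
  simp only [Pi.add_apply, Pi.smul_apply, smul_eq_mul]
  constructor
  · have := mul_pos hs ha.1
    have := mul_nonneg ht h₀
    linarith
  · have := mul_lt_mul_of_pos_left ha.2 hs
    have := mul_le_mul_of_nonneg_left h₁ ht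
    linarith

end IsInner

end Interior

/-! ### Exchange cuts are split flacets -/

section ExchangeCut

variable {α : Type*} [DecidableEq α] {M : Matroid α} {X Y F G : Finset α} {a b c e f : α}

lemma IsExchange.coordSum_exchangeVector_eq_sub (hab : IsExchange M X a b) (G : Finset α) :
    Matroid.coordSum G (exchangeVector a b) = (exchange X a b ∩ G).card - (X ∩ G).card := by
  rw [← coordSum_indicator, ← coordSum_indicator, indicator_exchange hab.mem hab.notMem,
    map_add, add_sub_cancel_left]

/-- A set `F` that separates `e ∈ X` from `f ∉ X` in the exchange graph of the base `X`, chosen so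
that `F` is a flacet: exchanges enter `F` only from inside, every element exchangeable out of `F`
is exchangeable for `f`, and the exchanges outside `F` connect the complement of `F` to `e`. -/
structure ExchangeCut (M : Matroid α) (X F : Finset α) (e f : α) : Prop where
  isBase : M.IsBase X
  left_mem : e ∈ X
  left_notMem : e ∉ F
  right_mem : f ∈ F
  right_notMem : f ∉ X
  subset_ground : (F : Set α) ⊆ M.E
  sameClass : SameClass M e f
  mem_of_isExchange : ∀ ⦃a b⦄, IsExchange M X a b → b ∈ F → a ∈ F
  isExchange_right : ∀ ⦃a b⦄, IsExchange M X a b → a ∈ F → b ∉ F → IsExchange M X a f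
  exchangeVector_mem : ∀ V : Submodule ℝ (α → ℝ),
    (∀ a b, IsExchange M X a b → (a ∈ F ↔ b ∈ F) → exchangeVector a b ∈ V) →
      ∀ b ∈ M.E, b ∉ F → exchangeVector e b ∈ V
  exists_isExchange : ∀ b ∈ M.E, b ∉ F → b ∉ X → ∃ a, a ∉ F ∧ IsExchange M X a b

section Existence

/-- The neighbourhood of `f` in the exchange graph of `X`, with `f` itself. -/
def IsNear (M : Matroid α) (X : Finset α) (f a : α) : Prop :=
  a = f ∨ IsExchange M X a f

/-- An edge of the exchange graph of `X` that leads from `a` to an element `b` outside of the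
neighbourhood of `f`. -/
structure IsFarEdge (M : Matroid α) (X : Finset α) (f a b : α) : Prop where
  not_isNear_right : ¬ IsNear M X f b
  isExchange_or : IsExchange M X a b ∨ IsExchange M X b a

/-- `b` is connected to `e` by a path that avoids the neighbourhood of `f` in the exchange graph
of `X`. -/
abbrev IsFarReachable (M : Matroid α) (X : Finset α) (f e b : α) : Prop :=
  Relation.ReflTransGen (IsFarEdge M X f) e b

lemma IsFarReachable.not_isNear (he : ¬ IsNear M X f e) (hb : IsFarReachable M X f e b) :
    ¬ IsNear M X f b := by
  rcases hb.cases_tail with rfl | ⟨c, -, hcb⟩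
  · exact he
  · exact hcb.not_isNear_right

lemma IsFarReachable.exchangeVector_mem {V : Submodule ℝ (α → ℝ)}
    (hV : ∀ a b, IsExchange M X a b → IsFarReachable M X f e a → IsFarReachable M X f e b →
      exchangeVector a b ∈ V) (hb : IsFarReachable M X f e b) : exchangeVector e b ∈ V := by
  induction hb with
  | refl => rw [exchangeVector_self]; exact V.zero_mem
  | @tail c d hc hcd ih =>
    rw [← exchangeVector_add e c d]
    refine V.add_mem ih ?_
    rcases hcd.isExchange_or with h | h
    · exact hV c d h hc (hc.tail hcd)
    · rw [← neg_exchangeVector]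
      exact V.neg_mem (hV d c h (hc.tail hcd) hc)

lemma exists_exchangeCut [M.Finite] (hX : M.IsBase X) (he : e ∈ X) (hf : f ∈ M.E) (hfX : f ∉ X)
    (hef : ¬ IsExchange M X e f) (hsame : SameClass M e f) : ∃ F, ExchangeCut M X F e f := by
  classical
  have he_far : ¬ IsNear M X f e := not_or.2 ⟨fun h => hfX (h ▸ he), hef⟩
  let F := M.ground_finite.toFinset.filter (fun a => ¬ IsFarReachable M X f e a)
  have hF {a : α} : a ∈ F ↔ a ∈ M.E ∧ ¬ IsFarReachable M X f e a := by simp [F]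
  have hreach {a : α} (ha : a ∈ M.E) : a ∉ F ↔ IsFarReachable M X f e a := by simp [hF, ha]
  have hfar {a : α} (ha : a ∈ M.E) (haF : a ∉ F) : ¬ IsNear M X f a :=
    ((hreach ha).1 haF).not_isNear he_far
  refine ⟨F, hX, he, (hreach (hX.subset_ground he)).2 .refl,
    hF.2 ⟨hf, fun h => h.not_isNear he_far (Or.inl rfl)⟩, hfX, fun a ha => (hF.1 ha).1, hsame,
    fun a b hab hbF => ?_, fun a b hab haF hbF => ?_, fun V hV b hb hbF => ?_,
    fun b hb hbF hbX => ?_⟩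
  · by_contra haF
    have ha := hX.subset_ground hab.mem
    have hb : IsNear M X f b := by
      by_contra hb
      exact (hF.1 hbF).2 (((hreach ha).1 haF).tail ⟨hb, Or.inl hab⟩)
    rcases hb with rfl | hb
    · exact hfar ha haF (Or.inr hab)
    · exact hab.notMem hb.mem
  · have ha : IsNear M X f a := by
      by_contra ha
      exact (hF.1 haF).2 (((hreach hab.mem_ground).1 hbF).tail ⟨ha, Or.inr hab⟩)
    exact ha.resolve_left fun h => hfX (h ▸ hab.mem)
  · exact ((hreach hb).1 hbF).exchangeVector_mem fun a b hab ha hb =>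
      hV a b hab (iff_of_false (fun h => (hF.1 h).2 ha) fun h => (hF.1 h).2 hb)
  · rcases ((hreach hb).1 hbF).cases_tail with rfl | ⟨c, hc, hcb⟩
    · exact absurd he hbX
    · exact ⟨c, fun h => (hF.1 h).2 hc,
        hcb.isExchange_or.resolve_right fun h => hbX h.mem⟩

end Existence

/-- The face of the base polytope on which `x(F)` attains the rank of `F`. -/
def rankFace (M : Matroid α) (F : Finset α) : Set (α → ℝ) :=
  {x ∈ M.basePolytope | Matroid.coordSum F x = M.natRk F}

omit [DecidableEq α] in
lemma vectorSpan_rankFace_le_baseDirection (M : Matroid α) (F : Finset α) :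
    vectorSpan ℝ (rankFace M F) ≤ baseDirection M :=
  vectorSpan_mono ℝ (Set.sep_subset _ _)

omit [DecidableEq α] in
lemma vectorSpan_rankFace_le_ker (M : Matroid α) (F : Finset α) :
    vectorSpan ℝ (rankFace M F) ≤ LinearMap.ker (Matroid.coordSum F) := by
  rw [vectorSpan_def, Submodule.span_le]
  rintro _ ⟨x, hx, y, hy, rfl⟩
  simp [hx.2, hy.2]

lemma card_inter_le_natRk (hY : M.IsBase Y) (F : Finset α) : (Y ∩ F).card ≤ M.natRk F := by
  have hle : ((Y ∩ F).card : ℕ∞) ≤ M.eRk F := by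
    rw [← Set.encard_coe_eq_coe_finsetCard]
    exact (hY.indep.subset (by simp)).encard_le_eRk_of_subset (by simp)
  have hfin : M.eRk (F : Set α) ≠ ⊤ :=
    ne_top_of_le_ne_top (Set.encard_ne_top_iff.2 F.finite_toSet) (M.eRk_le_encard F)
  rwa [Matroid.natRk, ← ENat.natCast_le_natCast, ENat.natCast_toNat hfin]

lemma indicator_mem_rankFace (hY : M.IsBase Y) (hYF : (Y ∩ F).card = M.natRk F) :
    (Y : Set α).indicator 1 ∈ rankFace M F :=
  ⟨indicator_mem_basePolytope hY, by rw [coordSum_indicator, hYF]⟩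

namespace ExchangeCut

lemma subset_closure (h : ExchangeCut M X F e f) :
    (F : Set α) ⊆ M.closure (X ∩ F : Finset α) := by
  intro b hb
  by_cases hbX : b ∈ X
  · exact M.mem_closure_of_mem' (by simp [hbX, Finset.mem_coe.1 hb]) (h.subset_ground hb)
  · refine mem_closure_of_forall_isExchange h.isBase (h.subset_ground hb) hbX fun a hab => ?_
    exact M.mem_closure_of_mem' (by simp [hab.mem, h.mem_of_isExchange hab hb])
      (h.isBase.subset_ground hab.mem)

lemma isBasis (h : ExchangeCut M X F e f) : M.IsBasis (X ∩ F : Finset α) F :=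
  (h.isBase.indep.subset (by simp)).isBasis_of_subset_of_subset_closure (by simp) h.subset_closure

lemma natRk_eq (h : ExchangeCut M X F e f) : M.natRk F = (X ∩ F).card := by
  rw [Matroid.natRk, ← h.isBasis.encard_eq_eRk, Set.encard_coe_eq_coe_finsetCard,
    ENat.toNat_natCast]

lemma isFlat (h : ExchangeCut M X F e f) : M.IsFlat (F : Set α) := by
  rw [Matroid.isFlat_iff_closure_eq, ← h.isBasis.closure_eq_closure]
  refine subset_antisymm (fun b hb => ?_) h.subset_closure
  by_contra hbF
  have hbF : b ∉ F := hbF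
  obtain ⟨Y, hY, hbY, hXY⟩ : ∃ Y : Finset α, M.IsBase Y ∧ b ∈ Y ∧ X ∩ F ⊆ Y.erase b := by
    by_cases hbX : b ∈ X
    · exact ⟨X, h.isBase, hbX, by grind⟩
    · obtain ⟨a, haF, hab⟩ := h.exists_isExchange b (M.mem_ground_of_mem_closure hb) hbF hbX
      exact ⟨_, hab.isBase, by simp, by grind⟩
  refine hY.indep.notMem_closure_sdiff_of_mem (e := b) hbY (M.closure_subset_closure ?_ hb)
  rw [← Finset.coe_erase]
  exact_mod_cast hXY

lemma card_inter_exchange (h : ExchangeCut M X F e f) (hab : IsExchange M X a b)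
    (habF : a ∈ F ↔ b ∈ F) : (exchange X a b ∩ F).card = M.natRk F := by
  rw [card_exchange_inter_of_mem_iff hab.mem hab.notMem habF, h.natRk_eq]

lemma exchangeVector_mem_vectorSpan (h : ExchangeCut M X F e f) (hab : IsExchange M X a b)
    (habF : a ∈ F ↔ b ∈ F) : exchangeVector a b ∈ vectorSpan ℝ (rankFace M F) := by
  have hmem := vsub_mem_vectorSpan ℝ
    (indicator_mem_rankFace hab.isBase (h.card_inter_exchange hab habF))
    (indicator_mem_rankFace h.isBase h.natRk_eq.symm)
  rwa [indicator_exchange hab.mem hab.notMem, vsub_eq_sub, add_sub_cancel_left] at hmem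

lemma coordSum_exchangeVector_eq_one (h : ExchangeCut M X F e f) :
    Matroid.coordSum F (exchangeVector e f) = 1 := by
  simp [coordSum_exchangeVector, h.right_mem, h.left_notMem]

lemma exchangeVector_ne_zero (h : ExchangeCut M X F e f) : exchangeVector e f ≠ 0 := by
  intro h₀
  have hone := h.coordSum_exchangeVector_eq_one
  rw [h₀, map_zero] at hone
  exact zero_ne_one hone

lemma baseDirection_le_sup (h : ExchangeCut M X F e f) {V : Submodule ℝ (α → ℝ)}
    (hV : ∀ a b, IsExchange M X a b → (a ∈ F ↔ b ∈ F) → exchangeVector a b ∈ V) :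
    baseDirection M ≤ V ⊔ Submodule.span ℝ {exchangeVector e f} := by
  refine baseDirection_le h.isBase fun a b hab => ?_
  by_cases habF : a ∈ F ↔ b ∈ F
  · exact Submodule.mem_sup_left (hV a b hab habF)
  obtain ⟨haF, hbF⟩ : a ∈ F ∧ b ∉ F := by
    have := h.mem_of_isExchange hab
    tauto
  -- Replace the exchange leaving `F` by the path `a → f → e → b`.
  have haf := hV a f (h.isExchange_right hab haF hbF) (iff_of_true haF h.right_mem)
  have heb := h.exchangeVector_mem V hV b hab.mem_ground hbF
  have hfe : exchangeVector f e ∈ Submodule.span ℝ {exchangeVector e f} := by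
    rw [← neg_exchangeVector e f, Submodule.neg_mem_iff]
    exact Submodule.mem_span_singleton_self _
  rw [← exchangeVector_add a f b, ← exchangeVector_add f e b]
  exact Submodule.add_mem _ (Submodule.mem_sup_left haf)
    (Submodule.add_mem _ (Submodule.mem_sup_right hfe) (Submodule.mem_sup_left heb))

lemma baseDirection_eq_sup (h : ExchangeCut M X F e f) :
    baseDirection M = vectorSpan ℝ (rankFace M F) ⊔ Submodule.span ℝ {exchangeVector e f} :=
  le_antisymm (h.baseDirection_le_sup fun _ _ => h.exchangeVector_mem_vectorSpan)
    (sup_le (vectorSpan_rankFace_le_baseDirection M F)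
      ((Submodule.span_singleton_le_iff_mem _ _).2 h.sameClass))

lemma vectorSpan_rankFace_inf_span (h : ExchangeCut M X F e f) :
    vectorSpan ℝ (rankFace M F) ⊓ Submodule.span ℝ {exchangeVector e f} = ⊥ := by
  rw [← disjoint_iff, Submodule.disjoint_span_singleton' h.exchangeVector_ne_zero]
  intro hmem
  have hzero : Matroid.coordSum F (exchangeVector e f) = 0 := vectorSpan_rankFace_le_ker M F hmem
  rw [h.coordSum_exchangeVector_eq_one] at hzero
  exact one_ne_zero hzero

lemma isFlacet [M.Finite] (h : ExchangeCut M X F e f) : M.IsFlacet F := by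
  refine ⟨h.isFlat, ⟨_, indicator_mem_rankFace h.isBase h.natRk_eq.symm⟩, ?_⟩
  change Module.finrank ℝ (vectorSpan ℝ (rankFace M F)) + 1 = Module.finrank ℝ (baseDirection M)
  have := finiteDimensional_baseDirection M
  have := Submodule.finiteDimensional_of_le (vectorSpan_rankFace_le_baseDirection M F)
  have hrank := Submodule.finrank_sup_add_finrank_inf_eq (vectorSpan ℝ (rankFace M F))
    (Submodule.span ℝ {exchangeVector e f})
  rw [h.vectorSpan_rankFace_inf_span, finrank_bot, ← h.baseDirection_eq_sup,
    finrank_span_singleton h.exchangeVector_ne_zero, add_zero] at hrank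
  exact hrank.symm

lemma exists_coordSum_eq_mul (h : ExchangeCut M X F e f)
    (hG : ∀ Y : Finset α, M.IsBase Y → (Y ∩ F).card = M.natRk F → (Y ∩ G).card = (X ∩ G).card) :
    ∃ s : ℝ, ∀ v ∈ baseDirection M, Matroid.coordSum G v = s * Matroid.coordSum F v := by
  refine ⟨Matroid.coordSum G (exchangeVector e f), fun v hv => ?_⟩
  have hker : ∀ a b, IsExchange M X a b → (a ∈ F ↔ b ∈ F) → exchangeVector a b ∈
      LinearMap.ker (Matroid.coordSum F) ⊓ LinearMap.ker (Matroid.coordSum G) := by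
    intro a b hab habF
    refine ⟨vectorSpan_rankFace_le_ker M F (h.exchangeVector_mem_vectorSpan hab habF), ?_⟩
    rw [SetLike.mem_coe, LinearMap.mem_ker, hab.coordSum_exchangeVector_eq_sub,
      hG _ hab.isBase (h.card_inter_exchange hab habF), sub_self]
  obtain ⟨w, ⟨hwF, hwG⟩, u, hu, rfl⟩ := Submodule.mem_sup.1 (h.baseDirection_le_sup hker hv)
  obtain ⟨t, rfl⟩ := Submodule.mem_span_singleton.1 hu
  simp only [SetLike.mem_coe, LinearMap.mem_ker] at hwF hwG
  simp [hwF, hwG, h.coordSum_exchangeVector_eq_one, mul_comm]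

lemma exists_isExchange_left (h : ExchangeCut M X F e f) (hab : IsExchange M X a b) :
    ∃ b', IsExchange M X a b' ∧ (a ∈ F ↔ b' ∈ F) := by
  by_cases haF : a ∈ F
  · by_cases hbF : b ∈ F
    · exact ⟨b, hab, iff_of_true haF hbF⟩
    · exact ⟨f, h.isExchange_right hab haF hbF, iff_of_true haF h.right_mem⟩
  · exact ⟨b, hab, iff_of_false haF fun hbF => haF (h.mem_of_isExchange hab hbF)⟩

lemma exists_isExchange_right (h : ExchangeCut M X F e f) (hab : IsExchange M X a b) :
    ∃ a', IsExchange M X a' b ∧ (a' ∈ F ↔ b ∈ F) := by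
  by_cases hbF : b ∈ F
  · exact ⟨a, hab, iff_of_true (h.mem_of_isExchange hab hbF) hbF⟩
  · obtain ⟨a', haF, ha'⟩ := h.exists_isExchange b hab.mem_ground hbF hab.notMem
    exact ⟨a', ha', iff_of_false haF hbF⟩

end ExchangeCut

/-- The bases that attain the rank of `F`. -/
def IsTightBase (M : Matroid α) (F Y : Finset α) : Prop :=
  M.IsBase Y ∧ (Y ∩ F).card = M.natRk F

lemma ExchangeCut.isTightBase (h : ExchangeCut M X F e f) : IsTightBase M F X :=
  ⟨h.isBase, h.natRk_eq.symm⟩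

lemma ExchangeCut.forall_eq_zero_or_exists_isTightBase (h : ExchangeCut M X F e f) (c : α) :
    (∀ v ∈ baseDirection M, v c = 0) ∨
      ∃ Y Z, IsTightBase M F Y ∧ IsTightBase M F Z ∧ c ∈ Y ∧ c ∉ Z := by
  by_cases hc : ∃ a b, IsExchange M X a b ∧ (a ∈ F ↔ b ∈ F) ∧ (c = a ∨ c = b)
  · obtain ⟨a, b, hab, habF, hc⟩ := hc
    have htight : IsTightBase M F (exchange X a b) := ⟨hab.isBase, h.card_inter_exchange hab habF⟩
    rcases hc with rfl | rfl
    · have hcb : c ≠ b := fun hcb => hab.notMem (hcb ▸ hab.mem)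
      exact Or.inr ⟨X, _, h.isTightBase, htight, hab.mem, by simp [hcb]⟩
    · exact Or.inr ⟨_, X, htight, h.isTightBase, by simp, hab.notMem⟩
  · refine Or.inl fun v hv => ?_
    refine baseDirection_le (V := LinearMap.ker (LinearMap.proj c)) h.isBase (fun a b hab => ?_) hv
    refine exchangeVector_apply_eq_zero (fun hca => hc ?_) fun hcb => hc ?_
    · obtain ⟨b', hab', habF⟩ := h.exists_isExchange_left hab
      exact ⟨a, b', hab', habF, Or.inl hca⟩
    · obtain ⟨a', hab', habF⟩ := h.exists_isExchange_right hab
      exact ⟨a', b, hab', habF, Or.inr hcb⟩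

omit [DecidableEq α] in
lemma finite_setOf_isBase (M : Matroid α) [M.Finite] :
    {Y : Finset α | M.IsBase Y}.Finite :=
  M.ground_finite.toFinset.powerset.finite_toSet.subset fun Y hY => by
    simpa using Matroid.IsBase.subset_ground hY

open scoped BigOperators

lemma expect_mem_of_convex {ι E : Type*} [AddCommGroup E] [Module ℝ E] [Module ℚ≥0 E] {C : Set E}
    (hC : Convex ℝ C) {s : Finset ι} (hs : s.Nonempty) {z : ι → E} (hz : ∀ i ∈ s, z i ∈ C) :
    𝔼 i ∈ s, z i ∈ C := by
  have hcard : (s.card : ℝ) ≠ 0 := Nat.cast_ne_zero.2 hs.card_ne_zero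
  have hsum : 𝔼 i ∈ s, z i = ∑ i ∈ s, (s.card : ℝ)⁻¹ • z i := by
    rw [Finset.expect, ← Finset.smul_sum, ← NNRat.cast_smul_eq_nnqsmul ℝ]
    simp
  rw [hsum]
  exact hC.sum_mem (fun _ _ => by positivity) (by simp [hcard]) hz

lemma ExchangeCut.exists_isInner [M.Finite] (h : ExchangeCut M X F e f) :
    ∃ u, IsInner M u ∧ Matroid.coordSum F u = M.natRk F := by
  let 𝓕 : Finset (Finset α) :=
    ((finite_setOf_isBase M).subset fun Y (hY : IsTightBase M F Y) => hY.1).toFinset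
  have h𝓕 {Y : Finset α} : Y ∈ 𝓕 ↔ IsTightBase M F Y :=
    Set.Finite.mem_toFinset _
  have hne : 𝓕.Nonempty := ⟨X, h𝓕.2 h.isTightBase⟩
  let u : α → ℝ := 𝔼 Y ∈ 𝓕, (Y : Set α).indicator 1
  have hu (a : α) : u a = 𝔼 Y ∈ 𝓕, (Y : Set α).indicator 1 a :=
    map_expect (LinearMap.proj (R := ℚ≥0) (φ := fun _ : α => ℝ) a) _ _
  refine ⟨u, ⟨?_, fun a => ?_⟩, ?_⟩
  · exact expect_mem_of_convex (affineSpan ℝ M.basePolytope).convex hne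
      fun Y hY => indicator_mem_affineSpan (h𝓕.1 hY).1
  · refine (h.forall_eq_zero_or_exists_isTightBase a).symm.imp_left ?_
    rintro ⟨Y, Z, hY, hZ, haY, haZ⟩
    rw [hu]
    exact ⟨Finset.expect_pos' (fun _ _ => Set.indicator_nonneg (fun _ _ => zero_le_one) a)
        ⟨Y, h𝓕.2 hY, by simp [haY]⟩,
      Finset.expect_lt (fun _ _ => Set.indicator_le_self' (fun _ _ => zero_le_one) a)
        ⟨Z, h𝓕.2 hZ, by simp [haZ]⟩⟩
  · have hcoord : ∀ Y ∈ 𝓕, Matroid.coordSum F ((Y : Set α).indicator 1) = M.natRk F := by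
      intro Y hY
      rw [coordSum_indicator, (h𝓕.1 hY).2]
    rw [← Finset.expect_const hne (M.natRk F : ℝ), ← Finset.expect_congr rfl hcoord]
    exact map_expect ((Matroid.coordSum F).restrictScalars ℚ≥0) _ _

end ExchangeCut

section ExtremePoints

lemma eq_zero_of_mem_extremePoints {E : Type*} [AddCommGroup E] [Module ℝ E] {C : Set E} {x v : E}
    (hx : x ∈ C.extremePoints ℝ) (hv : ∀ᶠ ε : ℝ in nhds 0, x + ε • v ∈ C) : v = 0 := by
  obtain ⟨δ, hδ, hball⟩ := Metric.eventually_nhds_iff.1 hv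
  have hdist : dist (δ / 2) 0 < δ := by
    rw [Real.dist_eq, sub_zero, abs_of_pos (by linarith)]
    linarith
  have hplus : x + (δ / 2) • v ∈ C := hball hdist
  have hminus : x + (-(δ / 2)) • v ∈ C := hball (by simpa using hdist)
  have hmid : x ∈ openSegment ℝ (x + (δ / 2) • v) (x + (-(δ / 2)) • v) :=
    ⟨1 / 2, 1 / 2, by norm_num, by norm_num, by norm_num, by module⟩
  have heq := (mem_extremePoints_iff_left.1 hx).2 _ hplus _ hminus hmid
  rw [add_eq_left] at heq
  exact (smul_eq_zero.1 heq).resolve_left (by positivity)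

lemma exists_ne_mem_Ioo {α : Type*} {x : α → ℝ} {S : Finset α} {a : α} {n : ℤ}
    (hS : ∑ b ∈ S, x b = n) (hx : ∀ b ∈ S, x b ∈ Set.Icc 0 1) (ha : a ∈ S)
    (hxa : x a ∈ Set.Ioo 0 1) : ∃ b ∈ S, b ≠ a ∧ x b ∈ Set.Ioo 0 1 := by
  classical
  by_contra! hnot
  have hround : ∀ b ∈ S.erase a, x b = (⌊x b⌋ : ℤ) := by
    intro b hb
    have hbS := Finset.mem_of_mem_erase hb
    rcases Set.eq_endpoints_or_mem_Ioo_of_mem_Icc (hx b hbS) with h | h | h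
    · simp [h]
    · simp [h]
    · exact absurd h (hnot b hbS (Finset.ne_of_mem_erase hb))
  rw [← Finset.add_sum_erase _ _ ha, Finset.sum_congr rfl hround, ← Int.cast_sum,
    ← eq_sub_iff_add_eq, ← Int.cast_sub] at hS
  rw [hS] at hxa
  have hpos := Int.cast_pos.1 hxa.1
  have hlt : n - ∑ b ∈ S.erase a, ⌊x b⌋ < 1 := by exact_mod_cast hxa.2
  omega

variable {α : Type*} {M : Matroid α} {x : α → ℝ} {a : α}

lemma mem_extremePoints_of_forall_eq_zero_or_one (hx : x ∈ M.ambientPolytope)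
    (h01 : ∀ a, x a = 0 ∨ x a = 1) : x ∈ M.ambientPolytope.extremePoints ℝ := by
  refine inter_extremePoints_subset_extremePoints_of_subset Set.inter_subset_right ⟨hx, ?_⟩
  rw [← Set.pi_univ_Icc, extremePoints_pi]
  exact fun a _ => by simpa using h01 a

lemma apply_eq_zero_of_mem_affineSpan [M.RankFinite] (hx : x ∈ affineSpan ℝ M.basePolytope)
    (ha : a ∉ M.E) : x a = 0 := by
  obtain ⟨X, hX⟩ := M.exists_isBase
  have h := apply_eq_zero_of_notMem_ground
    (sub_mem_baseDirection hx (indicator_mem_affineSpan hX)) ha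
  rwa [Pi.sub_apply, Set.indicator_of_notMem (fun haX => ha (hX.subset_ground haX)), sub_zero] at h

lemma exists_int_sum_eq [M.RankFinite] {S : Finset α}
    (hS : ∀ v ∈ baseDirection M, Matroid.coordSum S v = 0)
    (hx : x ∈ affineSpan ℝ M.basePolytope) : ∃ n : ℤ, ∑ b ∈ S, x b = n := by
  classical
  obtain ⟨X, hX⟩ := exists_finset_isBase M
  have h := hS _ (sub_mem_baseDirection hx (indicator_mem_affineSpan hX))
  rw [map_sub, sub_eq_zero, coordSum_indicator, coordSum_apply] at h
  exact ⟨(X ∩ S).card, by rw [h, Int.cast_natCast]⟩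

variable [DecidableEq α] {X F : Finset α} {b e f : α}

lemma eventually_add_smul_exchangeVector_mem_Icc (hx : x ∈ Set.Icc 0 1)
    (ha : x a ∈ Set.Ioo 0 1) (hb : x b ∈ Set.Ioo 0 1) :
    ∀ᶠ ε : ℝ in nhds 0, x + ε • exchangeVector a b ∈ Set.Icc 0 1 := by
  have eventually_mem {c : α} (hc : x c ∈ Set.Ioo 0 1) :
      ∀ᶠ ε : ℝ in nhds 0, (x + ε • exchangeVector a b) c ∈ Set.Ioo 0 1 := by
    have hcont : Continuous fun ε : ℝ => (x + ε • exchangeVector a b) c := by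
      simp only [Pi.add_apply, Pi.smul_apply]
      fun_prop
    have hc₀ : (x + (0 : ℝ) • exchangeVector a b) c ∈ Set.Ioo 0 1 := by simpa using hc
    exact hcont.continuousAt.eventually (Ioo_mem_nhds hc₀.1 hc₀.2)
  filter_upwards [eventually_mem ha, eventually_mem hb] with ε hεa hεb
  have hIcc (c : α) : (x + ε • exchangeVector a b) c ∈ Set.Icc 0 1 := by
    obtain rfl | hca := eq_or_ne c a
    · exact Set.Ioo_subset_Icc_self hεa
    obtain rfl | hcb := eq_or_ne c b
    · exact Set.Ioo_subset_Icc_self hεb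
    · simpa [exchangeVector_apply_eq_zero hca hcb] using ⟨hx.1 c, hx.2 c⟩
  exact ⟨fun c => (hIcc c).1, fun c => (hIcc c).2⟩

lemma notMem_Ioo_of_mem_extremePoints {I : Set ℝ} {c : ℝ}
    (hI : ∀ s ∈ I, s ≠ c → I ∈ nhds s)
    (hx : x ∈ {x ∈ M.ambientPolytope | Matroid.coordSum F x ∈ I}.extremePoints ℝ) (hab : a ≠ b)
    (hsame : SameClass M a b) (hF : Matroid.coordSum F x = c → (a ∈ F ↔ b ∈ F))
    (ha : x a ∈ Set.Ioo 0 1) : x b ∉ Set.Ioo 0 1 := by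
  intro hb
  obtain ⟨⟨hxP, hxIcc⟩, hxI⟩ := extremePoints_subset hx
  have eventually_mem :
      ∀ᶠ ε : ℝ in nhds 0, Matroid.coordSum F (x + ε • exchangeVector a b) ∈ I := by
    by_cases hxc : Matroid.coordSum F x = c
    · have hzero : Matroid.coordSum F (exchangeVector a b) = 0 := by
        simp [coordSum_exchangeVector, hF hxc]
      simpa [hzero] using hxI
    · have hcont : Continuous fun ε : ℝ => Matroid.coordSum F (x + ε • exchangeVector a b) := by
        simp only [map_add, map_smul]
        fun_prop
      exact hcont.continuousAt.eventually (by simpa using hI _ hxI hxc)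
  have hzero : exchangeVector a b = 0 := by
    refine eq_zero_of_mem_extremePoints hx ?_
    filter_upwards [eventually_add_smul_exchangeVector_mem_Icc hxIcc ha hb, eventually_mem]
      with ε hεIcc hεI
    exact ⟨⟨add_mem_affineSpan hxP (Submodule.smul_mem _ ε hsame), hεIcc⟩, hεI⟩
  have happly := congrFun hzero b
  simp [exchangeVector, hab.symm] at happly

namespace ExchangeCut

variable [M.Finite]

lemma mem_classFinset_of_notMem (h : ExchangeCut M X F e f) (ha : a ∈ M.E) (haF : a ∉ F) :
    a ∈ classFinset M e :=
  mem_classFinset.2 ⟨ha, SameClass.symm <|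
    h.exchangeVector_mem _ (fun _ _ hab _ => hab.sameClass h.isBase) a ha haF⟩

lemma exists_int_sum_classFinset_inter_eq (h : ExchangeCut M X F e f)
    (hx : x ∈ affineSpan ℝ M.basePolytope) (hF : Matroid.coordSum F x = M.natRk F) (a : α) :
    ∃ n : ℤ, ∑ b ∈ classFinset M a ∩ F, x b = n := by
  have hmem {b : α} := @mem_classFinset α M _ b
  by_cases hae : SameClass M a e
  · obtain ⟨n, hn⟩ : ∃ n : ℤ, ∑ b ∈ F \ classFinset M e, x b = n := by
      refine exists_int_sum_eq (fun v hv => coordSum_eq_zero_of_saturated ?_ hv) hx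
      intro c hc d hd hcd hcF
      have hde : d ∉ classFinset M e := fun hde => (Finset.mem_sdiff.1 hcF).2
        (hmem.2 ⟨hc, hcd.trans (hmem.1 hde).2⟩)
      exact Finset.mem_sdiff.2 ⟨by_contra fun hdF => hde (h.mem_classFinset_of_notMem hd hdF), hde⟩
    have hsum := Finset.sum_inter_add_sum_sdiff F (classFinset M e) x
    rw [hn, ← coordSum_apply F, hF] at hsum
    refine ⟨M.natRk F - n, ?_⟩
    rw [hae.classFinset_eq, Finset.inter_comm]
    push_cast
    linarith
  · have hsub : classFinset M a ⊆ F := by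
      intro b hb
      by_contra hbF
      have hb := hmem.1 hb
      exact hae (hb.2.symm.trans (hmem.1 (h.mem_classFinset_of_notMem hb.1 hbF)).2)
    rw [Finset.inter_eq_left.2 hsub]
    exact exists_int_sum_eq (fun v hv => coordSum_classFinset hv a) hx

lemma exists_int_sum_classFinset_sdiff_eq (h : ExchangeCut M X F e f)
    (hx : x ∈ affineSpan ℝ M.basePolytope) (hF : Matroid.coordSum F x = M.natRk F) (a : α) :
    ∃ n : ℤ, ∑ b ∈ classFinset M a \ F, x b = n := by
  obtain ⟨n, hn⟩ := h.exists_int_sum_classFinset_inter_eq hx hF a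
  obtain ⟨m, hm⟩ := exists_int_sum_eq (fun v hv => coordSum_classFinset hv a) hx
  have hsum := Finset.sum_inter_add_sum_sdiff (classFinset M a) F x
  exact ⟨m - n, by push_cast; linarith⟩

lemma exists_sameClass_mem_Ioo (h : ExchangeCut M X F e f) (hx : x ∈ M.ambientPolytope)
    (ha : a ∈ M.E) (hxa : x a ∈ Set.Ioo 0 1) :
    ∃ b, a ≠ b ∧ SameClass M a b ∧ x b ∈ Set.Ioo 0 1 ∧
      (Matroid.coordSum F x = M.natRk F → (a ∈ F ↔ b ∈ F)) := by
  suffices hS : ∃ S ⊆ classFinset M a, a ∈ S ∧ (∃ n : ℤ, ∑ b ∈ S, x b = n) ∧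
      ∀ b ∈ S, Matroid.coordSum F x = M.natRk F → (a ∈ F ↔ b ∈ F) by
    obtain ⟨S, hSa, haS, ⟨n, hn⟩, hSF⟩ := hS
    obtain ⟨b, hbS, hba, hxb⟩ :=
      exists_ne_mem_Ioo hn (fun b _ => ⟨hx.2.1 b, hx.2.2 b⟩) haS hxa
    exact ⟨b, hba.symm, (mem_classFinset.1 (hSa hbS)).2.symm, hxb, hSF b hbS⟩
  have haa : a ∈ classFinset M a := mem_classFinset.2 ⟨ha, .refl M a⟩
  by_cases hF : Matroid.coordSum F x = M.natRk F
  · by_cases haF : a ∈ F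
    · exact ⟨_, Finset.inter_subset_left, Finset.mem_inter.2 ⟨haa, haF⟩,
        h.exists_int_sum_classFinset_inter_eq hx.1 hF a,
        fun b hb _ => iff_of_true haF (Finset.mem_inter.1 hb).2⟩
    · exact ⟨_, Finset.sdiff_subset, Finset.mem_sdiff.2 ⟨haa, haF⟩,
        h.exists_int_sum_classFinset_sdiff_eq hx.1 hF a,
        fun b hb _ => iff_of_false haF (Finset.mem_sdiff.1 hb).2⟩
  · exact ⟨_, subset_rfl, haa, exists_int_sum_eq (fun v hv => coordSum_classFinset hv a) hx.1,
      fun b _ hF' => absurd hF' hF⟩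

lemma extremePoints_cell_subset (h : ExchangeCut M X F e f) {I : Set ℝ}
    (hI : ∀ s ∈ I, s ≠ M.natRk F → I ∈ nhds s) :
    {x ∈ M.ambientPolytope | Matroid.coordSum F x ∈ I}.extremePoints ℝ ⊆
      M.ambientPolytope.extremePoints ℝ := by
  intro x hx
  have hxQ := (extremePoints_subset hx).1
  refine mem_extremePoints_of_forall_eq_zero_or_one hxQ fun a => ?_
  by_cases haE : a ∈ M.E
  · rcases Set.eq_endpoints_or_mem_Ioo_of_mem_Icc ⟨hxQ.2.1 a, hxQ.2.2 a⟩ with h₀ | h₁ | hxa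
    · exact Or.inl h₀
    · exact Or.inr h₁
    · obtain ⟨b, hab, hsame, hxb, hF⟩ := h.exists_sameClass_mem_Ioo hxQ haE hxa
      exact absurd hxb (notMem_Ioo_of_mem_extremePoints hI hx hab hsame hF hxa)
  · exact Or.inl (apply_eq_zero_of_mem_affineSpan hxQ.1 haE)

omit [M.Finite] in
lemma exists_isBase_card_lt (h : ExchangeCut M X F e f) :
    ∃ Y : Finset α, M.IsBase Y ∧ (Y ∩ F).card < M.natRk F := by
  by_contra! hge
  have hker : baseDirection M ≤ LinearMap.ker (Matroid.coordSum F) := by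
    refine baseDirection_le h.isBase fun a b hab => ?_
    rw [LinearMap.mem_ker, hab.coordSum_exchangeVector_eq_sub,
      (card_inter_le_natRk hab.isBase F).antisymm (hge _ hab.isBase), h.natRk_eq, sub_self]
  have hzero : Matroid.coordSum F (exchangeVector e f) = 0 := hker h.sameClass
  rw [h.coordSum_exchangeVector_eq_one] at hzero
  exact one_ne_zero hzero

lemma isSplitFlacet (h : ExchangeCut M X F e f) : M.IsSplitFlacet F := by
  refine ⟨h.isFlacet, ?_, ?_, ?_, ?_⟩
  · obtain ⟨u, hu, hF⟩ := h.exists_isInner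
    exact ⟨u, hu.mem_intrinsicInterior, hF⟩
  · obtain ⟨Y, hY, hlt⟩ := h.exists_isBase_card_lt
    refine ⟨_, indicator_mem_ambientPolytope hY, ?_⟩
    rw [coordSum_indicator]
    exact_mod_cast hlt.ne
  · exact h.extremePoints_cell_subset (I := Set.Iic _) fun s hs hne =>
      Iic_mem_nhds (lt_of_le_of_ne hs hne)
  · exact h.extremePoints_cell_subset (I := Set.Ici _) fun s hs hne =>
      Ici_mem_nhds (lt_of_le_of_ne hs hne.symm)

end ExchangeCut

end ExtremePoints

section SplitHyperplanes

variable {α : Type*} {M : Matroid α} {F G : Finset α} {u x y : α → ℝ} {r c : ℝ}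

lemma IsInner.exists_isInner (hu : IsInner M u) (hy : y ∈ M.ambientPolytope)
    (huF : Matroid.coordSum F u = r) (hyF : Matroid.coordSum F y = r)
    (h : (Matroid.coordSum G u - c) * (Matroid.coordSum G y - c) < 0) :
    ∃ x, IsInner M x ∧ Matroid.coordSum F x = r ∧ Matroid.coordSum G x = c := by
  set p := Matroid.coordSum G u with hp
  set q := Matroid.coordSum G y with hq
  have hne : q - p ≠ 0 := by
    intro h₀
    rw [sub_eq_zero.1 h₀] at h
    exact h.not_ge (mul_self_nonneg _)
  obtain ⟨hs, ht⟩ : 0 < (q - c) / (q - p) ∧ 0 < (c - p) / (q - p) := by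
    rcases mul_neg_iff.1 h with ⟨hpc, hqc⟩ | ⟨hpc, hqc⟩
    · exact ⟨div_pos_of_neg_of_neg hqc (by linarith),
        div_pos_of_neg_of_neg (by linarith) (by linarith)⟩
    · exact ⟨div_pos hqc (by linarith), div_pos (by linarith) (by linarith)⟩
  have hst : (q - c) / (q - p) + (c - p) / (q - p) = 1 := by
    field_simp
    ring
  refine ⟨_, hu.combo hy hs ht.le hst, ?_, ?_⟩
  · rw [map_add, map_smul, map_smul, huF, hyF, ← add_smul, hst, one_smul]
  · rw [map_add, map_smul, map_smul, ← hp, ← hq, smul_eq_mul, smul_eq_mul]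
    field_simp
    ring

variable [M.Finite]

lemma not_isInner_of_isSplit (hM : M.IsSplit) (hF : M.IsSplitFlacet F) (hG : M.IsSplitFlacet G)
    (hne : M.splitHyperplane F ≠ M.splitHyperplane G) (hxF : Matroid.coordSum F x = M.natRk F)
    (hxG : Matroid.coordSum G x = M.natRk G) : ¬ IsInner M x := fun hx =>
  Set.disjoint_left.1 (hM F G hF hG hne) ⟨⟨hx.1, hxF⟩, ⟨hx.1, hxG⟩⟩ hx.mem_intrinsicInterior

lemma coordSum_eq_of_forall_notMem (hF : (F : Set α) ⊆ M.E)
    (hx : x ∈ affineSpan ℝ M.basePolytope) (hy : y ∈ affineSpan ℝ M.basePolytope)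
    (hxy : ∀ a ∈ M.E, a ∉ F → x a = y a) : Matroid.coordSum F x = Matroid.coordSum F y := by
  classical
  rw [← sub_eq_zero, ← map_sub, coordSum_apply]
  have hground := coordSum_eq_zero_of_saturated (F := M.ground_finite.toFinset)
    (fun _ _ _ hb _ _ => M.ground_finite.mem_toFinset.2 hb) (sub_mem_baseDirection hx hy)
  rw [coordSum_apply] at hground
  rw [← hground]
  refine Finset.sum_subset (fun a ha => M.ground_finite.mem_toFinset.2 (hF ha)) fun a ha haF => ?_
  rw [Pi.sub_apply, hxy a (M.ground_finite.mem_toFinset.1 ha) haF, sub_self]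

variable [DecidableEq α] {X Y : Finset α} {e f e' f' : α}

lemma piecewise_classFinset_mem_affineSpan (hx : x ∈ affineSpan ℝ M.basePolytope)
    (hy : y ∈ affineSpan ℝ M.basePolytope) (e : α) :
    (classFinset M e).piecewise x y ∈ affineSpan ℝ M.basePolytope := by
  have heq : (classFinset M e).piecewise x y =
      y + (classFinset M e : Set α).indicator (x - y) := by
    ext a
    by_cases ha : a ∈ classFinset M e <;> simp [ha]
  rw [heq]
  exact add_mem_affineSpan hy
    (indicator_classFinset_mem_baseDirection (sub_mem_baseDirection hx hy) e)

lemma IsInner.piecewise_classFinset (hx : IsInner M x) (hy : IsInner M y) (e : α) :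
    IsInner M ((classFinset M e).piecewise x y) := by
  refine ⟨piecewise_classFinset_mem_affineSpan hx.1 hy.1 e, fun a => ?_⟩
  by_cases ha : a ∈ classFinset M e
  · rw [Finset.piecewise_eq_of_mem _ _ _ ha]
    exact hx.2 a
  · rw [Finset.piecewise_eq_of_notMem _ _ _ ha]
    exact hy.2 a

namespace ExchangeCut

lemma coordSum_piecewise_left (h : ExchangeCut M X F e f) (hx : x ∈ affineSpan ℝ M.basePolytope)
    (hy : y ∈ affineSpan ℝ M.basePolytope) :
    Matroid.coordSum F ((classFinset M e).piecewise x y) = Matroid.coordSum F x :=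
  coordSum_eq_of_forall_notMem h.subset_ground (piecewise_classFinset_mem_affineSpan hx hy e) hx
    fun _ ha haF => Finset.piecewise_eq_of_mem _ _ _ (h.mem_classFinset_of_notMem ha haF)

lemma coordSum_piecewise_right (h : ExchangeCut M X F e f) (hne : ¬ SameClass M e e')
    (hx : x ∈ affineSpan ℝ M.basePolytope) (hy : y ∈ affineSpan ℝ M.basePolytope) :
    Matroid.coordSum F ((classFinset M e').piecewise x y) = Matroid.coordSum F y := by
  refine coordSum_eq_of_forall_notMem h.subset_ground
    (piecewise_classFinset_mem_affineSpan hx hy e') hy fun a ha haF =>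
      Finset.piecewise_eq_of_notMem _ _ _ fun hae' => hne ?_
  exact (mem_classFinset.1 (h.mem_classFinset_of_notMem ha haF)).2.symm.trans
    (mem_classFinset.1 hae').2

lemma sameClass_of_isSplit (hM : M.IsSplit) (h : ExchangeCut M X F e f)
    (h' : ExchangeCut M Y G e' f') : SameClass M e' e := by
  by_contra hne
  obtain ⟨u, hu, huF⟩ := h.exists_isInner
  obtain ⟨u', hu', huG⟩ := h'.exists_isInner
  -- Since the coordinates of different classes are independent, `u` and `u'` can be glued.
  refine not_isInner_of_isSplit hM h.isSplitFlacet h'.isSplitFlacet (fun heq => ?_)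
    ((h.coordSum_piecewise_left hu.1 hu'.1).trans huF)
    ((h'.coordSum_piecewise_right hne hu.1 hu'.1).trans huG) (hu.piecewise_classFinset hu' e)
  obtain ⟨Z, hZ, hlt⟩ := h.exists_isBase_card_lt
  have hZ' := indicator_mem_affineSpan hZ
  have hmem : (classFinset M e).piecewise ((Z : Set α).indicator 1) u' ∈ M.splitHyperplane F :=
    heq ▸ ⟨piecewise_classFinset_mem_affineSpan hZ' hu'.1 e,
      (h'.coordSum_piecewise_right hne hZ' hu'.1).trans huG⟩
  have hcard := hmem.2
  rw [h.coordSum_piecewise_left hZ' hu'.1, coordSum_indicator] at hcard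
  exact hlt.ne (by exact_mod_cast hcard)

end ExchangeCut

end SplitHyperplanes

section ClassRank

variable {α : Type*} [DecidableEq α] {M : Matroid α} [M.Finite] {X Y F G : Finset α}
  {e f e' f' : α}

lemma card_sdiff_classFinset (hX : M.IsBase X) (hY : M.IsBase Y) (e : α) :
    (X \ classFinset M e).card = (Y \ classFinset M e).card := by
  have hX' := Finset.card_inter_add_card_sdiff X (classFinset M e)
  have hY' := Finset.card_inter_add_card_sdiff Y (classFinset M e)
  have := card_inter_classFinset hX hY e
  have := card_eq_of_isBase hX hY
  omega

omit [M.Finite] in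
lemma sdiff_union_inter_card {C S T : Finset α} (hT : X \ C ⊆ T) (hS : S ⊆ C) :
    ((X \ C ∪ S) ∩ T).card = (X \ C).card + (S ∩ (T ∩ C)).card := by
  have hsplit : (X \ C ∪ S) ∩ T = X \ C ∪ S ∩ (T ∩ C) := by grind
  rw [hsplit, Finset.card_union_of_disjoint]
  exact Finset.disjoint_left.2 fun a ha haS => by grind

namespace ExchangeCut

lemma left_mem_classFinset (h : ExchangeCut M X F e f) : e ∈ classFinset M e :=
  h.mem_classFinset_of_notMem (h.isBase.subset_ground h.left_mem) h.left_notMem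

lemma right_mem_classFinset (h : ExchangeCut M X F e f) : f ∈ classFinset M e :=
  mem_classFinset.2 ⟨h.subset_ground h.right_mem, h.sameClass.symm⟩

lemma sdiff_classFinset_subset (h : ExchangeCut M X F e f) (hY : M.IsBase Y) :
    Y \ classFinset M e ⊆ F := by
  intro a ha
  rw [Finset.mem_sdiff] at ha
  by_contra haF
  exact ha.2 (h.mem_classFinset_of_notMem (hY.subset_ground ha.1) haF)

lemma card_inter_eq (h : ExchangeCut M X F e f) (hY : M.IsBase Y) :
    (Y ∩ F).card = (Y \ classFinset M e).card + (Y ∩ (F ∩ classFinset M e)).card := by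
  have hsub := h.sdiff_classFinset_subset hY
  have hsplit := sdiff_union_inter_card hsub (Finset.inter_subset_right (s₁ := Y))
  rw [Finset.sdiff_union_inter] at hsplit
  rw [hsplit, Finset.inter_assoc, Finset.inter_eq_right.2 Finset.inter_subset_right]

lemma natRk_inter_classFinset (h : ExchangeCut M X F e f) (c : α) :
    M.natRk (F ∩ classFinset M c) = (X ∩ (F ∩ classFinset M c)).card := by
  have hE {b : α} (hb : b ∈ F ∩ classFinset M c) : b ∈ M.E :=
    h.subset_ground (Finset.mem_inter.1 hb).1
  have hbasis : M.IsBasis (X ∩ (F ∩ classFinset M c) : Finset α)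
      (F ∩ classFinset M c : Finset α) := by
    refine (h.isBase.indep.subset (by simp)).isBasis_of_subset_of_subset_closure
      (Finset.coe_subset.2 Finset.inter_subset_right) fun b hb => ?_
    rw [Finset.mem_coe] at hb
    by_cases hbX : b ∈ X
    · exact M.mem_closure_of_mem' (by exact_mod_cast Finset.mem_inter.2 ⟨hbX, hb⟩) (hE hb)
    · refine mem_closure_of_forall_isExchange h.isBase (hE hb) hbX fun a hab => ?_
      have haE := h.isBase.subset_ground hab.mem
      obtain ⟨hbF, hbc⟩ := Finset.mem_inter.1 hb
      have hac := (hab.sameClass h.isBase).trans (mem_classFinset.1 hbc).2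
      refine M.mem_closure_of_mem' (Finset.mem_coe.2 ?_) haE
      exact Finset.mem_inter.2 ⟨hab.mem, Finset.mem_inter.2
        ⟨h.mem_of_isExchange hab hbF, mem_classFinset.2 ⟨haE, hac⟩⟩⟩
  rw [Matroid.natRk, ← hbasis.encard_eq_eRk, Set.encard_coe_eq_coe_finsetCard, ENat.toNat_natCast]

lemma natRk_eq_add (h : ExchangeCut M X F e f) (hY : M.IsBase Y) :
    M.natRk F = (Y \ classFinset M e).card + M.natRk (F ∩ classFinset M e) := by
  rw [h.natRk_eq, h.card_inter_eq h.isBase, h.natRk_inter_classFinset,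
    card_sdiff_classFinset h.isBase hY]

lemma card_inter_inter_classFinset_lt (h : ExchangeCut M X F e f) (hY : M.IsBase Y)
    (hlt : (Y ∩ F).card < M.natRk F) :
    (Y ∩ (F ∩ classFinset M e)).card < M.natRk (F ∩ classFinset M e) := by
  rw [h.natRk_eq_add hY, h.card_inter_eq hY] at hlt
  omega

lemma card_inter_inter_classFinset_eq (h : ExchangeCut M X F e f) (hY : M.IsBase Y)
    (heq : (Y ∩ F).card = M.natRk F) :
    (Y ∩ (F ∩ classFinset M e)).card = M.natRk (F ∩ classFinset M e) := by
  rw [h.natRk_eq_add hY, h.card_inter_eq hY] at heq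
  omega

lemma natRk_inter_classFinset_lt_card (h : ExchangeCut M X F e f) :
    M.natRk (F ∩ classFinset M e) < (F ∩ classFinset M e).card := by
  rw [h.natRk_inter_classFinset]
  refine Finset.card_lt_card ⟨Finset.inter_subset_right, fun hsub => h.right_notMem ?_⟩
  exact (Finset.mem_inter.1
    (hsub (Finset.mem_inter.2 ⟨h.right_mem, h.right_mem_classFinset⟩))).1

lemma natRk_inter_classFinset_lt_card_inter (h : ExchangeCut M X F e f) (hY : M.IsBase Y) :
    M.natRk (F ∩ classFinset M e) < (Y ∩ classFinset M e).card := by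
  rw [h.natRk_inter_classFinset, card_inter_classFinset hY h.isBase]
  refine Finset.card_lt_card ⟨Finset.inter_subset_inter_left Finset.inter_subset_right,
    fun hsub => h.left_notMem ?_⟩
  have he := hsub (Finset.mem_inter.2 ⟨h.left_mem, h.left_mem_classFinset⟩)
  exact (Finset.mem_inter.1 (Finset.mem_inter.1 he).2).1

lemma card_inter_classFinset_add_card_le (h : ExchangeCut M X F e f) :
    (X ∩ classFinset M e).card + (F ∩ classFinset M e).card ≤
      (classFinset M e).card + M.natRk (F ∩ classFinset M e) := by
  rw [h.natRk_inter_classFinset, ← Finset.card_union_add_card_inter]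
  exact Nat.add_le_add (Finset.card_le_card (by grind)) (Finset.card_le_card (by grind))

lemma indicator_sub_indicator_eq (h : ExchangeCut M X F e f) {s : ℝ}
    (hs : ∀ v ∈ baseDirection M, Matroid.coordSum G v = s * Matroid.coordSum F v) {a : α}
    (ha : a ∈ classFinset M e) :
    ((if f ∈ G then 1 else 0) - (if a ∈ G then 1 else 0) : ℝ) =
      s * (1 - (if a ∈ F then 1 else 0)) := by
  have hv := hs _ ((mem_classFinset.1 ha).2.trans h.sameClass)
  rwa [coordSum_exchangeVector, coordSum_exchangeVector, if_pos h.right_mem] at hv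

lemma eq_of_forall_mem_classFinset (h : ExchangeCut M X F e f) (h' : ExchangeCut M Y G e' f')
    (hsame : SameClass M e' e) (hFG : ∀ a ∈ classFinset M e, (a ∈ F ↔ a ∈ G)) : F = G := by
  have mem_iff {a : α} (ha : a ∉ classFinset M e) : (a ∈ F ↔ a ∈ M.E) ∧ (a ∈ G ↔ a ∈ M.E) :=
    ⟨⟨fun haF => h.subset_ground haF, fun haE => by_contra fun haF =>
        ha (h.mem_classFinset_of_notMem haE haF)⟩,
      ⟨fun haG => h'.subset_ground haG, fun haE => by_contra fun haG =>
        ha (hsame.classFinset_eq ▸ h'.mem_classFinset_of_notMem haE haG)⟩⟩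
  ext a
  by_cases ha : a ∈ classFinset M e
  · exact hFG a ha
  · exact (mem_iff ha).1.trans (mem_iff ha).2.symm

lemma mem_iff_notMem_of_coordSum_eq_mul (h : ExchangeCut M X F e f)
    (h' : ExchangeCut M Y G e' f') (hsame : SameClass M e' e) (hFG : F ≠ G) {s : ℝ}
    (hs : ∀ v ∈ baseDirection M, Matroid.coordSum G v = s * Matroid.coordSum F v) {a : α}
    (ha : a ∈ classFinset M e) : a ∈ F ↔ a ∉ G := by
  have hle := h.indicator_sub_indicator_eq hs (hsame.classFinset_eq ▸ h'.left_mem_classFinset)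
  have hri := h.indicator_sub_indicator_eq hs (hsame.classFinset_eq ▸ h'.right_mem_classFinset)
  rw [if_neg h'.left_notMem] at hle
  rw [if_pos h'.right_mem] at hri
  by_cases hfG : f ∈ G
  · rw [if_pos hfG] at hle
    have hs₁ : s = 1 := by
      split_ifs at hle <;> linarith
    refine absurd (h.eq_of_forall_mem_classFinset h' hsame fun b hb => ?_) hFG
    have hb' := h.indicator_sub_indicator_eq hs hb
    rw [if_pos hfG, hs₁] at hb'
    by_cases hbF : b ∈ F <;> by_cases hbG : b ∈ G <;> simp [hbF, hbG] at hb' ⊢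
  · rw [if_neg hfG] at hri
    have hs₁ : s = -1 := by
      split_ifs at hri <;> linarith
    have ha' := h.indicator_sub_indicator_eq hs ha
    rw [if_neg hfG, hs₁] at ha'
    by_cases haF : a ∈ F <;> by_cases haG : a ∈ G <;> simp [haF, haG] at ha' ⊢

lemma exists_isTightBase_card_lt (h : ExchangeCut M X F e f) (h' : ExchangeCut M Y G e' f')
    (hsame : SameClass M e' e) (hFG : F ≠ G)
    (hlt : M.natRk (F ∩ classFinset M e) + M.natRk (G ∩ classFinset M e) <
      ((F ∩ classFinset M e) ∩ (G ∩ classFinset M e)).card + (X ∩ classFinset M e).card) :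
    ∃ Z, IsTightBase M F Z ∧ (Z ∩ G).card < M.natRk G := by
  by_contra! hge
  have htight {Z : Finset α} (hZ : IsTightBase M F Z) : (Z ∩ G).card = M.natRk G :=
    (card_inter_le_natRk hZ.1 G).antisymm (hge Z hZ)
  obtain ⟨s, hs⟩ := h.exists_coordSum_eq_mul fun Z hZ hZF =>
    (htight ⟨hZ, hZF⟩).trans (htight h.isTightBase).symm
  have hcompl {a : α} (ha : a ∈ classFinset M e) : a ∈ F ↔ a ∉ G :=
    h.mem_iff_notMem_of_coordSum_eq_mul h' hsame hFG hs ha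
  have hempty : (F ∩ classFinset M e) ∩ (G ∩ classFinset M e) = ∅ := by
    ext a
    have := @hcompl a
    simp only [Finset.mem_inter, Finset.notMem_empty]
    tauto
  have hsum := card_inter_add_card_inter_of_compl (T := X ∩ classFinset M e) (H := F) (K := G)
    fun a ha => hcompl (Finset.mem_inter.1 ha).2
  have hF := card_inter_le_natRk h.isBase (F ∩ classFinset M e)
  have hG := card_inter_le_natRk h.isBase (G ∩ classFinset M e)
  rw [Finset.inter_assoc, Finset.inter_assoc, Finset.inter_comm _ F, Finset.inter_comm _ G] at hsum
  rw [hempty, Finset.card_empty] at hlt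
  omega

end ExchangeCut

end ClassRank

section Separation

variable {α : Type*} [DecidableEq α]

lemma exists_subset_card_inter_eq_min {A B : Finset α} {n : ℕ} (hAB : A ⊆ B) (hn : n ≤ B.card) :
    ∃ S ⊆ B, S.card = n ∧ (S ∩ A).card = min n A.card := by
  rcases le_total n A.card with hle | hle
  · obtain ⟨S, hSA, hS⟩ := Finset.exists_subset_card_eq hle
    exact ⟨S, hSA.trans hAB, hS, by rw [Finset.inter_eq_left.2 hSA, hS, min_eq_left hle]⟩
  · obtain ⟨S, hAS, hSB, hS⟩ := Finset.exists_subsuperset_card_eq hAB hle hn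
    exact ⟨S, hSB, hS, by rw [Finset.inter_eq_right.2 hAS, min_eq_right hle]⟩

lemma exists_finset_card_inter {C H K : Finset α} {n h k : ℕ} (hH : H ⊆ C) (hK : K ⊆ C)
    (hh : h ≤ H.card) (hhn : h ≤ n) (hn : n + H.card ≤ C.card + h) (hk : k < K.card)
    (hkn : k < n) (hinter : h + k < (H ∩ K).card + n) (hsdiff : k < (K \ H).card + h) :
    ∃ S ⊆ C, S.card = n ∧ (S ∩ H).card = h ∧ k < (S ∩ K).card := by
  have hcardC := Finset.card_sdiff_add_card_eq_card hH
  have hcardK := Finset.card_inter_add_card_sdiff K H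
  rw [Finset.inter_comm] at hcardK
  obtain ⟨S, hS, hSh, hSK⟩ :=
    exists_subset_card_inter_eq_min (Finset.inter_subset_left (s₁ := H) (s₂ := K)) hh
  obtain ⟨T, hT, hTn, hTK⟩ := exists_subset_card_inter_eq_min (n := n - h)
    (Finset.sdiff_subset_sdiff hK (subset_rfl (a := H))) (by omega)
  have hdisj : Disjoint S T := Finset.disjoint_left.2 fun a ha haT => by grind
  refine ⟨S ∪ T, by grind, ?_, ?_, ?_⟩
  · rw [Finset.card_union_of_disjoint hdisj]
    omega
  · rw [← hSh]
    congr 1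
    grind
  · have hsplit : (S ∪ T) ∩ K = S ∩ (H ∩ K) ∪ T ∩ (K \ H) := by grind
    rw [hsplit, Finset.card_union_of_disjoint
      (hdisj.mono Finset.inter_subset_left Finset.inter_subset_left)]
    omega

variable {M : Matroid α} {X Y F G : Finset α} {e f e' f' : α}

lemma indicator_sub_indicator_mem_baseDirection {S T : Finset α}
    (hS : ∀ a ∈ S, SameClass M e a) (hT : ∀ a ∈ T, SameClass M e a) (hST : S.card = T.card) :
    (S : Set α).indicator 1 - (T : Set α).indicator 1 ∈ baseDirection M := by
  have sub_smul_mem {S : Finset α} (hS : ∀ a ∈ S, SameClass M e a) :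
      (S : Set α).indicator 1 - S.card • Pi.single e (1 : ℝ) ∈ baseDirection M := by
    have hsum : (S : Set α).indicator (1 : α → ℝ) = ∑ a ∈ S, Pi.single a 1 := by
      ext b
      simp [Finset.sum_apply, Pi.single_apply, Set.indicator_apply]
    rw [hsum, ← Finset.sum_const, ← Finset.sum_sub_distrib]
    exact Submodule.sum_mem _ hS
  have hsub := Submodule.sub_mem _ (sub_smul_mem hS) (sub_smul_mem hT)
  rwa [hST, sub_sub_sub_cancel_right] at hsub

variable [M.Finite]

lemma indicator_sdiff_union_mem_ambientPolytope (hX : M.IsBase X) {S : Finset α}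
    (hS : S ⊆ classFinset M e) (hcard : S.card = (X ∩ classFinset M e).card) :
    ((X \ classFinset M e ∪ S : Finset α) : Set α).indicator 1 ∈ M.ambientPolytope := by
  refine ⟨?_, Set.indicator_nonneg (fun _ _ => zero_le_one),
    Set.indicator_le_self' (fun _ _ => zero_le_one)⟩
  have heq : ((X \ classFinset M e ∪ S : Finset α) : Set α).indicator (1 : α → ℝ) =
      (X : Set α).indicator 1 + ((S : Set α).indicator 1 -
        ((X ∩ classFinset M e : Finset α) : Set α).indicator 1) := by
    ext a
    have := @hS a
    by_cases haX : a ∈ X <;> by_cases haC : a ∈ classFinset M e <;> by_cases haS : a ∈ S <;>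
      simp_all
  rw [heq]
  exact add_mem_affineSpan (indicator_mem_affineSpan hX) (indicator_sub_indicator_mem_baseDirection
    (e := e) (fun a ha => (mem_classFinset.1 (hS ha)).2.symm)
    (fun a ha => (mem_classFinset.1 (Finset.mem_inter.1 ha).2).2.symm) hcard)

namespace ExchangeCut

lemma exists_mem_ambientPolytope (h : ExchangeCut M X F e f) (h' : ExchangeCut M Y G e' f')
    (hsame : SameClass M e' e) (hFG : F ≠ G)
    (hlt : M.natRk (F ∩ classFinset M e) + M.natRk (G ∩ classFinset M e) <
      ((F ∩ classFinset M e) ∩ (G ∩ classFinset M e)).card + (X ∩ classFinset M e).card) :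
    ∃ z ∈ M.ambientPolytope, Matroid.coordSum F z = M.natRk F ∧
      (M.natRk G : ℝ) < Matroid.coordSum G z := by
  have hC := hsame.classFinset_eq
  have hX := h.isBase
  have hsdiff : M.natRk (G ∩ classFinset M e) <
      ((G ∩ classFinset M e) \ (F ∩ classFinset M e)).card + M.natRk (F ∩ classFinset M e) := by
    obtain ⟨Z, hZG, hZF⟩ := h'.exists_isTightBase_card_lt h hsame.symm hFG.symm (by
      rw [hC, Finset.inter_comm (G ∩ _), card_inter_classFinset h'.isBase hX e]
      omega)
    have hZF' := h.card_inter_inter_classFinset_lt hZG.1 hZF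
    have hZG' := h'.card_inter_inter_classFinset_eq hZG.1 hZG.2
    rw [hC] at hZG'
    have hle : Z ∩ (G ∩ classFinset M e) ⊆ Z ∩ (F ∩ classFinset M e) ∪
        (G ∩ classFinset M e) \ (F ∩ classFinset M e) := by grind
    have := (Finset.card_le_card hle).trans (Finset.card_union_le _ _)
    omega
  have hG := h'.natRk_inter_classFinset_lt_card
  have hGX := h'.natRk_inter_classFinset_lt_card_inter hX
  have hrkG := h'.natRk_eq_add hX
  have hsub := h'.sdiff_classFinset_subset hX
  rw [hC] at hG hGX hrkG hsub
  obtain ⟨S, hSC, hS, hSF, hSG⟩ := exists_finset_card_inter Finset.inter_subset_right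
    Finset.inter_subset_right
    (h.natRk_inter_classFinset e ▸ Finset.card_le_card Finset.inter_subset_right)
    (h.natRk_inter_classFinset e ▸
      Finset.card_le_card (Finset.inter_subset_inter_left Finset.inter_subset_right))
    (Nat.add_comm _ _ ▸ h.card_inter_classFinset_add_card_le) hG hGX (by omega) hsdiff
  refine ⟨_, indicator_sdiff_union_mem_ambientPolytope hX hSC hS, ?_, ?_⟩
  · rw [coordSum_indicator, sdiff_union_inter_card (h.sdiff_classFinset_subset hX) hSC, hSF,
      h.natRk_eq_add hX]
  · rw [coordSum_indicator, sdiff_union_inter_card hsub hSC, hrkG]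
    exact_mod_cast Nat.add_lt_add_left hSG _

lemma card_inter_add_le (hM : M.IsSplit) (h : ExchangeCut M X F e f)
    (h' : ExchangeCut M Y G e' f') (hFG : F ≠ G) :
    ((F ∩ classFinset M e) ∩ (G ∩ classFinset M e)).card + (X ∩ classFinset M e).card ≤
      M.natRk (F ∩ classFinset M e) + M.natRk (G ∩ classFinset M e) := by
  by_contra! hlt
  have hsame := h.sameClass_of_isSplit hM h'
  obtain ⟨Z, ⟨hZ, hZF⟩, hZG⟩ := h.exists_isTightBase_card_lt h' hsame hFG hlt
  obtain ⟨z, hz, hzF, hzG⟩ := h.exists_mem_ambientPolytope h' hsame hFG hlt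
  have hZF' : Matroid.coordSum F ((Z : Set α).indicator 1) = M.natRk F := by
    rw [coordSum_indicator, hZF]
  have hZG' : Matroid.coordSum G ((Z : Set α).indicator 1) < M.natRk G := by
    rw [coordSum_indicator]
    exact_mod_cast hZG
  have hne : M.splitHyperplane F ≠ M.splitHyperplane G := fun heq =>
    hZG'.ne (heq.subset ⟨indicator_mem_affineSpan hZ, hZF'⟩).2
  -- On the hyperplane of `F`, the base `Z` and the point `z` lie on different sides of that of `G`.
  obtain ⟨u, hu, huF⟩ := h.exists_isInner
  obtain ⟨x, hx, hxF, hxG⟩ : ∃ x, IsInner M x ∧ Matroid.coordSum F x = M.natRk F ∧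
      Matroid.coordSum G x = M.natRk G := by
    rcases lt_trichotomy (Matroid.coordSum G u) (M.natRk G) with hlt | heq | hgt
    · exact hu.exists_isInner hz huF hzF (mul_neg_of_neg_of_pos (sub_neg.2 hlt) (sub_pos.2 hzG))
    · exact ⟨u, hu, huF, heq⟩
    · exact hu.exists_isInner (indicator_mem_ambientPolytope hZ) huF hZF'
        (mul_neg_of_pos_of_neg (sub_pos.2 hgt) (sub_neg.2 hZG'))
  exact not_isInner_of_isSplit hM h.isSplitFlacet h'.isSplitFlacet hne hxF hxG hx

end ExchangeCut

end Separation

/-! ### Split matroids -/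

section IsSplit

variable {α : Type*} [DecidableEq α] {M : Matroid α} [M.Finite]
  {D X X₁ X₂ X₀ B₁ B₂ F F₀ : Finset α} {a b e₀ f₀ p : α}

/-- The split system on the class of `e₀` in a split matroid: its hyperedges are the traces of the
split flacets that arise from exchange cuts. -/
noncomputable def ExchangeCut.splitSystem (hM : M.IsSplit) (h₀ : ExchangeCut M X₀ F₀ e₀ f₀) :
    SplitSystem M where
  ground := classFinset M e₀
  rank := (X₀ ∩ classFinset M e₀).card
  edges := {H | ∃ X F e f, ExchangeCut M X F e f ∧ H = F ∩ classFinset M e₀}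
  bound := M.natRk
  card_inter_ground _ hX := card_inter_classFinset hX h₀.isBase e₀
  subset_ground := by
    rintro _ ⟨X, F, e, f, -, rfl⟩
    exact Finset.inter_subset_right
  card_inter_le _ hX H _ := card_inter_le_natRk hX H
  card_inter_add_rank_le := by
    rintro _ ⟨X, F, e, f, h, rfl⟩ _ ⟨Y, G, e', f', h', rfl⟩ hne
    have hle := h.card_inter_add_le hM h' fun hFG => hne (by rw [hFG])
    rwa [(h₀.sameClass_of_isSplit hM h).classFinset_eq,
      card_inter_classFinset h.isBase h₀.isBase e₀] at hle
  exists_blocking X hX e f he heC hf hfC hef := by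
    have he' := mem_classFinset.1 heC
    have hf' := mem_classFinset.1 hfC
    obtain ⟨F, h⟩ := exists_exchangeCut hX he hf'.1 hf (fun hex => hef hex.isBase)
      (he'.2.trans hf'.2.symm)
    exact ⟨_, ⟨X, F, e, f, h, rfl⟩, (h.natRk_inter_classFinset e₀).symm,
      fun hmem => h.left_notMem (Finset.mem_inter.1 hmem).1,
      Finset.mem_inter.2 ⟨h.right_mem, hfC⟩⟩

omit [M.Finite] in
/-- A split system is complete if its ground set is a union of classes and any two elements of a
class outside of its ground set can be exchanged. -/
structure SplitSystem.IsComplete (S : SplitSystem M) : Prop where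
  mem_ground : ∀ ⦃a b⦄, b ∈ M.E → SameClass M a b → a ∈ S.ground → b ∈ S.ground
  isBase_exchange : ∀ ⦃X : Finset α⦄, M.IsBase X → ∀ ⦃a b⦄, a ∈ X → b ∈ M.E → b ∉ X →
    SameClass M a b → a ∉ S.ground → M.IsBase (exchange X a b)

lemma ExchangeCut.isComplete_splitSystem (hM : M.IsSplit) (h₀ : ExchangeCut M X₀ F₀ e₀ f₀) :
    (h₀.splitSystem hM).IsComplete where
  mem_ground _ _ hb hab ha := mem_classFinset.2 ⟨hb, hab.symm.trans (mem_classFinset.1 ha).2⟩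
  isBase_exchange X hX a b ha hb hbX hab haC := by
    by_contra hbad
    obtain ⟨F, h⟩ := exists_exchangeCut hX ha hb hbX (fun hex => hbad hex.isBase) hab
    exact haC (mem_classFinset.2 ⟨hX.subset_ground ha, h₀.sameClass_of_isSplit hM h⟩)

lemma exists_splitSystem_isComplete (hM : M.IsSplit) : ∃ S : SplitSystem M, S.IsComplete := by
  by_cases hcut : ∃ X F e f, ExchangeCut M X F e f
  · obtain ⟨X₀, F₀, e₀, f₀, h₀⟩ := hcut
    exact ⟨h₀.splitSystem hM, h₀.isComplete_splitSystem hM⟩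
  · let S : SplitSystem M := ⟨∅, 0, ∅, 0, by simp, by simp, by simp, by simp, by simp⟩
    refine ⟨S, fun a b _ _ ha => (Finset.notMem_empty a ha).elim, ?_⟩
    intro X hX a b ha hb hbX hab _
    by_contra hbad
    obtain ⟨F, h⟩ := exists_exchangeCut hX ha hb hbX (fun hex => hbad hex.isBase) hab
    exact hcut ⟨X, F, a, b, h⟩

namespace ExchangePair

lemma exists_sameClass (h : ExchangePair M D X₁ X₂ B₁ B₂) (hp : p ∈ X₁ \ B₁) :
    ∃ q ∈ X₂ \ B₂, SameClass M p q := by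
  have hcard := card_inter_add_card_sdiff_inter X₁ B₁ (classFinset M p)
  rw [card_inter_classFinset h.isBase₁ h.isBase_target₁ p, ← h.sdiff₂] at hcard
  have hpos : 0 < ((X₁ \ B₁) ∩ classFinset M p).card :=
    Finset.card_pos.2 ⟨p, Finset.mem_inter.2 ⟨hp, mem_classFinset.2
      ⟨h.isBase₁.subset_ground (Finset.mem_sdiff.1 hp).1, SameClass.refl M p⟩⟩⟩
  obtain ⟨q, hq⟩ := Finset.card_pos.1 (show 0 < ((X₂ \ B₂) ∩ classFinset M p).card by omega)
  rw [Finset.mem_inter, mem_classFinset] at hq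
  exact ⟨q, hq.1, hq.2.2.symm⟩

lemma exists_exchange_of_notMem_ground {S : SplitSystem M} (hS : S.IsComplete)
    (h : ExchangePair M D X₁ X₂ B₁ B₂) (hp : p ∈ X₁ \ B₁) (hpS : p ∉ S.ground) :
    ∃ q ∈ X₂ \ B₂, q ∉ S.ground ∧ CanExchange M X₁ X₂ p q := by
  obtain ⟨q, hq, hpq⟩ := h.exists_sameClass hp
  have hpE := h.isBase₁.subset_ground (Finset.mem_sdiff.1 hp).1
  have hqE := h.isBase₂.subset_ground (Finset.mem_sdiff.1 hq).1
  have hqS : q ∉ S.ground := fun hqS => hpS (hS.mem_ground hpE hpq.symm hqS)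
  exact ⟨q, hq, hqS,
    hS.isBase_exchange h.isBase₁ (Finset.mem_sdiff.1 hp).1 hqE (h.symm.notMem₂ hq) hpq hpS,
    hS.isBase_exchange h.isBase₂ (Finset.mem_sdiff.1 hq).1 hpE (h.notMem₂ hp) hpq.symm hqS⟩

lemma restrict_ground {S : SplitSystem M} (hS : S.IsComplete) (h : ExchangePair M D X₁ X₂ B₁ B₂)
    (hsub : X₁ \ B₁ ⊆ S.ground) : ExchangePair M S.ground X₁ X₂ B₁ B₂ where
  __ := h
  subset₁ := hsub
  subset₂ q hq := by
    obtain ⟨p, hp, hqp⟩ := h.symm.exists_sameClass hq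
    exact hS.mem_ground (h.isBase₂.subset_ground (Finset.mem_sdiff.1 hq).1) hqp.symm (hsub hp)

lemma hasStrictlyMonotoneSeq_add {S : SplitSystem M} (hS : S.IsComplete) {m d n : ℕ}
    (hseq : ∀ Y₁ Y₂, ExchangePair M S.ground Y₁ Y₂ B₁ B₂ → (Y₁ ∩ B₁ ∩ S.ground).card = d →
      M.HasStrictlyMonotoneSeq (Y₁, Y₂) (B₁, B₂) m)
    (h : ExchangePair M D X₁ X₂ B₁ B₂) (hd : (X₁ ∩ B₁ ∩ S.ground).card = d)
    (hn : ((X₁ \ B₁) \ S.ground).card = n) :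
    M.HasStrictlyMonotoneSeq (X₁, X₂) (B₁, B₂) (m + n) := by
  induction n generalizing X₁ X₂ with
  | zero =>
    exact hseq X₁ X₂
      (h.restrict_ground hS (Finset.sdiff_eq_empty_iff_subset.1 (Finset.card_eq_zero.1 hn))) hd
  | succ n ih =>
    obtain ⟨p, hp⟩ := Finset.card_pos.1 (show 0 < ((X₁ \ B₁) \ S.ground).card by omega)
    obtain ⟨hpX, hpS⟩ := Finset.mem_sdiff.1 hp
    obtain ⟨q, hq, hqS, hpq⟩ := h.exists_exchange_of_notMem_ground hS hpX hpS
    refine h.hasStrictlyMonotoneSeq_cons hpX hq hpq (ih (h.after_exchange hpX hq hpq) ?_ ?_)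
    · rw [Finset.inter_assoc, card_exchange_inter_of_mem_iff (Finset.mem_sdiff.1 hpX).1
        (h.symm.notMem₂ hq) (by simp [hpS, hqS]), ← Finset.inter_assoc, hd]
    · rw [exchange_sdiff (h.symm.mem_target₂ hq), Finset.erase_sdiff_comm,
        Finset.card_erase_of_mem hp, hn, Nat.add_sub_cancel]

omit [M.Finite] in
lemma card_sdiff_sdiff_add (S : SplitSystem M) (h : ExchangePair M D X₁ X₂ B₁ B₂) :
    ((X₁ \ B₁) \ S.ground).card + S.rank + (X₁ ∩ B₁).card =
      X₁.card + (X₁ ∩ B₁ ∩ S.ground).card := by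
  have hground := S.card_inter_ground h.isBase₁
  have hsplit := card_inter_eq_sdiff_add X₁ B₁ S.ground
  have hsdiff := Finset.card_inter_add_card_sdiff (X₁ \ B₁) S.ground
  have hX₁ := Finset.card_inter_add_card_sdiff X₁ B₁
  omega

lemma hasStrictlyMonotoneSeq_of_forall_ground {S : SplitSystem M} (hS : S.IsComplete) {k : ℕ}
    (hk : 1 ≤ k)
    (hseq : ∀ Y₁ Y₂, ExchangePair M S.ground Y₁ Y₂ B₁ B₂ →
      M.HasStrictlyMonotoneSeq (Y₁, Y₂) (B₁, B₂) (S.rank - k * (Y₁ ∩ B₁ ∩ S.ground).card))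
    (h : ExchangePair M D X₁ X₂ B₁ B₂) :
    M.HasStrictlyMonotoneSeq (X₁, X₂) (B₁, B₂) (X₁.card - k * (X₁ ∩ B₁).card) := by
  refine hasStrictlyMonotoneSeq_of_le (h.hasStrictlyMonotoneSeq_add hS
    (fun Y₁ Y₂ hY hd => hd ▸ hseq Y₁ Y₂ hY) rfl rfl) ?_
  have hcard := h.card_sdiff_sdiff_add S
  obtain ⟨c, hc⟩ := Nat.exists_eq_add_of_le
    (Finset.card_le_card (Finset.inter_subset_left (s₁ := X₁ ∩ B₁) (s₂ := S.ground)))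
  have hkc : c ≤ k * c := Nat.le_mul_of_pos_left c hk
  rw [hc, Nat.mul_add]
  omega

end ExchangePair

lemma hasStrictlyMonotoneSeq_of_isSplit (hM : M.IsSplit) (h : ExchangePair M D X₁ X₂ B₁ B₂) :
    M.HasStrictlyMonotoneSeq (X₁, X₂) (B₁, B₂) (X₁.card - 3 * (X₁ ∩ B₁).card) := by
  obtain ⟨S, hS⟩ := exists_splitSystem_isComplete hM
  exact h.hasStrictlyMonotoneSeq_of_forall_ground hS (by norm_num)
    fun _ _ hY => hY.hasStrictlyMonotoneSeq

lemma hasStrictlyMonotoneSeq_of_isBaseOrderable_of_isSplit (hM : M.IsBaseOrderable)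
    (hM' : M.IsSplit) (h : ExchangePair M D X₁ X₂ B₁ B₂) :
    M.HasStrictlyMonotoneSeq (X₁, X₂) (B₁, B₂) (X₁.card - 2 * (X₁ ∩ B₁).card) := by
  obtain ⟨S, hS⟩ := exists_splitSystem_isComplete hM'
  exact h.hasStrictlyMonotoneSeq_of_forall_ground hS (by norm_num)
    fun _ _ hY => hY.hasStrictlyMonotoneSeq_of_isBaseOrderable hM

end IsSplit

/-! ### Paving matroids -/

section IsPaving

variable {α : Type*} [DecidableEq α] {M : Matroid α} {D T X X₁ X₂ B₁ B₂ : Finset α}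
  {e e' f : α} {n : ℕ}

omit [DecidableEq α] in
lemma indep_of_isPaving_of_card_lt (hM : M.IsPaving) (hX : M.IsBase X) (hT : (T : Set α) ⊆ M.E)
    (hcard : T.card < X.card) : M.Indep T := by
  refine hM T hT ?_
  rw [← hX.encard_eq_eRank, Set.encard_coe_eq_coe_finsetCard, Set.encard_coe_eq_coe_finsetCard]
  exact_mod_cast hcard

lemma exists_isBase_insert (hT : M.Indep T) (hX : M.IsBase X) (hcard : T.card + 1 = X.card) :
    ∃ a ∈ X \ T, M.IsBase (insert a T : Finset α) := by
  obtain ⟨a, ha, hi⟩ := hT.augment hX.indep (by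
    rw [Set.encard_coe_eq_coe_finsetCard, Set.encard_coe_eq_coe_finsetCard]
    exact_mod_cast (by omega : T.card < X.card))
  have haT : a ∉ T := by simpa using ha.2
  refine ⟨a, by simpa using ha, ?_⟩
  rw [← Finset.coe_insert] at hi
  refine hi.isBase_of_eRk_ge (Finset.finite_toSet _) ?_
  rw [← hX.encard_eq_eRank, hi.eRk_eq_encard, Set.encard_coe_eq_coe_finsetCard,
    Set.encard_coe_eq_coe_finsetCard, Finset.card_insert_of_notMem haT, hcard]

lemma isBase_exchange_or_of_isPaving (hM : M.IsPaving) (hX : M.IsBase X) (he : e ∈ X)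
    (he' : e' ∈ X) (hne : e ≠ e') (hf : f ∈ M.E) (hfX : f ∉ X) :
    M.IsBase (exchange X e f) ∨ M.IsBase (exchange X e' f) := by
  have he'X : e' ∈ X.erase e := Finset.mem_erase.2 ⟨hne.symm, he'⟩
  have hcard : (exchange (X.erase e) e' f).card + 1 = X.card := by
    rw [Finset.card_insert_of_notMem (by simp [hfX]), Finset.card_erase_add_one he'X,
      Finset.card_erase_add_one he]
  have hsub : (exchange (X.erase e) e' f : Set α) ⊆ M.E := fun a ha => by
    rcases Finset.mem_insert.1 ha with rfl | ha
    · exact hf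
    · exact hX.subset_ground (Finset.mem_of_mem_erase (Finset.mem_of_mem_erase ha))
  obtain ⟨a, ha, hbase⟩ :=
    exists_isBase_insert (indep_of_isPaving_of_card_lt hM hX hsub (by omega)) hX hcard
  have hee' : a = e ∨ a = e' := by grind
  rcases hee' with rfl | rfl
  · exact .inr (by convert hbase using 2; grind)
  · exact .inl (by convert hbase using 2; grind)

lemma exists_canExchange_of_isPaving (hM : M.IsPaving) (h : ExchangePair M D X₁ X₂ B₁ B₂)
    (h₁ : 2 < (X₁ \ B₁).card) (h₂ : 1 < (X₂ \ B₂).card) :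
    ∃ e ∈ X₁ \ B₁, ∃ f ∈ X₂ \ B₂, CanExchange M X₁ X₂ e f := by
  obtain ⟨f₁, hf₁, f₂, hf₂, hne⟩ := Finset.one_lt_card.1 h₂
  classical
  let bad (f : α) := {e ∈ X₁ \ B₁ | ¬ M.IsBase (exchange X₁ e f)}
  have hbad {f : α} (hf : f ∈ X₂ \ B₂) : (bad f).card ≤ 1 := by
    refine Finset.card_le_one.2 fun e he e' he' => ?_
    obtain ⟨he, hef⟩ := Finset.mem_filter.1 he
    obtain ⟨he', hef'⟩ := Finset.mem_filter.1 he'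
    by_contra hee'
    exact (isBase_exchange_or_of_isPaving hM h.isBase₁ (Finset.mem_sdiff.1 he).1
      (Finset.mem_sdiff.1 he').1 hee' (h.isBase₂.subset_ground (Finset.mem_sdiff.1 hf).1)
      (h.symm.notMem₂ hf)).elim hef hef'
  obtain ⟨e, he, hgood⟩ : ∃ e ∈ X₁ \ B₁, e ∉ bad f₁ ∪ bad f₂ := by
    refine Finset.exists_mem_notMem_of_card_lt_card ?_
    have := Finset.card_union_le (bad f₁) (bad f₂)
    have := hbad hf₁
    have := hbad hf₂
    omega
  obtain ⟨hgood₁, hgood₂⟩ : M.IsBase (exchange X₁ e f₁) ∧ M.IsBase (exchange X₁ e f₂) := by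
    simpa [bad, Finset.mem_sdiff.1 he] using hgood
  rcases isBase_exchange_or_of_isPaving hM h.isBase₂ (Finset.mem_sdiff.1 hf₁).1
    (Finset.mem_sdiff.1 hf₂).1 hne (h.isBase₁.subset_ground (Finset.mem_sdiff.1 he).1)
    (h.notMem₂ he) with hbase | hbase
  · exact ⟨e, he, f₁, hf₁, hgood₁, hbase⟩
  · exact ⟨e, he, f₂, hf₂, hgood₂, hbase⟩

lemma hasStrictlyMonotoneSeq_of_isPaving (hM : M.IsPaving) (h : ExchangePair M D X₁ X₂ B₁ B₂) :
    M.HasStrictlyMonotoneSeq (X₁, X₂) (B₁, B₂) ((X₁ \ B₁).card - 2) := by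
  induction hn : (X₁ \ B₁).card - 2 generalizing X₁ X₂ with
  | zero => exact hasStrictlyMonotoneSeq_zero _ _
  | succ n ih =>
    have hcard := h.card_sdiff_eq
    obtain ⟨e, he, f, hf, hef⟩ := exists_canExchange_of_isPaving hM h (by omega) (by omega)
    refine h.hasStrictlyMonotoneSeq_cons he hf hef (ih (h.after_exchange he hf hef) ?_)
    rw [exchange_sdiff (h.symm.mem_target₂ hf), Finset.card_erase_of_mem he]
    omega

lemma exchangePair_of_compatiblePairs (h : M.CompatiblePairs (X₁, X₂) (B₁, B₂)) :
    ExchangePair M (X₁ ∪ X₂) X₁ X₂ B₁ B₂ := by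
  obtain ⟨hX₁, hX₂, hB₁, hB₂, hinter, hunion⟩ := h
  replace hinter (a : α) : a ∈ X₁ ∧ a ∈ X₂ ↔ a ∈ B₁ ∧ a ∈ B₂ := Set.ext_iff.1 hinter a
  replace hunion (a : α) : a ∈ X₁ ∨ a ∈ X₂ ↔ a ∈ B₁ ∨ a ∈ B₂ := Set.ext_iff.1 hunion a
  refine ⟨hX₁, hX₂, hB₁, hB₂, ?_, ?_, Finset.sdiff_subset.trans Finset.subset_union_left,
    Finset.sdiff_subset.trans Finset.subset_union_right⟩ <;>
  · ext a
    have := hinter a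
    have := hunion a
    simp only [Finset.mem_sdiff]
    tauto

end IsPaving

end SplitMatroid

theorem theorem4p2 {α : Type*} (M : Matroid α) [M.Finite] (r : ℕ) (hr : M.eRank = r)
    (A₁ A₂ B₁ B₂ : Set α) (hAB : M.CompatiblePairs (A₁, A₂) (B₁, B₂)) :
    (M.IsSplit →
      M.HasStrictlyMonotoneSeq (A₁, A₂) (B₁, B₂) (r - 3 * (A₁ ∩ B₁).ncard)) ∧
    (M.IsBaseOrderable → M.IsSplit →
      M.HasStrictlyMonotoneSeq (A₁, A₂) (B₁, B₂) (r - 2 * (A₁ ∩ B₁).ncard)) ∧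
    (M.IsPaving →
      M.HasStrictlyMonotoneSeq (A₁, A₂) (B₁, B₂) (r - (A₁ ∩ B₁).ncard - 2)) := by
  classical
  lift A₁ to Finset α using M.set_finite A₁ hAB.1.subset_ground
  lift A₂ to Finset α using M.set_finite A₂ hAB.2.1.subset_ground
  lift B₁ to Finset α using M.set_finite B₁ hAB.2.2.1.subset_ground
  lift B₂ to Finset α using M.set_finite B₂ hAB.2.2.2.1.subset_ground
  have h := SplitMatroid.exchangePair_of_compatiblePairs hAB
  have hA₁ : A₁.card = r := by
    have hcard := h.isBase₁.encard_eq_eRank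
    rw [hr, Set.encard_coe_eq_coe_finsetCard] at hcard
    exact_mod_cast hcard
  have hsdiff : A₁.card - (A₁ ∩ B₁).card = (A₁ \ B₁).card := by
    rw [← Finset.card_inter_add_card_sdiff A₁ B₁, Nat.add_sub_cancel_left]
  rw [← Finset.coe_inter, Set.ncard_coe_finset, ← hA₁, hsdiff]
  exact ⟨fun hM => SplitMatroid.hasStrictlyMonotoneSeq_of_isSplit hM h,
    fun hM hM' => SplitMatroid.hasStrictlyMonotoneSeq_of_isBaseOrderable_of_isSplit hM hM' h,
    fun hM => SplitMatroid.hasStrictlyMonotoneSeq_of_isPaving hM h⟩
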